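/- Let $\alpha\ge 1$ and $\beta$ be real numbers, let $1<c<\frac{12}{11}$, put $\gamma=1/c$, and let $\varepsilon>0$. For an integer $q\ge1$, an integer $a$ and real $x$, let $$\pi(x;q,a)=\#\{p\le x:\ p \text{ prime},\ p\equiv a \pmod q\},$$ and let $\pi_{\alpha,\beta,c}(x;q,a)$ be the number of primes $p\le x$ with $p\equiv a\pmod q$ such that $p=\lfloor \alpha n^c+\beta\rfloor$ for some integer $n\ge1$. Then there is a constant $C>0$, depending only on $\alpha,\beta,c$ and $\varepsilon$, such that for all coprime integers $a,q$ with $q\ge1$ and all real $x\ge2$, $$\left|\pi_{\alpha,\beta,c}(x;q,a)-\alpha^{-\gamma}\gamma x^{\gamma-1}\pi(x;q,a)-\alpha^{-\gamma}\gamma(1-\gamma)\int_2^x u^{\gamma-2}\pi(u;q,a)\,du\right|\le C\,x^{7\gamma/13+11/26+\varepsilon}.$$ -/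

import Mathlib

/-- The set of terms of the generalized Piatetski-Shapiro sequence
`⌊α n ^ c + β⌋`, `n = 1, 2, 3, …`. -/
def genPiatetskiShapiro (α β c : ℝ) : Set ℤ :=
  {m : ℤ | ∃ n : ℕ, 1 ≤ n ∧ m = ⌊α * (n : ℝ) ^ c + β⌋}

/-- `π(x; q, a)`: the number of primes `p ≤ x` with `p ≡ a (mod q)`. -/
noncomputable def primeCountAP (x : ℝ) (q : ℕ) (a : ℤ) : ℕ :=
  Set.ncard {p : ℕ | p.Prime ∧ (p : ℝ) ≤ x ∧ (p : ℤ) ≡ a [ZMOD (q : ℤ)]}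

/-- `π_{α,β,c}(x; q, a)`: the number of primes `p ≤ x` with `p ≡ a (mod q)` that occur in the
generalized Piatetski-Shapiro sequence. -/
noncomputable def primeCountGPS (α β c x : ℝ) (q : ℕ) (a : ℤ) : ℕ :=
  Set.ncard {p : ℕ | p.Prime ∧ (p : ℝ) ≤ x ∧ (p : ℤ) ∈ genPiatetskiShapiro α β c ∧
    (p : ℤ) ≡ a [ZMOD (q : ℤ)]}

/-! Put κ = α^(-γ). For large p, one has p = ⌊αn^c + β⌋ for some n exactly when [κ(p-β)^γ,
κ(p+1-β)^γ) contains an integer (`mem_genPiatetskiShapiro_iff`). This interval has length at most 1,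
so the indicator equals its length plus a difference of two sawtooth values (`ite_exists_int_eq`).
The length is κγp^(γ-1) + O(p^(γ-2)) (`increment_bounds`). The error is summable, and Abel summation
(`sum_primes_rpow_eq`) turns the rest into the two main terms. It remains to bound sawtooth sums
over primes in a progression.

The sawtooth is trapped between difference quotients of the periodized Bernoulli polynomial, whose
Fourier series converges absolutely (`abs_sum_saw_le`). This leaves exponential sums over primes
with phase hκ(p-β)^γ. The congruence is detected by averaging over additive characters modulo q,
which costs nothing and only adds a linear term θp (`norm_sum_ap_le`). The estimates see only second
derivatives of the phase, so they are uniform in θ, and hence in q and a.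

The exponential sums are treated by Vaughan's identity with both cut-offs near X^(1/6)
(`norm_sum_vonMangoldt_mul_le`). Type I sums, and the correlations left by Cauchy–Schwarz in type II
sums, are bounded by van der Corput's second derivative test, itself a consequence of Kusmin–Landau.
With F = hX^γ the outcome is X^η (X^(11/12) + X^(2/3) F^(1/4) + X^(1/3) F^(1/2))
(`norm_sum_primes_phase_le`).

Smoothing at scale δ = X^(E-1) makes frequencies h up to X^(1-E) decisive. A bound of size X^E then
requires E ≥ 11/12 and 2/3 + γ/4 + (1-E)/4 ≤ E. For E = 7γ/13 + 11/26 each condition says γ ≥ 11/12,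
which is also exactly when E ≤ γ, so that the error does not exceed x^γ. -/

namespace PiatetskiShapiro

/-! ### Additive characters, Kusmin–Landau and van der Corput. -/

section

open Finset

/-- The additive character `e(t) = exp(2πit)`. -/
noncomputable def ex (t : ℝ) : ℂ := Complex.exp ((2 * Real.pi * t : ℝ) * Complex.I)

lemma ex_add (s t : ℝ) : ex (s + t) = ex s * ex t := by
  simp only [ex, ← Complex.exp_add]
  congr 1
  push_cast
  ring

lemma norm_ex (t : ℝ) : ‖ex t‖ = 1 := Complex.norm_exp_ofReal_mul_I _

lemma ex_neg (t : ℝ) : ex (-t) = (starRingEnd ℂ) (ex t) := by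
  simp only [ex, ← Complex.exp_conj, map_mul, Complex.conj_ofReal, Complex.conj_I]
  congr 1
  push_cast
  ring

lemma ex_intCast (k : ℤ) : ex k = 1 := by
  rw [ex, Complex.exp_eq_one_iff]
  exact ⟨k, by push_cast; ring⟩

lemma ex_eq (t : ℝ) : ex t = (Real.cos (2 * Real.pi * t) : ℂ) +
    (Real.sin (2 * Real.pi * t) : ℂ) * Complex.I := by
  rw [ex, Complex.exp_mul_I, Complex.ofReal_cos, Complex.ofReal_sin]

lemma norm_one_sub_ex (t : ℝ) : ‖1 - ex t‖ = 2 * |Real.sin (Real.pi * t)| := by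
  have h : ‖1 - ex t‖ ^ 2 = (2 * |Real.sin (Real.pi * t)|) ^ 2 := by
    rw [ex_eq, ← Complex.normSq_eq_norm_sq, Complex.normSq_apply, mul_pow, sq_abs]
    have h1 : Real.cos (2 * Real.pi * t) = 1 - 2 * Real.sin (Real.pi * t) ^ 2 := by
      rw [mul_assoc, Real.cos_two_mul, Real.cos_sq']
      ring
    have h2 := Real.sin_sq_add_cos_sq (2 * Real.pi * t)
    simp only [Complex.sub_re, Complex.one_re, Complex.add_re, Complex.ofReal_re, Complex.mul_re,
      Complex.I_re, Complex.ofReal_im, Complex.I_im, Complex.sub_im, Complex.one_im,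
      Complex.add_im, Complex.mul_im]
    nlinarith
  exact (sq_eq_sq₀ (norm_nonneg _) (by positivity)).mp h

/-- `1 / (1 - e(t)) = 1/2 + (i/2) cot (π t)`. -/
lemma inv_one_sub_ex {t : ℝ} (ht : Real.sin (Real.pi * t) ≠ 0) :
    (1 - ex t)⁻¹ = 1 / 2 +
      ((Real.cos (Real.pi * t) / Real.sin (Real.pi * t) / 2 : ℝ) : ℂ) * Complex.I := by
  have h1 : Real.cos (2 * Real.pi * t) = 1 - 2 * Real.sin (Real.pi * t) ^ 2 := by
    rw [mul_assoc, Real.cos_two_mul, Real.cos_sq']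
    ring
  have h2 : Real.sin (2 * Real.pi * t) = 2 * Real.sin (Real.pi * t) * Real.cos (Real.pi * t) := by
    rw [mul_assoc, Real.sin_two_mul]
  have h3 : Real.cos (Real.pi * t) ^ 2 = 1 - Real.sin (Real.pi * t) ^ 2 := Real.cos_sq' _
  apply inv_eq_of_mul_eq_one_right
  rw [ex_eq, h1, h2]
  generalize Real.sin (Real.pi * t) = s at *
  generalize Real.cos (Real.pi * t) = c at *
  apply Complex.ext
  · simp [-Complex.ofReal_div, -Complex.ofReal_pow]
    field_simp
    linarith
  · simp [-Complex.ofReal_div, -Complex.ofReal_pow]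
    field_simp
    ring

/-- Cross-multiplied, this is sin(t - s) ≥ 0. Monotonicity of the cotangent is what makes the total
variation telescope in Kusmin–Landau. -/
lemma cot_le_cot {s t : ℝ} (hs : 0 < s) (hst : s ≤ t) (ht : t < Real.pi) :
    Real.cos t / Real.sin t ≤ Real.cos s / Real.sin s := by
  have h1 : 0 < Real.sin s := Real.sin_pos_of_pos_of_lt_pi hs (by linarith)
  have h2 : 0 < Real.sin t := Real.sin_pos_of_pos_of_lt_pi (by linarith) ht
  rw [div_le_div_iff₀ h2 h1]
  have h3 : 0 ≤ Real.sin (t - s) := Real.sin_nonneg_of_nonneg_of_le_pi (by linarith) (by linarith)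
  rw [Real.sin_sub] at h3
  linarith

/-- Jordan's inequality on [0, 1/2], then the symmetry t ↦ 1 - t. -/
lemma two_mul_le_sin_pi_mul {η t : ℝ} (hη : 0 < η) (h1 : η ≤ t) (h2 : t ≤ 1 - η) :
    2 * η ≤ Real.sin (Real.pi * t) := by
  have key : ∀ u : ℝ, η ≤ u → u ≤ 1 / 2 → 2 * η ≤ Real.sin (Real.pi * u) := by
    intro u hu1 hu2
    have := Real.mul_le_sin (x := Real.pi * u) (mul_nonneg Real.pi_pos.le (by linarith))
      (by nlinarith [Real.pi_pos])
    have h : 2 / Real.pi * (Real.pi * u) = 2 * u := by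
      field_simp
    linarith
  by_cases h : t ≤ 1 / 2
  · exact key t h1 h
  · have := key (1 - t) (by linarith) (by linarith)
    rwa [mul_sub, mul_one, Real.sin_pi_sub] at this

/-- The Kusmin–Landau inequality for first differences in `[η, 1 - η]`. -/
lemma kusmin_landau_aux (f : ℕ → ℝ) {a b : ℕ} {η : ℝ} (hη : 0 < η) (hab : a < b)
    (hmono : ∀ n, a ≤ n → n + 1 < b → f (n + 1) - f n ≤ f (n + 2) - f (n + 1))
    (hl : ∀ n, a ≤ n → n < b → η ≤ f (n + 1) - f n)
    (hu : ∀ n, a ≤ n → n < b → f (n + 1) - f n ≤ 1 - η) :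
    ‖∑ n ∈ Ico a b, ex (f n)‖ ≤ 1 / η := by
  -- Summation by parts rests on e(f n) = c n (e(f n) - e(f(n+1))). The real part of c n is
  -- constantly 1/2 and its imaginary part is half a cotangent, monotone in n, so the total
  -- variation of c is a difference of end values.
  set c : ℕ → ℂ := fun n => (1 - ex (f (n + 1) - f n))⁻¹ with hc
  set r : ℕ → ℝ := fun n => Real.cos (Real.pi * (f (n + 1) - f n)) /
    Real.sin (Real.pi * (f (n + 1) - f n)) with hr
  have hsin : ∀ n, a ≤ n → n < b → 2 * η ≤ Real.sin (Real.pi * (f (n + 1) - f n)) :=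
    fun n h1 h2 => two_mul_le_sin_pi_mul hη (hl n h1 h2) (hu n h1 h2)
  have hcr : ∀ n, a ≤ n → n < b → c n = 1 / 2 + ((r n / 2 : ℝ) : ℂ) * Complex.I :=
    fun n h1 h2 => inv_one_sub_ex (by have := hsin n h1 h2; exact (by linarith : (0 : ℝ) < _).ne')
  have hcn : ∀ n, a ≤ n → n < b → ‖c n‖ ≤ 1 / (4 * η) := by
    intro n h1 h2
    have h := hsin n h1 h2
    rw [hc]
    simp only [norm_inv, norm_one_sub_ex, one_div]
    rw [abs_of_pos (by linarith)]
    exact inv_anti₀ (by positivity) (by linarith)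
  have hrn : ∀ n, a ≤ n → n < b → |r n / 2| ≤ 1 / (4 * η) := by
    intro n h1 h2
    refine le_trans ?_ (hcn n h1 h2)
    rw [hcr n h1 h2]
    refine le_trans (le_of_eq ?_) (Complex.abs_im_le_norm _)
    simp
  have hE : ∀ n, a ≤ n → n < b → ex (f n) = c n * ex (f n) - c n * ex (f (n + 1)) := by
    intro n h1 h2
    have h : ex (f (n + 1)) = ex (f n) * ex (f (n + 1) - f n) := by
      rw [← ex_add]
      congr 1
      ring
    have h0 : 1 - ex (f (n + 1) - f n) ≠ 0 := by
      rw [← norm_pos_iff, norm_one_sub_ex]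
      rw [abs_of_pos (by linarith [hsin n h1 h2])]
      linarith [hsin n h1 h2]
    rw [h, hc]
    field_simp
  have hanti : ∀ n, a ≤ n → n + 1 < b → r (n + 1) ≤ r n := by
    intro n h1 h2
    have e1 := hl n h1 (by omega)
    have e2 := hu (n + 1) (by omega) h2
    apply cot_le_cot
    · have := Real.pi_pos
      exact mul_pos this (by linarith)
    · exact mul_le_mul_of_nonneg_left (hmono n h1 h2) Real.pi_pos.le
    · nlinarith [Real.pi_pos]
  -- With the boundary term included, each step adds only (c(k+1) - c k) e(f(k+1)), whose norm is
  -- the drop of r/2.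
  have main : ∀ b', a ≤ b' → b' < b →
      ‖∑ n ∈ Ico a (b' + 1), ex (f n) + c b' * ex (f (b' + 1))‖ ≤
        ‖c a‖ + (r a / 2 - r b' / 2) := by
    intro b' h1
    induction b', h1 using Nat.le_induction with
    | base =>
      intro _
      rw [Nat.Ico_succ_singleton, sum_singleton]
      nth_rewrite 1 [hE a le_rfl hab]
      rw [sub_add_cancel, norm_mul, norm_ex]
      simp
    | succ k hk ih =>
      intro hkb
      have ih' := ih (by omega)
      rw [sum_Ico_succ_top (by omega)]
      have e : ∑ n ∈ Ico a (k + 1), ex (f n) + ex (f (k + 1)) + c (k + 1) * ex (f (k + 1 + 1)) =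
          (∑ n ∈ Ico a (k + 1), ex (f n) + c k * ex (f (k + 1))) +
            (c (k + 1) - c k) * ex (f (k + 1)) := by
        linear_combination hE (k + 1) (by omega) hkb
      rw [e]
      refine (norm_add_le _ _).trans ?_
      have e2 : ‖(c (k + 1) - c k) * ex (f (k + 1))‖ = r k / 2 - r (k + 1) / 2 := by
        rw [norm_mul, norm_ex, mul_one, hcr k hk (by omega), hcr (k + 1) (by omega) hkb]
        rw [add_sub_add_left_eq_sub, ← sub_mul, norm_mul, Complex.norm_I, mul_one,
          ← Complex.ofReal_sub, Complex.norm_real, Real.norm_eq_abs, abs_sub_comm, abs_of_nonneg]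
        linarith [hanti k hk hkb]
      linarith
  obtain ⟨b', rfl⟩ : ∃ b', b = b' + 1 := ⟨b - 1, by omega⟩
  have h1 := main b' (by omega) (by omega)
  have h2 : ‖∑ n ∈ Ico a (b' + 1), ex (f n)‖ ≤
      ‖∑ n ∈ Ico a (b' + 1), ex (f n) + c b' * ex (f (b' + 1))‖ + ‖c b'‖ := by
    have := norm_sub_le (∑ n ∈ Ico a (b' + 1), ex (f n) + c b' * ex (f (b' + 1)))
      (c b' * ex (f (b' + 1)))
    rw [add_sub_cancel_right, norm_mul (c b'), norm_ex, mul_one] at this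
    exact this
  have h3 := hcn a le_rfl hab
  have h4 := hcn b' (by omega) (by omega)
  have h5 := (abs_le.mp (hrn a le_rfl hab)).2
  have h6 := (abs_le.mp (hrn b' (by omega) (by omega))).1
  -- The four end quantities ‖c a‖, ‖c b'‖, |r a / 2|, |r b' / 2| are each at most 1/(4η).
  have h7 : 1 / η = 4 * (1 / (4 * η)) := by field_simp
  rw [h7]
  linarith

/-- The Kusmin–Landau inequality: if the first differences of `f` are nondecreasing and lie in
`[k + η, k + 1 - η]` for an integer `k`, then `|∑ e(f n)| ≤ 1/η`. -/
theorem kusmin_landau (f : ℕ → ℝ) {a b : ℕ} {η : ℝ} (k : ℤ) (hη : 0 < η)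
    (hmono : ∀ n, a ≤ n → n + 1 < b → f (n + 1) - f n ≤ f (n + 2) - f (n + 1))
    (hl : ∀ n, a ≤ n → n < b → k + η ≤ f (n + 1) - f n)
    (hu : ∀ n, a ≤ n → n < b → f (n + 1) - f n ≤ k + 1 - η) :
    ‖∑ n ∈ Ico a b, ex (f n)‖ ≤ 1 / η := by
  rcases Nat.lt_or_ge a b with hab | hab
  · have h : ∀ n ∈ Ico a b, ex (f n) = ex (f n - k * n) := by
      intro n _
      have : f n = (f n - k * n) + ((k * n : ℤ) : ℝ) := by push_cast; ring
      rw [this, ex_add, ex_intCast, mul_one]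
      congr 1
      push_cast
      ring
    rw [sum_congr rfl h]
    apply kusmin_landau_aux (fun n => f n - k * n) hη hab
    · intro n h1 h2
      have := hmono n h1 h2
      push_cast
      linarith
    · intro n h1 h2
      have := hl n h1 h2
      push_cast
      linarith
    · intro n h1 h2
      have := hu n h1 h2
      push_cast
      linarith
  · rw [Ico_eq_empty_of_le hab]
    simp [hη.le]

/-- The number of terms in a window of length `η` of a sequence growing by at least `l` at each
step. -/
lemma card_filter_window_le (d : ℕ → ℝ) {a b : ℕ} {l η u : ℝ} (hl : 0 < l) (hη : 0 ≤ η)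
    (hd : ∀ n, a ≤ n → n + 1 < b → l ≤ d (n + 1) - d n) (s : Finset ℕ) (hs : s ⊆ Ico a b)
    (h1 : ∀ n ∈ s, u ≤ d n) (h2 : ∀ n ∈ s, d n ≤ u + η) : (#s : ℝ) ≤ η / l + 1 := by
  have hgrow : ∀ m n, a ≤ m → m ≤ n → n < b → l * ((n : ℝ) - m) ≤ d n - d m := by
    intro m n h1 h2
    induction n, h2 using Nat.le_induction with
    | base => simp
    | succ k hk ih =>
      intro hkb
      have e1 := ih (by omega)
      have e2 := hd k (by omega) hkb
      push_cast
      linarith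
  rcases s.eq_empty_or_nonempty with rfl | hne
  · simp
    positivity
  · set m := s.min' hne
    set n := s.max' hne
    have hm : m ∈ s := s.min'_mem hne
    have hn : n ∈ s := s.max'_mem hne
    have hmn : m ≤ n := s.min'_le n hn
    have hsub : s ⊆ Icc m n := fun x hx => mem_Icc.mpr ⟨s.min'_le x hx, s.le_max' x hx⟩
    have hcard := card_le_card hsub
    rw [Nat.card_Icc] at hcard
    have hc : (#s : ℝ) ≤ (n : ℝ) - m + 1 := by
      have : #s + m ≤ n + 1 := by omega
      have : (#s : ℝ) + m ≤ n + 1 := by exact_mod_cast this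
      linarith
    have hg := hgrow m n (mem_Ico.mp (hs hm)).1 hmn (mem_Ico.mp (hs hn)).2
    have := h1 m hm
    have := h2 n hn
    have : (n : ℝ) - m ≤ η / l := by
      rw [le_div_iff₀ hl]
      linarith
    linarith

lemma norm_sum_ex_le_card {ι : Type*} (s : Finset ι) (f : ι → ℝ) :
    ‖∑ n ∈ s, ex (f n)‖ ≤ #s := by
  refine (norm_sum_le _ _).trans ?_
  simp [norm_ex]

/-- Van der Corput's second derivative test, in terms of second differences. -/
theorem van_der_corput (f : ℕ → ℝ) {a b : ℕ} {l C : ℝ} (hl : 0 < l) (hC : 1 ≤ C) (hab : a ≤ b)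
    (h1 : ∀ n, a ≤ n → n + 1 < b → l ≤ (f (n + 2) - f (n + 1)) - (f (n + 1) - f n))
    (h2 : ∀ n, a ≤ n → n + 1 < b → (f (n + 2) - f (n + 1)) - (f (n + 1) - f n) ≤ C * l) :
    ‖∑ n ∈ Ico a b, ex (f n)‖ ≤ 8 * C * (((b : ℝ) - a) * √l + (√l)⁻¹) := by
  have hL : (0 : ℝ) ≤ (b : ℝ) - a := by
    have : (a : ℝ) ≤ b := by exact_mod_cast hab
    linarith
  have hsl : 0 < √l := Real.sqrt_pos.mpr hl
  have htriv : ‖∑ n ∈ Ico a b, ex (f n)‖ ≤ (b : ℝ) - a := by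
    refine (norm_sum_ex_le_card _ _).trans ?_
    rw [Nat.card_Ico, Nat.cast_sub hab]
  -- For √l ≥ 1/2 the trivial bound b - a is enough; otherwise 2 ≤ 1/√l absorbs the additive
  -- constants below.
  rcases le_or_gt (1 / 2) (√l) with hbig | hsmall
  · refine htriv.trans ?_
    have : (b : ℝ) - a ≤ 8 * 1 * (((b : ℝ) - a) * √l + 0) := by nlinarith
    refine this.trans ?_
    gcongr
    positivity
  rcases hab.eq_or_lt with rfl | hlt
  · simp
    positivity
  set η := √l with hη
  have hηl : η / l = η⁻¹ := by
    have : l = η ^ 2 := (Real.sq_sqrt hl.le).symm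
    rw [this]
    field_simp
  set d : ℕ → ℝ := fun n => f (n + 1) - f n with hd
  have hdm : ∀ n, a ≤ n → n + 1 < b → l ≤ d (n + 1) - d n := h1
  have hdle : ∀ m n, a ≤ m → m ≤ n → n < b → d m ≤ d n := by
    intro m n h1 h2
    induction n, h2 using Nat.le_induction with
    | base => simp
    | succ k hk ih =>
      intro hkb
      have e1 := ih (by omega)
      have e2 := hdm k (by omega) hkb
      linarith
  have hdup : ∀ n, a ≤ n → n < b → d n - d a ≤ C * l * ((n : ℝ) - a) := by
    intro n h3
    induction n, h3 using Nat.le_induction with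
    | base => simp
    | succ k hk ih =>
      intro hkb
      have e1 := ih (by omega)
      have e2 : d (k + 1) - d k ≤ C * l := h2 k hk hkb
      push_cast
      linarith
  -- The first differences d increase and meet at most C l (b - a) + 2 integer parts; the terms with
  -- a given integer part contribute O(1/η).
  set T := Icc ⌊d a⌋ ⌊d (b - 1)⌋ with hT
  have hmaps : ∀ n ∈ Ico a b, ⌊d n⌋ ∈ T := by
    intro n hn
    rw [mem_Ico] at hn
    exact mem_Icc.mpr ⟨Int.floor_le_floor (hdle a n le_rfl hn.1 hn.2),
      Int.floor_le_floor (hdle n (b - 1) hn.1 (by omega) (by omega))⟩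
  have hTcard : (#T : ℝ) ≤ C * l * ((b : ℝ) - a) + 2 := by
    have e1 := hdup (b - 1) (by omega) (by omega)
    have e2 := hdle a (b - 1) le_rfl (by omega) (by omega)
    have e3 := Int.floor_le_floor e2
    have e4 : (#T : ℝ) = (⌊d (b - 1)⌋ : ℝ) + 1 - ⌊d a⌋ := by
      rw [hT, Int.card_Icc, ← Int.cast_natCast, Int.toNat_of_nonneg (by omega)]
      push_cast
      ring
    have e5 := Int.floor_le (d (b - 1))
    have e6 := Int.lt_floor_add_one (d a)
    have e7 : C * l * (((b - 1 : ℕ) : ℝ) - a) ≤ C * l * ((b : ℝ) - a) := by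
      gcongr
      omega
    linarith
  have hfiber : ∀ k ∈ T, ‖∑ n ∈ Ico a b with ⌊d n⌋ = k, ex (f n)‖ ≤ 4 * η⁻¹ := by
    intro k _
    set s := (Ico a b).filter (fun n => ⌊d n⌋ = k) with hs
    have hk1 : ∀ n ∈ s, (k : ℝ) ≤ d n := fun n hn => Int.le_floor.mp (mem_filter.mp hn).2.ge
    have hk2 : ∀ n ∈ s, d n < k + 1 := fun n hn => by
      rw [← (mem_filter.mp hn).2]
      exact Int.lt_floor_add_one _
    -- Differences within η of either end of [k, k+1) are counted trivially, at most η/l + 1 = 1/η +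
    -- 1 per end. The middle ones form an interval of n on which Kusmin–Landau gives 1/η. The choice
    -- η = √l balances the two.
    rw [← sum_filter_add_sum_filter_not s (fun n => d n < k + η)]
    rw [← sum_filter_add_sum_filter_not (s.filter (fun n => ¬ d n < k + η))
      (fun n => k + 1 - η < d n)]
    set s1 := s.filter (fun n => d n < k + η)
    set s2 := (s.filter (fun n => ¬ d n < k + η)).filter (fun n => k + 1 - η < d n)
    set s3 := (s.filter (fun n => ¬ d n < k + η)).filter (fun n => ¬ k + 1 - η < d n) with hs3
    have hb1 : ‖∑ n ∈ s1, ex (f n)‖ ≤ η⁻¹ + 1 := by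
      refine (norm_sum_ex_le_card _ _).trans ?_
      rw [← hηl]
      refine card_filter_window_le d (u := k) hl hsl.le hdm s1
        ((filter_subset _ _).trans (filter_subset _ _)) ?_ ?_
      · intro n hn
        exact hk1 n (mem_filter.mp hn).1
      · intro n hn
        exact (mem_filter.mp hn).2.le
    have hb2 : ‖∑ n ∈ s2, ex (f n)‖ ≤ η⁻¹ + 1 := by
      refine (norm_sum_ex_le_card _ _).trans ?_
      rw [← hηl]
      refine card_filter_window_le d (u := k + 1 - η) hl hsl.le hdm s2
        ((filter_subset _ _).trans ((filter_subset _ _).trans (filter_subset _ _))) ?_ ?_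
      · intro n hn
        exact (mem_filter.mp hn).2.le
      · intro n hn
        have := hk2 n (mem_filter.mp (mem_filter.mp hn).1).1
        linarith
    have hb3 : ‖∑ n ∈ s3, ex (f n)‖ ≤ η⁻¹ := by
      have hmem : ∀ n, n ∈ s3 ↔ (a ≤ n ∧ n < b) ∧ k + η ≤ d n ∧ d n ≤ k + 1 - η := by
        intro n
        simp only [hs3, hs, mem_filter, mem_Ico, not_lt]
        constructor
        · rintro ⟨⟨⟨h, _⟩, h'⟩, h''⟩
          exact ⟨h, h', h''⟩
        · rintro ⟨h, h', h''⟩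
          refine ⟨⟨⟨h, ?_⟩, h'⟩, h''⟩
          rw [Int.floor_eq_iff]
          constructor <;> linarith
      rcases s3.eq_empty_or_nonempty with he | hne
      · rw [he]
        simp [hsl.le]
      have hint : s3 = Ico (s3.min' hne) (s3.max' hne + 1) := by
        ext x
        rw [mem_Ico]
        constructor
        · intro hx
          exact ⟨s3.min'_le x hx, Nat.lt_succ_of_le (s3.le_max' x hx)⟩
        · rintro ⟨hx1, hx2⟩
          have e1 := (hmem _).mp (s3.min'_mem hne)
          have e2 := (hmem _).mp (s3.max'_mem hne)
          have hb : x < b := by omega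
          have ha : a ≤ x := by omega
          rw [hmem]
          have e3 := hdle _ x e1.1.1 hx1 hb
          have e4 := hdle x _ ha (Nat.lt_succ_iff.mp hx2) e2.1.2
          exact ⟨⟨ha, hb⟩, by linarith, by linarith⟩
      have e1 := (hmem _).mp (s3.min'_mem hne)
      have e2 := (hmem _).mp (s3.max'_mem hne)
      rw [hint, ← one_div]
      apply kusmin_landau f k hsl
      · intro n hn1 hn2
        have := h1 n (by omega) (by omega)
        linarith
      · intro n hn1 hn2
        have : n ∈ s3 := by rw [hint]; exact mem_Ico.mpr ⟨hn1, hn2⟩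
        exact ((hmem n).mp this).2.1
      · intro n hn1 hn2
        have : n ∈ s3 := by rw [hint]; exact mem_Ico.mpr ⟨hn1, hn2⟩
        exact ((hmem n).mp this).2.2
    have h2η : 2 ≤ η⁻¹ := by
      rw [le_inv_comm₀ (by norm_num) hsl]
      linarith
    refine (norm_add_le _ _).trans ?_
    have := norm_add_le (∑ n ∈ s2, ex (f n)) (∑ n ∈ s3, ex (f n))
    linarith
  rw [← sum_fiberwise_of_maps_to hmaps]
  refine (norm_sum_le _ _).trans ((sum_le_sum hfiber).trans ?_)
  rw [sum_const, nsmul_eq_mul]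
  have e1 : l * η⁻¹ = η := by
    have : l = η ^ 2 := (Real.sq_sqrt hl.le).symm
    rw [this]
    field_simp
  calc (#T : ℝ) * (4 * η⁻¹) ≤ (C * l * ((b : ℝ) - a) + 2) * (4 * η⁻¹) := by gcongr
    _ = 4 * C * ((b : ℝ) - a) * (l * η⁻¹) + 8 * 1 * η⁻¹ := by ring
    _ ≤ 8 * C * ((b : ℝ) - a) * η + 8 * C * η⁻¹ := by
      rw [e1]
      gcongr
      norm_num
    _ = _ := by ring

end

/-! ### The divisor bound, Abel summation and Vaughan's identity. -/

section

open Finset ArithmeticFunction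
open scoped ArithmeticFunction.zeta ArithmeticFunction.Moebius

/-- The divisor bound `d(n) ≪ n ^ ε`. -/
theorem card_divisors_le_rpow {ε : ℝ} (hε : 0 < ε) :
    ∃ C : ℝ, 1 ≤ C ∧ ∀ n : ℕ, 1 ≤ n → (#n.divisors : ℝ) ≤ C * (n : ℝ) ^ ε := by
  set P : ℕ := ⌈(2 : ℝ) ^ (1 / ε)⌉₊ with hP
  set B : ℝ := 1 + 1 / (ε * Real.log 2) with hB
  have hlog2 : 0 < Real.log 2 := Real.log_pos (by norm_num)
  have hB1 : 1 ≤ B := by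
    rw [hB]
    have : 0 ≤ 1 / (ε * Real.log 2) := by positivity
    linarith
  -- For p ≥ 2^(1/ε) one has a + 1 ≤ 2^a ≤ p^(aε). Each of the at most P smaller primes loses a
  -- factor B, chosen so that a + 1 ≤ B(1 + εa log 2) ≤ B · 2^(εa).
  have hloc : ∀ p a : ℕ, p.Prime →
      ((a : ℝ) + 1) ≤ (if p < P then B else 1) * ((p : ℝ) ^ a) ^ ε := by
    intro p a hp
    have hp2 : (2 : ℝ) ≤ p := by exact_mod_cast hp.two_le
    split_ifs with h
    · have h1 : (2 : ℝ) ^ (ε * a) ≤ ((p : ℝ) ^ a) ^ ε := by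
        rw [← Real.rpow_natCast, ← Real.rpow_mul (by positivity), mul_comm ε]
        exact Real.rpow_le_rpow (by norm_num) hp2 (by positivity)
      have h2 : 1 + ε * a * Real.log 2 ≤ (2 : ℝ) ^ (ε * a) := by
        rw [Real.rpow_def_of_pos (by norm_num)]
        have := Real.add_one_le_exp (Real.log 2 * (ε * a))
        linarith
      have h3 : (a : ℝ) + 1 ≤ B * (1 + ε * a * Real.log 2) := by
        have h4 : B * (1 + ε * a * Real.log 2) =
            1 + ε * a * Real.log 2 + 1 / (ε * Real.log 2) + a := by
          rw [hB]
          field_simp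
          ring
        rw [h4]
        have : 0 ≤ ε * a * Real.log 2 := by positivity
        have : 0 ≤ 1 / (ε * Real.log 2) := by positivity
        linarith
      exact h3.trans (mul_le_mul_of_nonneg_left (h2.trans h1) (by linarith))
    · rw [one_mul, ← Real.rpow_natCast, ← Real.rpow_mul (by positivity), mul_comm (a : ℝ),
        Real.rpow_mul (by positivity), Real.rpow_natCast]
      have h1 : (2 : ℝ) ≤ (p : ℝ) ^ ε := by
        have h2 : (2 : ℝ) ^ (1 / ε) ≤ p := (Nat.le_ceil _).trans (by exact_mod_cast not_lt.mp h)
        calc (2 : ℝ) = ((2 : ℝ) ^ (1 / ε)) ^ ε := by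
              rw [← Real.rpow_mul (by norm_num), one_div, inv_mul_cancel₀ hε.ne', Real.rpow_one]
          _ ≤ _ := Real.rpow_le_rpow (by positivity) h2 hε.le
      have h2 : ((a + 1 : ℕ) : ℝ) ≤ ((2 ^ a : ℕ) : ℝ) := by
        exact_mod_cast Nat.lt_two_pow_self
      push_cast at h2
      exact h2.trans (pow_le_pow_left₀ (by norm_num) h1 a)
  refine ⟨B ^ P, one_le_pow₀ hB1, fun n hn => ?_⟩
  have hn0 : n ≠ 0 := by omega
  rw [Nat.card_divisors hn0]
  have hfac : (n : ℝ) = ∏ p ∈ n.primeFactors, (p : ℝ) ^ (n.factorization p) := by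
    conv_lhs => rw [← Nat.prod_factorization_pow_eq_self hn0]
    rw [Nat.prod_factorization_eq_prod_primeFactors]
    push_cast
    rfl
  push_cast
  calc ∏ p ∈ n.primeFactors, ((n.factorization p : ℝ) + 1)
      ≤ ∏ p ∈ n.primeFactors, ((if p < P then B else 1) * ((p : ℝ) ^ (n.factorization p)) ^ ε) :=
        prod_le_prod (fun _ _ => by positivity)
          (fun p hp => hloc p _ (Nat.prime_of_mem_primeFactors hp))
    _ = (∏ p ∈ n.primeFactors, (if p < P then B else 1)) * (n : ℝ) ^ ε := by
        rw [prod_mul_distrib, Real.finsetProd_rpow _ _ (fun _ _ => by positivity), ← hfac]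
    _ ≤ B ^ P * (n : ℝ) ^ ε := by
        gcongr
        rw [prod_ite, prod_const, prod_const_one, mul_one]
        refine pow_le_pow_right₀ hB1 ?_
        calc _ ≤ #(range P) := card_le_card (fun p hp => by
              rw [mem_filter] at hp
              exact mem_range.mpr hp.2)
          _ = P := card_range P

/-- Abel summation with nonnegative nonincreasing weights. -/
lemma norm_sum_antitone_mul_le (w : ℕ → ℝ) (c : ℕ → ℂ) {a b : ℕ} {B : ℝ}
    (hw : ∀ n, a < n → n < b → w (n + 1) ≤ w n) (hw0 : ∀ n, a < n → n ≤ b → 0 ≤ w n)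
    (hB : ∀ k, a ≤ k → k ≤ b → ‖∑ n ∈ Ioc a k, c n‖ ≤ B) (hab : a < b) :
    ‖∑ n ∈ Ioc a b, (w n : ℂ) * c n‖ ≤ w (a + 1) * B := by
  have main : ∀ k, a + 1 ≤ k → k ≤ b →
      ‖∑ n ∈ Ioc a k, (w n : ℂ) * c n - w k * ∑ n ∈ Ioc a k, c n‖ ≤ (w (a + 1) - w k) * B := by
    intro k hk
    induction k, hk using Nat.le_induction with
    | base =>
      intro _
      simp [Nat.Ioc_succ_singleton]
    | succ k hk ih =>
      intro hkb
      rw [sum_Ioc_succ_top (by omega), sum_Ioc_succ_top (by omega)]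
      have h1 := ih (by omega)
      have h2 := hB k (by omega) (by omega)
      have h3 := hw k (by omega) (by omega)
      have e : ∑ n ∈ Ioc a k, (w n : ℂ) * c n + (w (k + 1) : ℂ) * c (k + 1) -
          w (k + 1) * (∑ n ∈ Ioc a k, c n + c (k + 1)) =
          (∑ n ∈ Ioc a k, (w n : ℂ) * c n - w k * ∑ n ∈ Ioc a k, c n) +
            ((w k - w (k + 1) : ℝ) : ℂ) * ∑ n ∈ Ioc a k, c n := by
        push_cast
        ring
      rw [e]
      refine (norm_add_le _ _).trans ?_
      rw [norm_mul, Complex.norm_real, Real.norm_of_nonneg (by linarith)]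
      have := mul_le_mul_of_nonneg_left h2 (by linarith : 0 ≤ w k - w (k + 1))
      linarith
  have h1 := main b hab le_rfl
  have h2 := hB b hab.le le_rfl
  have h3 := hw0 b hab le_rfl
  have h4 : ‖(w b : ℂ) * ∑ n ∈ Ioc a b, c n‖ ≤ w b * B := by
    rw [norm_mul, Complex.norm_real, Real.norm_of_nonneg h3]
    gcongr
  have h5 := norm_add_le (∑ n ∈ Ioc a b, (w n : ℂ) * c n - w b * ∑ n ∈ Ioc a b, c n)
    ((w b : ℂ) * ∑ n ∈ Ioc a b, c n)
  rw [sub_add_cancel] at h5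
  linarith

/-- Abel summation with nonnegative nondecreasing weights. -/
lemma norm_sum_monotone_mul_le (w : ℕ → ℝ) (c : ℕ → ℂ) {a b : ℕ} {B W : ℝ}
    (hw : ∀ m n, a < m → m ≤ n → n ≤ b → w m ≤ w n) (hw0 : ∀ n, a < n → n ≤ b → 0 ≤ w n)
    (hW : ∀ n, a < n → n ≤ b → w n ≤ W) (hW0 : 0 ≤ W) (hB0 : 0 ≤ B)
    (hB : ∀ k, a ≤ k → k ≤ b → ‖∑ n ∈ Ioc a k, c n‖ ≤ B) :
    ‖∑ n ∈ Ioc a b, (w n : ℂ) * c n‖ ≤ 2 * W * B := by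
  rcases Nat.lt_or_ge a b with hab | hab
  -- The weights W - w are nonnegative and nonincreasing.
  · have h1 := norm_sum_antitone_mul_le (fun n => W - w n) c (a := a) (b := b) (B := B)
      (fun n h1 h2 => by linarith [hw n (n + 1) h1 (by omega) (by omega)])
      (fun n h1 h2 => by simpa using hW n h1 h2) hB hab
    have h2 := hB b hab.le le_rfl
    have e : ∑ n ∈ Ioc a b, (w n : ℂ) * c n = W * ∑ n ∈ Ioc a b, c n -
        ∑ n ∈ Ioc a b, ((W - w n : ℝ) : ℂ) * c n := by
      rw [mul_sum, ← sum_sub_distrib]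
      refine sum_congr rfl fun n _ => ?_
      push_cast
      ring
    rw [e]
    refine (norm_sub_le _ _).trans ?_
    rw [norm_mul, Complex.norm_real, Real.norm_of_nonneg hW0]
    have h3 := hw0 (a + 1) (by omega) (by omega)
    have h4 : (W - w (a + 1)) * B ≤ W * B := by
      gcongr
      linarith
    have h5 : W * ‖∑ n ∈ Ioc a b, c n‖ ≤ W * B := by gcongr
    linarith
  · rw [Ioc_eq_empty_of_le hab]
    simp only [sum_empty, norm_zero]
    positivity

/-- The truncation of an arithmetic function to arguments at most `U`. -/
noncomputable def trunc (f : ArithmeticFunction ℝ) (U : ℕ) : ArithmeticFunction ℝ :=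
  ⟨fun n => if n ≤ U then f n else 0, by simp⟩

lemma trunc_apply (f : ArithmeticFunction ℝ) (U n : ℕ) :
    trunc f U n = if n ≤ U then f n else 0 := rfl

lemma sub_trunc_apply (f : ArithmeticFunction ℝ) (U n : ℕ) :
    (f - trunc f U) n = if n ≤ U then 0 else f n := by
  rw [sub_eq_add_neg, ArithmeticFunction.add_apply, ArithmeticFunction.neg_apply, trunc_apply]
  split_ifs <;> simp

/-- Vaughan's identity. -/
theorem vaughan (U V : ℕ) : (Λ : ArithmeticFunction ℝ) =
    trunc Λ V + trunc (μ : ArithmeticFunction ℝ) U * log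
    - (trunc (μ : ArithmeticFunction ℝ) U * trunc Λ V) * (ζ : ArithmeticFunction ℝ)
    + (((μ : ArithmeticFunction ℝ) - trunc (μ : ArithmeticFunction ℝ) U) *
      (ζ : ArithmeticFunction ℝ))
      * (Λ - trunc Λ V) := by
  have h1 : (μ : ArithmeticFunction ℝ) * (ζ : ArithmeticFunction ℝ) = 1 :=
    coe_moebius_mul_coe_zeta
  have h2 : (Λ : ArithmeticFunction ℝ) * (ζ : ArithmeticFunction ℝ) = log := vonMangoldt_mul_zeta
  -- Given μ * ζ = 1 and Λ * ζ = log, the identity is formal in the ring of arithmetic functions.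
  linear_combination (trunc (μ : ArithmeticFunction ℝ) U) * h2 - (Λ - trunc Λ V) * h1

lemma sum_mul_apply (a b : ArithmeticFunction ℝ) (g : ℕ → ℂ) (X Y : ℕ) :
    ∑ n ∈ Ioc X Y, (((a * b) n : ℝ) : ℂ) * g n =
      ∑ k ∈ Ioc 0 Y, ∑ m ∈ Ioc (X / k) (Y / k), (a k : ℂ) * (b m : ℂ) * g (k * m) := by
  simp only [ArithmeticFunction.mul_apply]
  push_cast
  simp only [sum_mul]
  rw [sum_sigma', sum_sigma']
  refine sum_bij' (fun x _ => ⟨x.2.1, x.2.2⟩) (fun x _ => ⟨x.1 * x.2, (x.1, x.2)⟩) ?_ ?_ ?_ ?_ ?_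
  · rintro ⟨n, k, m⟩ h
    simp only [mem_sigma, mem_Ioc, Nat.mem_divisorsAntidiagonal] at h ⊢
    obtain ⟨⟨h1, h2⟩, rfl, h3⟩ := h
    have hk : 0 < k := Nat.pos_of_ne_zero (by rintro rfl; simp at h3)
    have hm : 0 < m := Nat.pos_of_ne_zero (by rintro rfl; simp at h3)
    refine ⟨⟨hk, (Nat.le_mul_of_pos_right k hm).trans h2⟩, ?_, ?_⟩
    · rwa [Nat.div_lt_iff_lt_mul hk, mul_comm]
    · rwa [Nat.le_div_iff_mul_le hk, mul_comm]
  · rintro ⟨k, m⟩ h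
    simp only [mem_sigma, mem_Ioc, Nat.mem_divisorsAntidiagonal] at h ⊢
    obtain ⟨⟨hk, h2⟩, h3, h4⟩ := h
    rw [Nat.div_lt_iff_lt_mul hk, mul_comm] at h3
    rw [Nat.le_div_iff_mul_le hk, mul_comm] at h4
    exact ⟨⟨h3, h4⟩, trivial, by omega⟩
  · rintro ⟨n, k, m⟩ h
    simp only [mem_sigma, mem_Ioc, Nat.mem_divisorsAntidiagonal] at h
    obtain ⟨_, rfl, _⟩ := h
    rfl
  · rintro ⟨k, m⟩ _
    rfl
  · rintro ⟨n, k, m⟩ h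
    simp only [mem_sigma, mem_Ioc, Nat.mem_divisorsAntidiagonal] at h
    obtain ⟨_, rfl, _⟩ := h
    rfl

end

/-! ### Bilinear sums by Cauchy–Schwarz. -/

section

open Finset

/-- Cauchy's inequality for the square of a norm of a sum. -/
lemma norm_sum_sq_le_card_mul {ι : Type*} (s : Finset ι) (f : ι → ℂ) :
    ‖∑ i ∈ s, f i‖ ^ 2 ≤ #s * ∑ i ∈ s, ‖f i‖ ^ 2 :=
  (pow_le_pow_left₀ (norm_nonneg _) (norm_sum_le _ _) 2).trans sq_sum_le_card_mul_sum_sq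

/-- Expanding a mean square and bounding correlations. -/
lemma sum_norm_sq_le {ι κ : Type*} (s : Finset ι) (t : Finset κ) (b : ι → ℂ) (G : ι → κ → ℂ)
    (D : ι → ι → ℝ) {B : ℝ} (hb : ∀ n ∈ s, ‖b n‖ ≤ B) (hB : 0 ≤ B)
    (hD : ∀ n₁ ∈ s, ∀ n₂ ∈ s, ‖∑ m ∈ t, G n₁ m * (starRingEnd ℂ) (G n₂ m)‖ ≤ D n₁ n₂) :
    ∑ m ∈ t, ‖∑ n ∈ s, b n * G n m‖ ^ 2 ≤ B ^ 2 * ∑ n₁ ∈ s, ∑ n₂ ∈ s, D n₁ n₂ := by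
  have e : ((∑ m ∈ t, ‖∑ n ∈ s, b n * G n m‖ ^ 2 : ℝ) : ℂ) =
      ∑ n₁ ∈ s, ∑ n₂ ∈ s, b n₁ * (starRingEnd ℂ) (b n₂) *
        ∑ m ∈ t, G n₁ m * (starRingEnd ℂ) (G n₂ m) := by
    push_cast
    have e' : ∀ m, (‖∑ n ∈ s, b n * G n m‖ : ℂ) ^ 2 = ∑ n₁ ∈ s, ∑ n₂ ∈ s,
        b n₁ * (starRingEnd ℂ) (b n₂) * (G n₁ m * (starRingEnd ℂ) (G n₂ m)) := by
      intro m
      rw [← Complex.mul_conj', map_sum, sum_mul_sum]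
      refine sum_congr rfl fun n₁ _ => sum_congr rfl fun n₂ _ => ?_
      rw [map_mul]
      ring
    simp only [e', mul_sum]
    rw [sum_comm]
    refine sum_congr rfl fun n₁ _ => ?_
    rw [sum_comm]
  have h0 : 0 ≤ ∑ m ∈ t, ‖∑ n ∈ s, b n * G n m‖ ^ 2 := sum_nonneg fun _ _ => by positivity
  rw [← Real.norm_of_nonneg h0, ← Complex.norm_real, e, mul_sum]
  refine (norm_sum_le _ _).trans (sum_le_sum fun n₁ h₁ => ?_)
  rw [mul_sum]
  refine (norm_sum_le _ _).trans (sum_le_sum fun n₂ h₂ => ?_)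
  rw [norm_mul, norm_mul, RCLike.norm_conj]
  have := hD n₁ h₁ n₂ h₂
  have h3 := hb n₁ h₁
  have h4 := hb n₂ h₂
  rw [sq]
  gcongr

lemma card_filter_div_eq_le (s : Finset ℕ) {Q : ℕ} (hQ : 0 < Q) (j : ℕ) :
    #(s.filter (fun n => n / Q = j)) ≤ Q := by
  have : s.filter (fun n => n / Q = j) ⊆ Ico (j * Q) (j * Q + Q) := by
    intro n hn
    rw [mem_filter] at hn
    obtain ⟨_, rfl⟩ := hn
    rw [mem_Ico]
    have h1 := Nat.div_add_mod n Q
    have h2 := Nat.mod_lt n hQ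
    rw [mul_comm] at h1
    omega
  refine (card_le_card this).trans ?_
  simp

/-- A dyadic bilinear sum over `X < nm ≤ Y`, bounded in terms of correlations of `g` at
multiples of two close integers. -/
theorem norm_bilinear_dyadic_sq_le (a b g : ℕ → ℂ) {X Y K Q : ℕ} {A B R : ℝ} (hK : 1 ≤ K)
    (hQ : 1 ≤ Q) (hY : Y ≤ 3 * X) (hg : ∀ n, ‖g n‖ ≤ 1) (hB : 0 ≤ B) (hR : 0 ≤ R)
    (ha : ∀ m, m ≤ Y → ‖a m‖ ≤ A) (hb : ∀ n ∈ Ioc K (2 * K), ‖b n‖ ≤ B)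
    (hcor : ∀ n₁ n₂, n₁ ∈ Ioc K (2 * K) → n₂ ∈ Ioc K (2 * K) → n₂ < n₁ → n₁ - n₂ ≤ Q →
      ‖∑ m ∈ Ioc (max (X / n₁) (X / n₂)) (min (Y / n₁) (Y / n₂)),
        g (n₁ * m) * (starRingEnd ℂ) (g (n₂ * m))‖ ≤ R) :
    ‖∑ n ∈ Ioc K (2 * K), ∑ m ∈ Ioc (X / n) (Y / n), b n * a m * g (n * m)‖ ^ 2 ≤
      A ^ 2 * B ^ 2 * (3 * X / K) * ((K : ℝ) / Q + 2) * (K * (3 * X / K + Q * R)) := by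
  have hK0 : (0 : ℝ) < K := by exact_mod_cast hK
  have hQ0 : (0 : ℝ) < Q := by exact_mod_cast hQ
  set M := Y / K with hM
  have hMle : (M : ℝ) ≤ 3 * X / K := by
    rw [le_div_iff₀ hK0]
    have := Nat.div_mul_le_self Y K
    exact_mod_cast this.trans hY
  set G : ℕ → ℕ → ℂ := fun n m => if m ∈ Ioc (X / n) (Y / n) then g (n * m) else 0 with hG
  have hGn : ∀ n m, ‖G n m‖ ≤ 1 := by
    intro n m
    simp only [hG]
    split_ifs
    · exact hg _
    · simp
  have hsub : ∀ n ∈ Ioc K (2 * K), Ioc (X / n) (Y / n) ⊆ Ioc 0 M := by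
    intro n hn m hm
    rw [mem_Ioc] at hn hm ⊢
    exact ⟨(Nat.zero_le _).trans_lt hm.1, hm.2.trans (Nat.div_le_div_left hn.1.le (by omega))⟩
  set T : ℕ → ℂ := fun m => ∑ n ∈ Ioc K (2 * K), b n * G n m with hT
  have hS : ∑ n ∈ Ioc K (2 * K), ∑ m ∈ Ioc (X / n) (Y / n), b n * a m * g (n * m) =
      ∑ m ∈ Ioc 0 M, a m * T m := by
    simp only [hT, mul_sum]
    rw [sum_comm (s := Ioc 0 M)]
    refine sum_congr rfl fun n hn => ?_
    rw [← sum_subset (hsub n hn) (f := fun m => a m * (b n * G n m))]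
    · refine sum_congr rfl fun m hm => ?_
      simp only [hG, if_pos hm]
      ring
    · intro m _ hm
      simp only [hG, if_neg hm, mul_zero]
  have h1 : ‖∑ m ∈ Ioc 0 M, a m * T m‖ ^ 2 ≤ M * (A ^ 2 * ∑ m ∈ Ioc 0 M, ‖T m‖ ^ 2) := by
    refine (norm_sum_sq_le_card_mul _ _).trans ?_
    rw [Nat.card_Ioc, Nat.sub_zero, mul_sum _ _ (A ^ 2)]
    refine mul_le_mul_of_nonneg_left (sum_le_sum fun m hm => ?_) (Nat.cast_nonneg M)
    rw [norm_mul, mul_pow]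
    gcongr
    exact ha m ((mem_Ioc.mp hm).2.trans (Nat.div_le_self _ _))
  set J := Icc (K / Q) (2 * K / Q) with hJ
  have hmaps : ∀ n ∈ Ioc K (2 * K), n / Q ∈ J := by
    intro n hn
    rw [mem_Ioc] at hn
    exact mem_Icc.mpr ⟨Nat.div_le_div_right hn.1.le, Nat.div_le_div_right hn.2⟩
  have hJcard : (#J : ℝ) ≤ (K : ℝ) / Q + 2 := by
    have e1 : ((2 * K / Q : ℕ) : ℝ) ≤ 2 * K / Q := by
      refine Nat.cast_div_le.trans ?_
      push_cast
      rfl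
    have e2 : (K : ℝ) / Q < (K / Q : ℕ) + 1 := by
      rw [div_lt_iff₀ hQ0]
      have := Nat.lt_mul_div_succ K hQ
      have : (K : ℝ) < (Q * (K / Q + 1) : ℕ) := by exact_mod_cast this
      push_cast at this ⊢
      linarith
    have e3 : K / Q ≤ 2 * K / Q := Nat.div_le_div_right (by omega)
    rw [hJ, Nat.card_Icc, Nat.cast_sub (by omega)]
    push_cast
    have e4 : 2 * (K : ℝ) / Q = K / Q + K / Q := by ring
    linarith
  -- Cauchy–Schwarz over at most K/Q + 2 blocks of at most Q consecutive n leaves only correlations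
  -- with |n₁ - n₂| ≤ Q. The diagonal costs M and every other pair R, hence M + QR for each n.
  set blk : ℕ → Finset ℕ := fun j => (Ioc K (2 * K)).filter (fun n => n / Q = j) with hblk
  have h2 : ∀ m, ‖T m‖ ^ 2 ≤ ((K : ℝ) / Q + 2) * ∑ j ∈ J, ‖∑ n ∈ blk j, b n * G n m‖ ^ 2 := by
    intro m
    simp only [hT]
    rw [← sum_fiberwise_of_maps_to hmaps]
    refine (norm_sum_sq_le_card_mul _ _).trans ?_
    gcongr
  have hcor' : ∀ n₁ n₂, n₁ ∈ Ioc K (2 * K) → n₂ ∈ Ioc K (2 * K) → n₂ < n₁ → n₁ - n₂ ≤ Q →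
      ‖∑ m ∈ Ioc 0 M, G n₁ m * (starRingEnd ℂ) (G n₂ m)‖ ≤ R := by
    intro n₁ n₂ m₁ m₂ h₁ h₂
    have e : ∑ m ∈ Ioc 0 M, G n₁ m * (starRingEnd ℂ) (G n₂ m) =
        ∑ m ∈ Ioc (max (X / n₁) (X / n₂)) (min (Y / n₁) (Y / n₂)),
          g (n₁ * m) * (starRingEnd ℂ) (g (n₂ * m)) := by
      have hI : Ioc (max (X / n₁) (X / n₂)) (min (Y / n₁) (Y / n₂)) =
          Ioc (X / n₁) (Y / n₁) ∩ Ioc (X / n₂) (Y / n₂) := Ioc_inter_Ioc.symm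
      rw [hI, ← sum_subset (inter_subset_left.trans (hsub n₁ m₁))
        (f := fun m => G n₁ m * (starRingEnd ℂ) (G n₂ m))]
      · refine sum_congr rfl fun m hm => ?_
        rw [mem_inter] at hm
        simp only [hG, if_pos hm.1, if_pos hm.2]
      · intro m _ hm
        rw [mem_inter, not_and_or] at hm
        rcases hm with hm | hm
        · simp only [hG, if_neg hm, zero_mul]
        · simp only [hG, if_neg hm, map_zero, mul_zero]
    rw [e]
    exact hcor n₁ n₂ m₁ m₂ h₁ h₂
  have h3 : ∀ j, ∑ m ∈ Ioc 0 M, ‖∑ n ∈ blk j, b n * G n m‖ ^ 2 ≤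
      B ^ 2 * (#(blk j) * (M + Q * R)) := by
    intro j
    refine (sum_norm_sq_le (blk j) (Ioc 0 M) b G
      (fun n₁ n₂ => (if n₁ = n₂ then (M : ℝ) else 0) + R)
      (fun n hn => hb n (mem_filter.mp hn).1) hB ?_).trans ?_
    · intro n₁ hn₁ n₂ hn₂
      simp only [hblk, mem_filter] at hn₁ hn₂
      have hclose : ∀ u v, u / Q = j → v / Q = j → u - v ≤ Q := by
        intro u v hu hv
        have e1 := Nat.div_add_mod u Q
        have e2 := Nat.div_add_mod v Q
        have e3 := Nat.mod_lt u hQ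
        rw [hu] at e1
        rw [hv] at e2
        omega
      rcases lt_trichotomy n₁ n₂ with h | h | h
      · rw [if_neg h.ne, zero_add, ← RCLike.norm_conj, map_sum]
        refine le_trans (le_of_eq ?_) (hcor' n₂ n₁ hn₂.1 hn₁.1 h (hclose _ _ hn₂.2 hn₁.2))
        congr 1
        refine sum_congr rfl fun m _ => ?_
        rw [map_mul, Complex.conj_conj, mul_comm]
      · rw [if_pos h]
        refine le_trans ?_ (le_add_of_nonneg_right hR)
        refine (norm_sum_le _ _).trans ?_
        calc _ ≤ ∑ m ∈ Ioc 0 M, (1 : ℝ) := sum_le_sum fun m _ => by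
              rw [norm_mul, RCLike.norm_conj]
              exact mul_le_one₀ (hGn _ _) (norm_nonneg _) (hGn _ _)
          _ = M := by simp
      · rw [if_neg h.ne', zero_add]
        exact hcor' n₁ n₂ hn₁.1 hn₂.1 h (hclose _ _ hn₁.2 hn₂.2)
    · gcongr
      rw [← nsmul_eq_mul, ← sum_const]
      refine sum_le_sum fun n₁ hn₁ => ?_
      rw [sum_add_distrib, sum_ite_eq, if_pos hn₁, sum_const, nsmul_eq_mul]
      gcongr
      exact card_filter_div_eq_le _ hQ j
  have h4 : ∑ j ∈ J, #(blk j) = K := by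
    rw [← card_eq_sum_card_fiberwise hmaps, Nat.card_Ioc]
    omega
  have h5 : ∑ m ∈ Ioc 0 M, ‖T m‖ ^ 2 ≤
      ((K : ℝ) / Q + 2) * (B ^ 2 * (K * (M + Q * R))) := by
    calc _ ≤ ∑ m ∈ Ioc 0 M, ((K : ℝ) / Q + 2) * ∑ j ∈ J, ‖∑ n ∈ blk j, b n * G n m‖ ^ 2 :=
          sum_le_sum fun m _ => h2 m
      _ = ((K : ℝ) / Q + 2) * ∑ j ∈ J, ∑ m ∈ Ioc 0 M, ‖∑ n ∈ blk j, b n * G n m‖ ^ 2 := by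
          rw [← mul_sum, sum_comm]
      _ ≤ ((K : ℝ) / Q + 2) * ∑ j ∈ J, B ^ 2 * (#(blk j) * (M + Q * R)) := by
          gcongr with j _
          exact h3 j
      _ = _ := by
          rw [← mul_sum, ← sum_mul, ← Nat.cast_sum, h4]
  rw [hS]
  calc _ ≤ M * (A ^ 2 * ∑ m ∈ Ioc 0 M, ‖T m‖ ^ 2) := h1
    _ ≤ (3 * X / K) * (A ^ 2 * (((K : ℝ) / Q + 2) * (B ^ 2 * (K * (3 * X / K + Q * R))))) := by
        gcongr
        exact h5.trans (by gcongr)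
    _ = _ := by ring

lemma sum_Ioc_one_two_pow (f : ℕ → ℂ) (L : ℕ) :
    ∑ n ∈ Ioc 1 (2 ^ L), f n = ∑ i ∈ range L, ∑ n ∈ Ioc (2 ^ i) (2 * 2 ^ i), f n := by
  induction L with
  | zero => simp
  | succ L ih =>
    rw [sum_range_succ, ← ih, pow_succ', sum_Ioc_consecutive _ Nat.one_le_two_pow (by omega)]

/-- A bilinear sum over `X < nm ≤ Y` whose variable `n` is effectively restricted to
`Q < n ≤ Z`. -/
theorem norm_bilinear_le (a b g : ℕ → ℂ) {X Y Q : ℕ} {A B A₀ F Z : ℝ}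
    (hQ : 1 ≤ Q) (hY : Y ≤ 3 * X) (hg : ∀ n, ‖g n‖ ≤ 1) (hA : 0 ≤ A) (hB : 0 ≤ B)
    (hA₀ : 1 ≤ A₀) (hF : 0 < F)
    (ha : ∀ m, m ≤ Y → ‖a m‖ ≤ A) (hb : ∀ n, n ≤ Y → ‖b n‖ ≤ B)
    (hbQ : ∀ n, n ≤ Q → b n = 0) (hZ : ∀ n m, n * m ≤ Y → b n ≠ 0 → a m ≠ 0 → (n : ℝ) ≤ Z)
    (hcor : ∀ K n₁ n₂ : ℕ, 1 ≤ K → n₁ ∈ Ioc K (2 * K) → n₂ ∈ Ioc K (2 * K) → n₂ < n₁ →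
      ‖∑ m ∈ Ioc (max (X / n₁) (X / n₂)) (min (Y / n₁) (Y / n₂)),
        g (n₁ * m) * (starRingEnd ℂ) (g (n₂ * m))‖ ≤
        A₀ * (√(F * (n₁ - n₂) / K) + X / K * (√(F * (n₁ - n₂) / K))⁻¹)) :
    ‖∑ n ∈ Ioc 0 Y, ∑ m ∈ Ioc (X / n) (Y / n), b n * a m * g (n * m)‖ ≤
      (Nat.log 2 Y + 1) *
        (7 * A₀ * A * B * √(X ^ 2 / Q + X * √(F * Q * Z) + X ^ 2 * √(Z / F))) := by
  set W := √((X : ℝ) ^ 2 / Q + X * √(F * Q * Z) + X ^ 2 * √(Z / F)) with hW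
  set t : ℕ → ℂ := fun n => ∑ m ∈ Ioc (X / n) (Y / n), b n * a m * g (n * m) with ht
  have hQ0 : (0 : ℝ) < Q := by exact_mod_cast hQ
  set L := Nat.log 2 Y + 1 with hL
  have hYL : Y ≤ 2 ^ L := (Nat.lt_pow_succ_log_self (by norm_num) Y).le
  -- The dyadic ranges omit n = 1, where b vanishes because 1 ≤ Q, and overshoot Y, where the inner
  -- sums are empty.
  have e1 : ∑ n ∈ Ioc 0 Y, t n = ∑ n ∈ Ioc 1 (2 ^ L), t n := by
    have e2 : ∑ n ∈ Ioc 0 Y, t n = ∑ n ∈ Ioc 0 (2 ^ L), t n := by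
      refine sum_subset (Ioc_subset_Ioc_right hYL) fun n hn hn' => ?_
      simp only [mem_Ioc] at hn hn'
      have : Y / n = 0 := Nat.div_eq_of_lt (by omega)
      simp [ht, this]
    rw [e2]
    symm
    refine sum_subset (Ioc_subset_Ioc_left (by norm_num)) fun n hn hn' => ?_
    simp only [mem_Ioc] at hn hn'
    have : n ≤ Q := by omega
    simp [ht, hbQ n this]
  have hdy : ∀ i ∈ range L, ‖∑ n ∈ Ioc (2 ^ i) (2 * 2 ^ i), t n‖ ≤ 7 * A₀ * A * B * W := by
    intro i _
    set K := 2 ^ i with hK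
    have hK1 : 1 ≤ K := Nat.one_le_two_pow
    have hK0 : (0 : ℝ) < K := by exact_mod_cast hK1
    -- A block that contributes has a witness n with K < n ≤ 2K and Q < n ≤ Z, which forces Q ≤ 2K
    -- and K ≤ Z.
    by_cases hz : ∀ n ∈ Ioc K (2 * K), t n = 0
    · rw [sum_eq_zero hz, norm_zero]
      positivity
    push Not at hz
    obtain ⟨n, hn, hne⟩ := hz
    obtain ⟨m, hm, hne'⟩ := exists_ne_zero_of_sum_ne_zero hne
    rw [mem_Ioc] at hn hm
    have hbn : b n ≠ 0 := fun h => hne' (by simp [h])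
    have ham : a m ≠ 0 := fun h => hne' (by simp [h])
    have hnm : n * m ≤ Y := by
      have := (Nat.le_div_iff_mul_le (by omega)).mp hm.2
      linarith
    have hKZ : (K : ℝ) ≤ Z := by
      have : (K : ℝ) ≤ n := by exact_mod_cast hn.1.le
      exact this.trans (hZ n m hnm hbn ham)
    have hQn : Q < n := by
      by_contra h
      exact hbn (hbQ n (by omega))
    have hQK : (Q : ℝ) ≤ 2 * K := by
      have : Q ≤ 2 * K := by omega
      exact_mod_cast this
    set R := A₀ * (√(F * Q / K) + X / K * √(K / F)) with hR
    have hR0 : 0 ≤ R := by positivity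
    have hb' : ∀ n ∈ Ioc K (2 * K), ‖(if n ≤ Y then b n else 0)‖ ≤ B := by
      intro n _
      split_ifs with h
      · exact hb n h
      · simpa using hB
    -- The coefficient is cut off at Y because (K, 2K] may reach past the range where b is bounded;
    -- the inner sum is empty there.
    have key := norm_bilinear_dyadic_sq_le a (fun n => if n ≤ Y then b n else 0) g (K := K)
      hK1 hQ hY hg hB hR0 ha hb' (by
      intro n₁ n₂ m₁ m₂ h₁ h₂
      refine (hcor K n₁ n₂ hK1 m₁ m₂ h₁).trans ?_
      have d1 : (1 : ℝ) ≤ (n₁ : ℝ) - n₂ := by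
        have : (n₂ : ℝ) + 1 ≤ n₁ := by exact_mod_cast h₁
        linarith
      have d2 : (n₁ : ℝ) - n₂ ≤ Q := by
        have : n₁ ≤ n₂ + Q := by omega
        have : (n₁ : ℝ) ≤ n₂ + Q := by exact_mod_cast this
        linarith
      rw [hR, ← Real.sqrt_inv, inv_div]
      gcongr
      exact le_mul_of_one_le_right hF.le d1)
    have e3 : ∑ n ∈ Ioc K (2 * K), ∑ m ∈ Ioc (X / n) (Y / n),
        (if n ≤ Y then b n else 0) * a m * g (n * m) = ∑ n ∈ Ioc K (2 * K), t n := by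
      refine sum_congr rfl fun n hn => ?_
      by_cases h : n ≤ Y
      · simp only [if_pos h, ht]
      · have : Y / n = 0 := Nat.div_eq_of_lt (by omega)
        simp [ht, this]
    simp only [e3] at key
    have hW2 : W ^ 2 = (X : ℝ) ^ 2 / Q + X * √(F * Q * Z) + X ^ 2 * √(Z / F) := by
      rw [hW, Real.sq_sqrt]
      positivity
    have e4 : (K : ℝ) / Q + 2 ≤ 5 * (K / Q) := by
      have : (1 : ℝ) ≤ 2 * (K / Q) := by
        rw [← mul_div_assoc, le_div_iff₀ hQ0]
        linarith
      linarith
    have e5 : (K : ℝ) * √(F * Q / K) ≤ √(F * Q * Z) := by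
      apply Real.le_sqrt_of_sq_le
      rw [mul_pow, Real.sq_sqrt (by positivity)]
      have : (K : ℝ) ^ 2 * (F * Q / K) = F * Q * K := by field_simp
      rw [this]
      gcongr
    have e6 : √(K / F) ≤ √(Z / F) := by gcongr
    have e7 : (K : ℝ) * R ≤ A₀ * (√(F * Q * Z) + X * √(Z / F)) := by
      have : (K : ℝ) * R = A₀ * (K * √(F * Q / K) + X * √(K / F)) := by
        rw [hR]
        field_simp
      rw [this]
      gcongr
    have e8 : A ^ 2 * B ^ 2 * (3 * X / K) * ((K : ℝ) / Q + 2) * (K * (3 * X / K + Q * R)) ≤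
        (7 * A₀ * A * B * W) ^ 2 := by
      calc _ ≤ A ^ 2 * B ^ 2 * (3 * X / K) * (5 * (K / Q)) * (K * (3 * X / K + Q * R)) := by
            gcongr
        _ = A ^ 2 * B ^ 2 * (15 * X) * (3 * (X / Q) + K * R) := by
            field_simp
            ring
        _ ≤ A ^ 2 * B ^ 2 * (15 * X) *
            (3 * A₀ * (X / Q) + 3 * A₀ * (√(F * Q * Z) + X * √(Z / F))) := by
            refine mul_le_mul_of_nonneg_left (add_le_add ?_ (e7.trans ?_)) (by positivity)
            · gcongr
              linarith
            · gcongr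
              linarith
        _ = 45 * A₀ * (A ^ 2 * B ^ 2) * W ^ 2 := by
            rw [hW2]
            ring
        -- The constant 45 = 15 · 3 is rounded up to the square 7².
        _ ≤ 49 * A₀ ^ 2 * (A ^ 2 * B ^ 2) * W ^ 2 := by
            gcongr ?_ * _ * _
            nlinarith
        _ = _ := by ring
    exact le_of_sq_le_sq (key.trans e8) (by positivity)
  change ‖∑ n ∈ Ioc 0 Y, t n‖ ≤ _
  rw [e1, sum_Ioc_one_two_pow]
  refine (norm_sum_le _ _).trans ((sum_le_sum hdy).trans ?_)
  rw [sum_const, nsmul_eq_mul, card_range, hL]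
  push_cast
  rfl

end

/-! ### Sums weighted by the von Mangoldt function. -/

section

open Finset ArithmeticFunction
open scoped ArithmeticFunction.zeta ArithmeticFunction.Moebius

lemma abs_moebius_real_le_one (n : ℕ) : |(μ : ArithmeticFunction ℝ) n| ≤ 1 := by
  rw [ArithmeticFunction.intCoe_apply, ← Int.cast_abs]
  exact_mod_cast abs_moebius_le_one

lemma abs_trunc_moebius_le_one (U n : ℕ) : |trunc (μ : ArithmeticFunction ℝ) U n| ≤ 1 := by
  rw [trunc_apply]
  split_ifs
  · exact abs_moebius_real_le_one n
  · simp

lemma abs_trunc_vonMangoldt_le (V n : ℕ) : |trunc Λ V n| ≤ Λ n := by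
  rw [trunc_apply]
  split_ifs
  · rw [abs_of_nonneg vonMangoldt_nonneg]
  · simp

/-- Once the Möbius factor is bounded by 1, what remains is at most Σ_{d ∣ n} Λ(d) = log n. -/
lemma abs_typeI_coeff_le (U V n : ℕ) :
    |(trunc (μ : ArithmeticFunction ℝ) U * trunc Λ V) n| ≤ Real.log n := by
  rw [ArithmeticFunction.mul_apply, ← vonMangoldt_sum,
    ← Nat.sum_divisorsAntidiagonal' (fun _ i => Λ i)]
  refine (abs_sum_le_sum_abs _ _).trans (sum_le_sum fun p _ => ?_)
  rw [abs_mul]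
  exact (mul_le_of_le_one_left (abs_nonneg _) (abs_trunc_moebius_le_one _ _)).trans
    (abs_trunc_vonMangoldt_le _ _)

lemma typeI_coeff_eq_zero {U V n : ℕ} (hn : U * V < n) :
    (trunc (μ : ArithmeticFunction ℝ) U * trunc Λ V) n = 0 := by
  rw [ArithmeticFunction.mul_apply]
  refine sum_eq_zero fun p hp => ?_
  rw [Nat.mem_divisorsAntidiagonal] at hp
  rw [trunc_apply, trunc_apply]
  by_cases h1 : p.1 ≤ U
  · by_cases h2 : p.2 ≤ V
    · have := Nat.mul_le_mul h1 h2
      omega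
    · simp [h2]
  · simp [h1]

lemma abs_typeII_coeff_le (U n : ℕ) :
    |(((μ : ArithmeticFunction ℝ) - trunc (μ : ArithmeticFunction ℝ) U) *
      (ζ : ArithmeticFunction ℝ)) n| ≤ #n.divisors := by
  rw [coe_mul_zeta_apply]
  refine (abs_sum_le_sum_abs _ _).trans ?_
  calc _ ≤ ∑ i ∈ n.divisors, (1 : ℝ) := sum_le_sum fun i _ => by
        rw [sub_trunc_apply]
        split_ifs
        · simp
        · exact abs_moebius_real_le_one i
    _ = _ := by simp

lemma typeII_coeff_eq_zero {U n : ℕ} (hn : n ≤ U) :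
    (((μ : ArithmeticFunction ℝ) - trunc (μ : ArithmeticFunction ℝ) U) *
      (ζ : ArithmeticFunction ℝ)) n = 0 := by
  rw [coe_mul_zeta_apply]
  refine sum_eq_zero fun i hi => ?_
  rw [sub_trunc_apply, if_pos ((Nat.divisor_le hi).trans hn)]

/-- A type I sum: the smooth variable carries the weight `1`. -/
lemma norm_typeI_le (c : ArithmeticFunction ℝ) (w : ArithmeticFunction ℝ) (g : ℕ → ℂ) {X Y M : ℕ}
    {C T : ℝ} (hC : 0 ≤ C) (hT : 0 ≤ T) (hc : ∀ k, k ≤ Y → |c k| ≤ C) (hcM : ∀ k, M < k → c k = 0)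
    (hg : ∀ k, 1 ≤ k → k ≤ Y → ‖∑ m ∈ Ioc (X / k) (Y / k), (w m : ℂ) * g (k * m)‖ ≤ T) :
    ‖∑ n ∈ Ioc X Y, (((c * w) n : ℝ) : ℂ) * g n‖ ≤ M * (C * T) := by
  rw [sum_mul_apply]
  refine (norm_sum_le _ _).trans ?_
  calc _ ≤ ∑ k ∈ Ioc 0 Y, if k ∈ Ioc 0 M then C * T else 0 := by
        refine sum_le_sum fun k hk => ?_
        rw [mem_Ioc] at hk
        have e : ∑ m ∈ Ioc (X / k) (Y / k), (c k : ℂ) * (w m : ℂ) * g (k * m) =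
            (c k : ℂ) * ∑ m ∈ Ioc (X / k) (Y / k), (w m : ℂ) * g (k * m) := by
          rw [mul_sum]
          exact sum_congr rfl fun m _ => by ring
        rw [e, norm_mul, Complex.norm_real, Real.norm_eq_abs]
        split_ifs with h
        · exact mul_le_mul (hc k hk.2) (hg k hk.1 hk.2) (norm_nonneg _) hC
        · rw [mem_Ioc] at h
          rw [hcM k (by omega)]
          simp
    _ ≤ _ := by
        rw [← sum_filter, sum_const, nsmul_eq_mul]
        gcongr
        calc #((Ioc 0 Y).filter (· ∈ Ioc 0 M)) ≤ #(Ioc 0 M) :=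
              card_le_card fun k hk => (mem_filter.mp hk).2
          _ = M := by simp

/-- The factor x^(1/3) stands for the number Q² of type I moduli when Q ≤ x^(1/6). Since F ≥
x^(11/12), the second term is at most x^(4/3 - 11/24) = x^(7/8). -/
lemma typeI_total_le {x F : ℝ} (hx1 : 1 ≤ x) (hF : x ^ (11 / 12 : ℝ) ≤ F) :
    x ^ (1 / 3 : ℝ) * (√F + x * (√F)⁻¹) ≤
      x ^ (1 / 3 : ℝ) * F ^ (1 / 2 : ℝ) + x ^ (11 / 12 : ℝ) := by
  have hx0 : 0 < x := by linarith
  have hF0 : 0 < F := lt_of_lt_of_le (by positivity) hF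
  have hFinv : F ^ (-(1 / 2) : ℝ) ≤ x ^ (-(11 / 24) : ℝ) := by
    have : x ^ (-(11 / 24) : ℝ) = (x ^ (11 / 12 : ℝ)) ^ (-(1 / 2) : ℝ) := by
      rw [← Real.rpow_mul hx0.le]
      norm_num
    rw [this]
    exact Real.rpow_le_rpow_of_nonpos (by positivity) hF (by norm_num)
  have e : x ^ (1 / 3 : ℝ) * (√F + x * (√F)⁻¹) = x ^ (1 / 3 : ℝ) * F ^ (1 / 2 : ℝ) +
      x ^ (1 / 3 : ℝ) * x * F ^ (-(1 / 2) : ℝ) := by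
    rw [Real.sqrt_eq_rpow, Real.rpow_neg hF0.le]
    ring
  rw [e]
  gcongr
  calc x ^ (1 / 3 : ℝ) * x * F ^ (-(1 / 2) : ℝ) ≤
        x ^ (1 / 3 : ℝ) * x ^ (1 : ℝ) * x ^ (-(11 / 24) : ℝ) := by
        rw [Real.rpow_one]
        gcongr
    _ = x ^ (7 / 8 : ℝ) := by
        rw [← Real.rpow_add hx0, ← Real.rpow_add hx0]
        norm_num
    _ ≤ x ^ (11 / 12 : ℝ) := Real.rpow_le_rpow_of_exponent_le hx1 (by norm_num)

/-- This evaluates the square root in `norm_bilinear_le` for Q ≍ x^(1/6) and Z = 3√x. The term x²/Q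
is of the order of the square of x^(11/12) and is the origin of that exponent; the middle term is of
the order of the square of x^(2/3) F^(1/4); the last is smaller than the first because F ≥
x^(11/12). -/
lemma typeII_total_le {x F Q : ℝ} (hx1 : 1 ≤ x) (hF : x ^ (11 / 12 : ℝ) ≤ F) (hQ1 : 1 ≤ Q)
    (hQle : Q ≤ x ^ (1 / 6 : ℝ)) (hQge : x ^ (1 / 6 : ℝ) ≤ 2 * Q) :
    √(x ^ 2 / Q + x * √(F * Q * (3 * √x)) + x ^ 2 * √(3 * √x / F)) ≤
      2 * (x ^ (11 / 12 : ℝ) + x ^ (2 / 3 : ℝ) * F ^ (1 / 4 : ℝ)) := by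
  have hx0 : 0 < x := by linarith
  have hF0 : 0 < F := lt_of_lt_of_le (by positivity) hF
  set P1 := x ^ (11 / 12 : ℝ) with hP1
  set P2 := x ^ (2 / 3 : ℝ) * F ^ (1 / 4 : ℝ) with hP2
  have hP10 : 0 < P1 := by positivity
  have hP20 : 0 < P2 := by positivity
  apply Real.sqrt_le_iff.mpr
  refine ⟨by positivity, ?_⟩
  have w1 : x ^ 2 / Q ≤ 2 * P1 ^ 2 := by
    rw [div_le_iff₀ (by linarith)]
    have : x ^ 2 = P1 ^ 2 * x ^ (1 / 6 : ℝ) := by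
      rw [hP1, ← Real.rpow_natCast, ← Real.rpow_natCast, ← Real.rpow_mul hx0.le,
        ← Real.rpow_add hx0]
      norm_num
    rw [this]
    calc P1 ^ 2 * x ^ (1 / 6 : ℝ) ≤ P1 ^ 2 * (2 * Q) := by gcongr
      _ = _ := by ring
  have w2 : x * √(F * Q * (3 * √x)) ≤ 2 * P2 ^ 2 := by
    have e1 : √(F * Q * (3 * √x)) ≤ 2 * (F ^ (1 / 2 : ℝ) * x ^ (1 / 3 : ℝ)) := by
      apply Real.sqrt_le_iff.mpr
      refine ⟨by positivity, ?_⟩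
      have e2 : (2 * (F ^ (1 / 2 : ℝ) * x ^ (1 / 3 : ℝ))) ^ 2 =
          4 * (F * (x ^ (1 / 6 : ℝ) * x ^ (1 / 2 : ℝ))) := by
        rw [← Real.rpow_add hx0, mul_pow, mul_pow, ← Real.rpow_natCast (F ^ _),
          ← Real.rpow_natCast (x ^ _), ← Real.rpow_mul hF0.le, ← Real.rpow_mul hx0.le]
        norm_num
      rw [e2, Real.sqrt_eq_rpow]
      have e3 : F * Q * (3 * x ^ (1 / 2 : ℝ)) ≤ F * x ^ (1 / 6 : ℝ) * (4 * x ^ (1 / 2 : ℝ)) := by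
        gcongr
        norm_num
      refine e3.trans (le_of_eq ?_)
      ring
    have e3 : x * (2 * (F ^ (1 / 2 : ℝ) * x ^ (1 / 3 : ℝ))) = 2 * P2 ^ 2 := by
      have e4 : P2 ^ 2 = x ^ (1 : ℝ) * x ^ (1 / 3 : ℝ) * F ^ (1 / 2 : ℝ) := by
        rw [hP2, mul_pow, ← Real.rpow_natCast (F ^ _),
          ← Real.rpow_natCast (x ^ _), ← Real.rpow_mul hF0.le, ← Real.rpow_mul hx0.le,
          ← Real.rpow_add hx0]
        norm_num
      rw [e4, Real.rpow_one]
      ring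
    rw [← e3]
    gcongr
  have w3 : x ^ 2 * √(3 * √x / F) ≤ 2 * P1 ^ 2 := by
    have e1 : √(3 * √x / F) ≤ 2 * x ^ (-(1 / 6) : ℝ) := by
      apply Real.sqrt_le_iff.mpr
      refine ⟨by positivity, ?_⟩
      rw [div_le_iff₀ hF0]
      have e2 : (2 * x ^ (-(1 / 6) : ℝ)) ^ 2 * x ^ (11 / 12 : ℝ) = 4 * x ^ (7 / 12 : ℝ) := by
        rw [mul_pow, ← Real.rpow_natCast (x ^ _), ← Real.rpow_mul hx0.le, mul_assoc,
          ← Real.rpow_add hx0]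
        norm_num
      have e3 : √x ≤ x ^ (7 / 12 : ℝ) := by
        rw [Real.sqrt_eq_rpow]
        exact Real.rpow_le_rpow_of_exponent_le hx1 (by norm_num)
      calc 3 * √x ≤ 4 * x ^ (7 / 12 : ℝ) := by
            linarith [Real.sqrt_nonneg x]
        _ = _ := e2.symm
        _ ≤ _ := by gcongr
    have e2 : x ^ 2 * (2 * x ^ (-(1 / 6) : ℝ)) = 2 * P1 ^ 2 := by
      have e3 : P1 ^ 2 = x ^ (2 : ℝ) * x ^ (-(1 / 6) : ℝ) := by
        rw [hP1, ← Real.rpow_natCast, ← Real.rpow_mul hx0.le, ← Real.rpow_add hx0]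
        norm_num
      rw [e3, Real.rpow_two]
      ring
    rw [← e2]
    gcongr
  have := mul_pos hP10 hP20
  calc _ ≤ 2 * P1 ^ 2 + 2 * P2 ^ 2 + 2 * P1 ^ 2 := add_le_add (add_le_add w1 w2) w3
    _ ≤ (2 * (P1 + P2)) ^ 2 := by nlinarith only [this, sq_nonneg P2]

/-- Sums over primes by Vaughan's identity: type I and type II information on `g` gives a bound
for `∑ Λ(n) g(n)`. -/
theorem norm_sum_vonMangoldt_mul_le (g : ℕ → ℂ) {X Y : ℕ} {A₀ F D : ℝ} (hX : 1 ≤ X)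
    (hY : Y ≤ 3 * X) (hg : ∀ n, ‖g n‖ ≤ 1) (hA₀ : 1 ≤ A₀) (hF : (X : ℝ) ^ (11 / 12 : ℝ) ≤ F)
    (hD : 1 ≤ D) (hDlog : Nat.log 2 Y + 1 ≤ D) (hDl : Real.log Y ≤ D)
    (hDd : ∀ n, n ≤ Y → (#n.divisors : ℝ) ≤ D)
    (hI : ∀ m b : ℕ, 1 ≤ m → m ≤ Y → X / m ≤ b → b ≤ Y / m →
      ‖∑ n ∈ Ioc (X / m) b, g (m * n)‖ ≤ A₀ * (√F + X * (√F)⁻¹))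
    (hcor : ∀ K n₁ n₂ : ℕ, 1 ≤ K → n₁ ∈ Ioc K (2 * K) → n₂ ∈ Ioc K (2 * K) → n₂ < n₁ →
      ‖∑ m ∈ Ioc (max (X / n₁) (X / n₂)) (min (Y / n₁) (Y / n₂)),
        g (n₁ * m) * (starRingEnd ℂ) (g (n₂ * m))‖ ≤
        A₀ * (√(F * (n₁ - n₂) / K) + X / K * (√(F * (n₁ - n₂) / K))⁻¹)) :
    ‖∑ n ∈ Ioc X Y, (Λ n : ℂ) * g n‖ ≤ 50 * A₀ * D ^ 3 *
      ((X : ℝ) ^ (11 / 12 : ℝ) + (X : ℝ) ^ (2 / 3 : ℝ) * F ^ (1 / 4 : ℝ) +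
        (X : ℝ) ^ (1 / 3 : ℝ) * F ^ (1 / 2 : ℝ)) := by
  set x : ℝ := (X : ℝ) with hx
  have hx1 : 1 ≤ x := by rw [hx]; exact_mod_cast hX
  have hx0 : 0 < x := by linarith
  have hF0 : 0 < F := lt_of_lt_of_le (by positivity) hF
  -- Q serves as both Vaughan cut-offs, giving type I level Q² ≤ x^(1/3), and also as the block
  -- length in Cauchy–Schwarz.
  set Q := ⌊x ^ (1 / 6 : ℝ)⌋₊ with hQdef
  have hx6 : 1 ≤ x ^ (1 / 6 : ℝ) := Real.one_le_rpow hx1 (by norm_num)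
  have hQ : 1 ≤ Q := Nat.le_floor (by simpa using hx6)
  have hQle : (Q : ℝ) ≤ x ^ (1 / 6 : ℝ) := Nat.floor_le (by positivity)
  have hQ1 : (1 : ℝ) ≤ Q := by exact_mod_cast hQ
  have hQge : x ^ (1 / 6 : ℝ) ≤ 2 * Q := by
    have := Nat.lt_floor_add_one (x ^ (1 / 6 : ℝ))
    rw [← hQdef] at this
    linarith
  have hQX : Q ≤ X := by
    have : x ^ (1 / 6 : ℝ) ≤ x ^ (1 : ℝ) := Real.rpow_le_rpow_of_exponent_le hx1 (by norm_num)
    rw [Real.rpow_one] at this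
    have := hQle.trans this
    rw [hx] at this
    exact_mod_cast this
  set T := A₀ * (√F + x * (√F)⁻¹) with hT
  have hT0 : 0 ≤ T := by positivity
  have hsF : √F = F ^ (1 / 2 : ℝ) := Real.sqrt_eq_rpow F
  have hlogm : ∀ m : ℕ, m ≤ Y → Real.log m ≤ D := by
    intro m hm
    rcases Nat.eq_zero_or_pos m with rfl | h
    · simp
      linarith
    · refine le_trans (Real.log_le_log (by exact_mod_cast h) (by exact_mod_cast hm)) hDl
  have hΛ : ∀ m : ℕ, m ≤ Y → Λ m ≤ D := fun m hm => vonMangoldt_le_log.trans (hlogm m hm)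
  set bc : ArithmeticFunction ℝ :=
      ((μ : ArithmeticFunction ℝ) - trunc (μ : ArithmeticFunction ℝ) Q)
      * (ζ : ArithmeticFunction ℝ) with hbc
  set Λ' : ArithmeticFunction ℝ := Λ - trunc Λ Q with hΛ'
  -- The type II term is split according to the size of the Λ variable, so that the outer variable
  -- never exceeds 3√x. At most S, the Λ variable itself is outer; above S, nm ≤ 3X makes the other
  -- one short.
  set S := Nat.sqrt X with hS
  have hΛ'0 : ∀ n, n ≤ Q → Λ' n = 0 := fun n hn => by rw [hΛ', sub_trunc_apply, if_pos hn]
  have hΛ'n : ∀ n, n ≤ Y → |Λ' n| ≤ D := by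
    intro n hn
    rw [hΛ', sub_trunc_apply]
    split_ifs
    · simp
      linarith
    · rw [abs_of_nonneg vonMangoldt_nonneg]
      exact hΛ n hn
  have hsplit : ∑ n ∈ Ioc X Y, (Λ n : ℂ) * g n =
      ∑ n ∈ Ioc X Y, (((trunc (μ : ArithmeticFunction ℝ) Q * log) n : ℝ) : ℂ) * g n
      - ∑ n ∈ Ioc X Y, ((((trunc (μ : ArithmeticFunction ℝ) Q * trunc Λ Q) *
          (ζ : ArithmeticFunction ℝ)) n : ℝ) : ℂ) * g n
      + ∑ n ∈ Ioc X Y, (((trunc Λ' S * bc) n : ℝ) : ℂ) * g n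
      + ∑ n ∈ Ioc X Y, (((bc * (Λ' - trunc Λ' S)) n : ℝ) : ℂ) * g n := by
    rw [← sum_sub_distrib, ← sum_add_distrib, ← sum_add_distrib]
    refine sum_congr rfl fun n hn => ?_
    have e1 : Λ n = trunc Λ Q n + (trunc (μ : ArithmeticFunction ℝ) Q * log) n
        - ((trunc (μ : ArithmeticFunction ℝ) Q * trunc Λ Q) * (ζ : ArithmeticFunction ℝ)) n
        + (trunc Λ' S * bc) n + (bc * (Λ' - trunc Λ' S)) n := by
      have e2 : (Λ : ArithmeticFunction ℝ) = trunc Λ Q + trunc (μ : ArithmeticFunction ℝ) Q * log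
          + -((trunc (μ : ArithmeticFunction ℝ) Q * trunc Λ Q) * (ζ : ArithmeticFunction ℝ))
          + trunc Λ' S * bc + bc * (Λ' - trunc Λ' S) := by
        conv_lhs => rw [vaughan Q Q]
        rw [← hbc, ← hΛ']
        ring
      conv_lhs => rw [e2]
      simp only [ArithmeticFunction.add_apply, ArithmeticFunction.neg_apply]
      ring
    have e3 : trunc Λ Q n = 0 := by
      rw [mem_Ioc] at hn
      rw [trunc_apply, if_neg (by omega)]
    rw [e1, e3]
    push_cast
    ring
  have hY1 : ∀ k, Y / k ≤ Y := fun k => Nat.div_le_self Y k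
  have b1 : ‖∑ n ∈ Ioc X Y, (((trunc (μ : ArithmeticFunction ℝ) Q * log) n : ℝ) : ℂ) * g n‖ ≤
      Q * (1 * (2 * D * T)) := by
    refine norm_typeI_le _ _ g zero_le_one (by positivity)
      (fun k _ => abs_trunc_moebius_le_one Q k) (fun k hk => by rw [trunc_apply, if_neg (by omega)])
      (fun k hk hkY => ?_)
    refine norm_sum_monotone_mul_le (fun m => log m) (fun m => g (k * m)) ?_ ?_ ?_ (by linarith) hT0
      (fun b hb1 hb2 => hI k b hk hkY hb1 hb2)
    · intro m n h1 h2 _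
      simp only [log_apply]
      have : 0 < m := (Nat.zero_le _).trans_lt h1
      gcongr
    · intro n _ _
      simp only [log_apply]
      exact Real.log_natCast_nonneg n
    · intro n _ h2
      simp only [log_apply]
      exact hlogm n (h2.trans (hY1 k))
  have b2 : ‖∑ n ∈ Ioc X Y, ((((trunc (μ : ArithmeticFunction ℝ) Q * trunc Λ Q) *
      (ζ : ArithmeticFunction ℝ)) n : ℝ) : ℂ) * g n‖ ≤ (Q * Q : ℕ) * (D * T) := by
    refine norm_typeI_le _ _ g (by linarith) hT0
      (fun k hk => (abs_typeI_coeff_le Q Q k).trans (hlogm k hk))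
      (fun k hk => typeI_coeff_eq_zero hk) (fun k hk hkY => ?_)
    rcases le_total (X / k) (Y / k) with h | h
    · refine le_trans (le_of_eq ?_) (hI k (Y / k) hk hkY h le_rfl)
      congr 1
      refine sum_congr rfl fun m hm => ?_
      rw [mem_Ioc] at hm
      have hm0 : m ≠ 0 := ((Nat.zero_le _).trans_lt hm.1).ne'
      rw [natCoe_apply, zeta_apply_ne hm0]
      simp
    · rw [Ioc_eq_empty_of_le h]
      simpa using hT0
  set Z := 3 * √x with hZ
  have hsqrt1 : (S : ℝ) ≤ √x := by
    apply Real.le_sqrt_of_sq_le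
    rw [hx]
    exact_mod_cast Nat.sqrt_le' X
  have hsqrt2 : √x < S + 1 := by
    rw [Real.sqrt_lt' (by positivity), hx]
    exact_mod_cast Nat.lt_succ_sqrt' X
  set W := √(x ^ 2 / Q + x * √(F * Q * Z) + x ^ 2 * √(Z / F)) with hW
  have b3 : ‖∑ n ∈ Ioc X Y, (((trunc Λ' S * bc) n : ℝ) : ℂ) * g n‖ ≤
      (Nat.log 2 Y + 1) * (7 * A₀ * D * D * W) := by
    rw [sum_mul_apply]
    refine norm_bilinear_le (fun m => (bc m : ℂ)) (fun n => (trunc Λ' S n : ℂ)) g hQ hY hg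
      (by linarith) (by linarith) hA₀ hF0 ?_ ?_ ?_ ?_ hcor
    · intro m hm
      rw [Complex.norm_real]
      exact (abs_typeII_coeff_le Q m).trans (hDd m hm)
    · intro n hn
      rw [Complex.norm_real, Real.norm_eq_abs, trunc_apply]
      split_ifs
      · exact hΛ'n n hn
      · simp
        linarith
    · intro n hn
      rw [trunc_apply, hΛ'0 n hn]
      simp
    · intro n m _ hn _
      have : n ≤ S := by
        by_contra h
        exact hn (by simp [trunc_apply, h])
      have : (n : ℝ) ≤ S := by exact_mod_cast this
      have := Real.sqrt_nonneg x
      linarith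
  have b4 : ‖∑ n ∈ Ioc X Y, (((bc * (Λ' - trunc Λ' S)) n : ℝ) : ℂ) * g n‖ ≤
      (Nat.log 2 Y + 1) * (7 * A₀ * D * D * W) := by
    rw [sum_mul_apply]
    refine norm_bilinear_le (fun m => ((Λ' - trunc Λ' S) m : ℂ)) (fun n => (bc n : ℂ)) g hQ hY hg
      (by linarith) (by linarith) hA₀ hF0 ?_ ?_ ?_ ?_ hcor
    · intro n hn
      rw [Complex.norm_real, Real.norm_eq_abs, sub_trunc_apply]
      split_ifs
      · simp
        linarith
      · exact hΛ'n n hn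
    · intro m hm
      rw [Complex.norm_real]
      exact (abs_typeII_coeff_le Q m).trans (hDd m hm)
    · intro n hn
      rw [hbc, typeII_coeff_eq_zero hn]
      simp
    · intro n m hnm _ hm
      have h1 : S + 1 ≤ m := by
        by_contra h
        exact hm (by rw [sub_trunc_apply, if_pos (by omega)]; simp)
      have h2 : (S : ℝ) + 1 ≤ m := by exact_mod_cast h1
      have h3 : (n : ℝ) * m ≤ 3 * x := by rw [hx]; exact_mod_cast hnm.trans hY
      have h4 : (n : ℝ) * √x ≤ 3 * √x * √x := by
        rw [mul_assoc, Real.mul_self_sqrt hx0.le]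
        refine le_trans ?_ h3
        gcongr
        linarith
      exact le_of_mul_le_mul_right h4 (Real.sqrt_pos.mpr hx0)
  set P1 := x ^ (11 / 12 : ℝ) with hP1
  set P2 := x ^ (2 / 3 : ℝ) * F ^ (1 / 4 : ℝ) with hP2
  set P3 := x ^ (1 / 3 : ℝ) * F ^ (1 / 2 : ℝ) with hP3
  have hP10 : 0 < P1 := by positivity
  have hP20 : 0 < P2 := by positivity
  have hP30 : 0 < P3 := by positivity
  have hQ2 : (Q : ℝ) * Q ≤ x ^ (1 / 3 : ℝ) := by
    have : x ^ (1 / 3 : ℝ) = x ^ (1 / 6 : ℝ) * x ^ (1 / 6 : ℝ) := by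
      rw [← Real.rpow_add hx0]
      norm_num
    rw [this]
    gcongr
  have hQQ : (Q : ℝ) ≤ Q * Q := by nlinarith
  have hTb : x ^ (1 / 3 : ℝ) * T ≤ A₀ * (P3 + P1) := by
    have := typeI_total_le hx1 hF
    calc x ^ (1 / 3 : ℝ) * T = A₀ * (x ^ (1 / 3 : ℝ) * (√F + x * (√F)⁻¹)) := by
          rw [hT]
          ring
      _ ≤ _ := by gcongr
  have hWb : W ≤ 2 * (P1 + P2) := typeII_total_le hx1 hF hQ1 hQle hQge
  rw [hsplit]
  have n1 := norm_add_le
      (∑ n ∈ Ioc X Y, (((trunc (μ : ArithmeticFunction ℝ) Q * log) n : ℝ) : ℂ) * g n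
      - ∑ n ∈ Ioc X Y, ((((trunc (μ : ArithmeticFunction ℝ) Q * trunc Λ Q) *
          (ζ : ArithmeticFunction ℝ)) n : ℝ) : ℂ) * g n
      + ∑ n ∈ Ioc X Y, (((trunc Λ' S * bc) n : ℝ) : ℂ) * g n)
      (∑ n ∈ Ioc X Y, (((bc * (Λ' - trunc Λ' S)) n : ℝ) : ℂ) * g n)
  have n2 := norm_add_le
      (∑ n ∈ Ioc X Y, (((trunc (μ : ArithmeticFunction ℝ) Q * log) n : ℝ) : ℂ) * g n
      - ∑ n ∈ Ioc X Y, ((((trunc (μ : ArithmeticFunction ℝ) Q * trunc Λ Q) *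
          (ζ : ArithmeticFunction ℝ)) n : ℝ) : ℂ) * g n)
      (∑ n ∈ Ioc X Y, (((trunc Λ' S * bc) n : ℝ) : ℂ) * g n)
  have n3 := norm_sub_le
      (∑ n ∈ Ioc X Y, (((trunc (μ : ArithmeticFunction ℝ) Q * log) n : ℝ) : ℂ) * g n)
      (∑ n ∈ Ioc X Y, ((((trunc (μ : ArithmeticFunction ℝ) Q * trunc Λ Q) *
          (ζ : ArithmeticFunction ℝ)) n : ℝ) : ℂ) * g n)
  have hD0 : 0 ≤ D := by linarith
  have c1 : (Q : ℝ) * (1 * (2 * D * T)) ≤ 2 * D * (A₀ * (P3 + P1)) := by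
    calc (Q : ℝ) * (1 * (2 * D * T)) = 2 * D * (Q * T) := by ring
      _ ≤ 2 * D * (x ^ (1 / 3 : ℝ) * T) := by
          gcongr
          exact hQQ.trans hQ2
      _ ≤ _ := by gcongr
  have c2 : ((Q * Q : ℕ) : ℝ) * (D * T) ≤ D * (A₀ * (P3 + P1)) := by
    push_cast
    calc (Q : ℝ) * Q * (D * T) = D * (Q * Q * T) := by ring
      _ ≤ D * (x ^ (1 / 3 : ℝ) * T) := by gcongr
      _ ≤ _ := by gcongr
  have c3 : ((Nat.log 2 Y : ℝ) + 1) * (7 * A₀ * D * D * W) ≤ 14 * A₀ * D ^ 3 * (P1 + P2) := by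
    calc _ ≤ D * (7 * A₀ * D * D * (2 * (P1 + P2))) := by gcongr
      _ = _ := by ring
  have c4 : D * (A₀ * (P3 + P1)) ≤ D ^ 3 * (A₀ * (P3 + P1)) := by
    gcongr
    exact le_self_pow₀ hD (by norm_num)
  have c5 : 0 ≤ A₀ * D ^ 3 * P1 := by positivity
  have c6 : 0 ≤ A₀ * D ^ 3 * P2 := by positivity
  have c7 : 0 ≤ A₀ * D ^ 3 * P3 := by positivity
  linarith

end

/-! ### Second derivative test for the phase and for its correlations. -/

section

open Finset

/-- A second difference is a value of the second derivative. -/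
lemma exists_second_difference_eq (f f' f'' : ℝ → ℝ) (a : ℝ)
    (h1 : ∀ t ∈ Set.Icc a (a + 2), HasDerivAt f (f' t) t)
    (h2 : ∀ t ∈ Set.Icc a (a + 2), HasDerivAt f' (f'' t) t) :
    ∃ t ∈ Set.Icc a (a + 2), (f (a + 2) - f (a + 1)) - (f (a + 1) - f a) = f'' t := by
  have hG : ∀ t ∈ Set.Icc a (a + 1),
      HasDerivAt (fun u => f (u + 1) - f u) (f' (t + 1) - f' t) t := by
    intro t ht
    have e1 := h1 (t + 1) ⟨by linarith [ht.1], by linarith [ht.2]⟩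
    exact (e1.comp_add_const t 1).sub (h1 t ⟨ht.1, by linarith [ht.2]⟩)
  obtain ⟨c, hc, hc'⟩ := exists_hasDerivAt_eq_slope (fun u => f (u + 1) - f u)
    (fun t => f' (t + 1) - f' t) (by linarith : a < a + 1)
    (fun t ht => (hG t ht).continuousAt.continuousWithinAt)
    (fun t ht => hG t (Set.Ioo_subset_Icc_self ht))
  have hsub : ∀ t ∈ Set.Icc c (c + 1), t ∈ Set.Icc a (a + 2) := fun t ht =>
    ⟨by linarith [ht.1, hc.1], by linarith [ht.2, hc.2]⟩
  obtain ⟨d, hd, hd'⟩ := exists_hasDerivAt_eq_slope f' f'' (by linarith : c < c + 1)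
    (fun t ht => (h2 t (hsub t ht)).continuousAt.continuousWithinAt)
    (fun t ht => h2 t (hsub t (Set.Ioo_subset_Icc_self ht)))
  refine ⟨d, hsub d (Set.Ioo_subset_Icc_self hd), ?_⟩
  rw [hd']
  simp only [add_sub_cancel_left, div_one] at hc' ⊢
  rw [hc']
  ring_nf

/-- Van der Corput's second derivative test. -/
theorem van_der_corput_deriv (f f' f'' : ℝ → ℝ) {a b : ℕ} {l C : ℝ} (hl : 0 < l) (hC : 1 ≤ C)
    (h1 : ∀ t ∈ Set.Icc ((a : ℝ) + 1) (b + 1), HasDerivAt f (f' t) t)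
    (h2 : ∀ t ∈ Set.Icc ((a : ℝ) + 1) (b + 1), HasDerivAt f' (f'' t) t)
    (h3 : ∀ t ∈ Set.Icc ((a : ℝ) + 1) (b + 1), l ≤ f'' t ∧ f'' t ≤ C * l) :
    ‖∑ n ∈ Ioc a b, ex (f n)‖ ≤ 8 * C * (b * √l + (√l)⁻¹) := by
  rcases le_total b a with hba | hab
  · rw [Ioc_eq_empty_of_le hba]
    simp only [sum_empty, norm_zero]
    positivity
  -- A second difference based at n ≤ b - 1... in the shifted range n < b involves n + 2 ≤ b + 1, so
  -- the derivative hypotheses reach one step beyond the last summand.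
  have key : ∀ n : ℕ, a + 1 ≤ n → n + 1 < b + 1 →
      l ≤ (f ((n + 2 : ℕ) : ℝ) - f ((n + 1 : ℕ) : ℝ)) - (f ((n + 1 : ℕ) : ℝ) - f n) ∧
      (f ((n + 2 : ℕ) : ℝ) - f ((n + 1 : ℕ) : ℝ)) - (f ((n + 1 : ℕ) : ℝ) - f n) ≤ C * l := by
    intro n hn hnb
    have e1 : (a : ℝ) + 1 ≤ n := by exact_mod_cast hn
    have e2 : (n : ℝ) + 1 ≤ b := by exact_mod_cast (by omega : n + 1 ≤ b)
    have hsub : ∀ t ∈ Set.Icc (n : ℝ) (n + 2), t ∈ Set.Icc ((a : ℝ) + 1) (b + 1) := fun t ht =>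
      ⟨by linarith [ht.1], by linarith [ht.2]⟩
    obtain ⟨t, ht, hE⟩ := exists_second_difference_eq f f' f'' n (fun t ht => h1 t (hsub t ht))
      (fun t ht => h2 t (hsub t ht))
    push_cast
    rw [hE]
    exact h3 t (hsub t ht)
  have hI : Ioc a b = Ico (a + 1) (b + 1) := by
    ext x
    simp only [mem_Ioc, mem_Ico]
    omega
  rw [hI]
  refine (van_der_corput (fun n => f n) hl hC (by omega) (fun n hn hnb => (key n hn hnb).1)
    (fun n hn hnb => (key n hn hnb).2)).trans ?_
  push_cast
  gcongr
  linarith [Nat.cast_nonneg (α := ℝ) a]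

/-- The phase `-r (u - β) ^ γ + θ u`. -/
noncomputable def phase (r β γ θ u : ℝ) : ℝ := -(r * (u - β) ^ γ) + θ * u

lemma hasDerivAt_rpow_comp {β y t : ℝ} (s : ℝ) (h : 0 < y * t - β) :
    HasDerivAt (fun t => (y * t - β) ^ s) (s * y * (y * t - β) ^ (s - 1)) t := by
  have h1 : HasDerivAt (fun t => y * t - β) y t := by
    simpa using ((hasDerivAt_id t).const_mul y).sub_const β
  convert! h1.rpow_const (p := s) (Or.inl h.ne') using 1
  ring

lemma hasDerivAt_phase (r β γ θ : ℝ) {y t : ℝ} (h : 0 < y * t - β) :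
    HasDerivAt (fun t => phase r β γ θ (y * t))
      (-(r * (γ * y * (y * t - β) ^ (γ - 1))) + θ * y) t := by
  have h2 := (hasDerivAt_rpow_comp γ h).const_mul r
  have h3 : HasDerivAt (fun t => θ * (y * t)) (θ * y) t := by
    simpa using ((hasDerivAt_id t).const_mul y).const_mul θ
  exact h2.neg.add h3

/-- The twist θ disappears here, which makes all later bounds uniform in θ. For r > 0 and 0 < γ < 1
the second derivative is positive. -/
lemma hasDerivAt_phase' (r β γ θ : ℝ) {y t : ℝ} (h : 0 < y * t - β) :
    HasDerivAt (fun t => -(r * (γ * y * (y * t - β) ^ (γ - 1))) + θ * y)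
      (r * γ * (1 - γ) * (y ^ 2 * (y * t - β) ^ (γ - 2))) t := by
  have h2 :=
    (((hasDerivAt_rpow_comp (γ - 1) h).const_mul (γ * y)).const_mul r).neg.add_const (θ * y)
  convert! h2 using 1
  have : γ - 1 - 1 = γ - 2 := by ring
  rw [this]
  ring

/-- Comparison of a negative power of `v` with that of `x`, when `v` is comparable to `x`. -/
lemma rpow_neg_bounds {x v : ℝ} (s : ℝ) (k : ℕ) (hx : 0 < x) (h1 : x / 2 ≤ v) (h2 : v ≤ 7 * x)
    (hs : s ≤ 0) (hk : -(k : ℝ) ≤ s) :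
    x ^ s / 7 ^ k ≤ v ^ s ∧ v ^ s ≤ 2 ^ k * x ^ s := by
  have hv : 0 < v := by linarith
  constructor
  · calc x ^ s / 7 ^ k = 7 ^ (-(k : ℝ)) * x ^ s := by
          rw [Real.rpow_neg (by norm_num), Real.rpow_natCast]
          ring
      _ ≤ 7 ^ s * x ^ s := by
          gcongr
          norm_num
      _ = (7 * x) ^ s := (Real.mul_rpow (by norm_num) hx.le).symm
      _ ≤ v ^ s := Real.rpow_le_rpow_of_nonpos hv h2 hs
  · calc v ^ s ≤ (x / 2) ^ s := Real.rpow_le_rpow_of_nonpos (by positivity) h1 hs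
      _ = 2 ^ (-s) * x ^ s := by
          rw [Real.div_rpow hx.le (by norm_num), Real.rpow_neg (by norm_num)]
          ring
      _ ≤ 2 ^ (k : ℝ) * x ^ s := by
          gcongr
          · norm_num
          · linarith
      _ = _ := by rw [Real.rpow_natCast]

/-- The type I estimate for the phase. -/
theorem typeI_phase {κ β γ : ℝ} (hκ : 0 < κ) (hγ0 : 0 < γ) (hγ1 : γ < 1) :
    ∃ A : ℝ, 1 ≤ A ∧ ∀ (X Y : ℕ) (h θ : ℝ), 1 ≤ X → 2 * |β| ≤ X → Y ≤ 3 * X → 0 < h →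
      ∀ m b : ℕ, 1 ≤ m → m ≤ Y → b ≤ Y / m →
      ‖∑ n ∈ Ioc (X / m) b, ex (phase (κ * h) β γ θ ((m * n : ℕ) : ℝ))‖ ≤
        A * (√(h * (X : ℝ) ^ γ) + X * (√(h * (X : ℝ) ^ γ))⁻¹) := by
  -- The argument mt - β stays in [x/2, 7x], so its power γ - 2 lies between x^(γ-2)/7² and 2²
  -- x^(γ-2). This gives 49 here and the ratio 196 = 7² · 2² below.
  set c₀ := κ * γ * (1 - γ) / 49 with hc₀
  have hc₀0 : 0 < c₀ := by
    have : 0 < 1 - γ := by linarith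
    positivity
  set s := √c₀ with hs
  have hs0 : 0 < s := Real.sqrt_pos.mpr hc₀0
  refine ⟨1 + 8 * 196 * (3 * s + s⁻¹), by
    have : 0 ≤ 8 * 196 * (3 * s + s⁻¹) := by positivity
    linarith, ?_⟩
  intro X Y h θ hX hβ hY hh m b hm hmY hb
  set x : ℝ := (X : ℝ) with hx
  have hx1 : 1 ≤ x := by rw [hx]; exact_mod_cast hX
  have hx0 : 0 < x := by linarith
  set F := h * x ^ γ with hF
  have hF0 : 0 < F := by positivity
  have hsF : 0 < √F := Real.sqrt_pos.mpr hF0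
  have hm1 : (1 : ℝ) ≤ m := by exact_mod_cast hm
  have hm0 : (0 : ℝ) < m := by linarith
  have hmY' : (m : ℝ) ≤ 3 * x := by rw [hx]; exact_mod_cast hmY.trans hY
  have hbm : (b : ℝ) * m ≤ 3 * x := by
    rw [hx]
    have := (Nat.le_div_iff_mul_le hm).mp hb
    exact_mod_cast this.trans hY
  set l := c₀ * F * (m / x) ^ 2 with hl
  have hl0 : 0 < l := by positivity
  have hsl : √l = s * √F * (m / x) := by
    rw [hl, Real.sqrt_mul (by positivity), Real.sqrt_sq (by positivity), Real.sqrt_mul hc₀0.le]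
  have hrange : ∀ t ∈ Set.Icc (((X / m : ℕ) : ℝ) + 1) (b + 1), x ≤ m * t ∧ m * t ≤ 6 * x := by
    intro t ht
    constructor
    · have : (X : ℝ) ≤ (m * (X / m + 1) : ℕ) := by exact_mod_cast (Nat.lt_mul_div_succ X hm).le
      push_cast at this
      calc x ≤ m * (((X / m : ℕ) : ℝ) + 1) := this
        _ ≤ m * t := by gcongr; exact ht.1
    · calc m * t ≤ m * ((b : ℝ) + 1) := by gcongr; exact ht.2
        _ = b * m + m := by ring
        _ ≤ 6 * x := by linarith
  have hβ1 := neg_abs_le β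
  have hβ2 := le_abs_self β
  have hv : ∀ t ∈ Set.Icc (((X / m : ℕ) : ℝ) + 1) (b + 1),
      x / 2 ≤ m * t - β ∧ m * t - β ≤ 7 * x := by
    intro t ht
    have := hrange t ht
    constructor <;> linarith
  have hpos : ∀ t ∈ Set.Icc (((X / m : ℕ) : ℝ) + 1) (b + 1), 0 < m * t - β := by
    intro t ht
    have := hv t ht
    linarith
  have key := van_der_corput_deriv (fun t => phase (κ * h) β γ θ (m * t)) _ _ (C := 196) hl0
    (by norm_num) (fun t ht => hasDerivAt_phase (κ * h) β γ θ (hpos t ht))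
    (fun t ht => hasDerivAt_phase' (κ * h) β γ θ (hpos t ht)) (by
      intro t ht
      obtain ⟨e1, e2⟩ := rpow_neg_bounds (γ - 2) 2 hx0 (hv t ht).1 (hv t ht).2 (by linarith)
        (by push_cast; linarith)
      have e3 : x ^ (γ - 2) = x ^ γ / x ^ 2 := by
        rw [Real.rpow_sub hx0, Real.rpow_two]
      have e4 : l = κ * h * γ * (1 - γ) * (m ^ 2 * (x ^ (γ - 2) / 7 ^ 2)) := by
        rw [hl, hc₀, hF, e3]
        ring
      have e5 : 0 ≤ κ * h * γ * (1 - γ) := by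
        have : 0 ≤ 1 - γ := by linarith
        positivity
      constructor
      · rw [e4]
        gcongr
      · calc _ ≤ κ * h * γ * (1 - γ) * (m ^ 2 * (2 ^ 2 * x ^ (γ - 2))) := by gcongr
          _ = _ := by
            rw [e4]
            ring)
  simp only [Nat.cast_mul]
  refine key.trans ?_
  rw [hsl]
  have k1 : (b : ℝ) * (s * √F * (m / x)) ≤ 3 * s * √F := by
    calc (b : ℝ) * (s * √F * (m / x)) = s * √F * (b * m) / x := by ring
      _ ≤ s * √F * (3 * x) / x := by gcongr
      _ = _ := by field_simp
  have k2 : (s * √F * (m / x))⁻¹ ≤ s⁻¹ * (x * (√F)⁻¹) := by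
    have : (s * √F * (m / x))⁻¹ = s⁻¹ * (x * (√F)⁻¹) * (m : ℝ)⁻¹ := by
      field_simp
    rw [this]
    exact mul_le_of_le_one_right (by positivity) (inv_le_one_of_one_le₀ hm1)
  have k3 : 0 ≤ √F := hsF.le
  have k4 : 0 ≤ x * (√F)⁻¹ := by positivity
  have k5 : 0 ≤ s⁻¹ := by positivity
  nlinarith [mul_nonneg k5 k3, mul_nonneg hs0.le k4, mul_nonneg k5 k4]

/-- The correlation estimate for the phase. -/
theorem typeII_phase {κ β γ : ℝ} (hκ : 0 < κ) (hγ0 : 0 < γ) (hγ1 : γ < 1) :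
    ∃ A : ℝ, 1 ≤ A ∧ ∀ (X Y : ℕ) (h θ : ℝ), 1 ≤ X → 4 * |β| ≤ γ * X → Y ≤ 3 * X → 0 < h →
      ∀ K n₁ n₂ : ℕ, 1 ≤ K → n₁ ∈ Ioc K (2 * K) → n₂ ∈ Ioc K (2 * K) → n₂ < n₁ →
      ‖∑ m ∈ Ioc (max (X / n₁) (X / n₂)) (min (Y / n₁) (Y / n₂)),
        ex (phase (κ * h) β γ θ ((n₁ * m : ℕ) : ℝ)) *
          (starRingEnd ℂ) (ex (phase (κ * h) β γ θ ((n₂ * m : ℕ) : ℝ)))‖ ≤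
        A * (√(h * (X : ℝ) ^ γ * (n₁ - n₂) / K) +
          X / K * (√(h * (X : ℝ) ^ γ * (n₁ - n₂) / K))⁻¹) := by
  -- Here 686 = 2 · 7³ comes from the lower bound for the second derivative, and 112 = 2 · 2³ · 7 in
  -- C from the upper one.
  set c₀ := κ * γ * (1 - γ) * (γ / 686) with hc₀
  have hγ' : 0 < 1 - γ := by linarith
  have hc₀0 : 0 < c₀ := by positivity
  set s := √c₀ with hs
  have hs0 : 0 < s := Real.sqrt_pos.mpr hc₀0
  set C := 112 * (686 / γ) with hC
  have hC1 : 1 ≤ C := by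
    rw [hC]
    have : 1 ≤ 686 / γ := by
      rw [le_div_iff₀ hγ0]
      linarith
    linarith
  refine ⟨1 + 8 * C * (3 * s + s⁻¹), by
    have : 0 ≤ 8 * C * (3 * s + s⁻¹) := by positivity
    linarith, ?_⟩
  intro X Y h θ hX hβ hY hh K n₁ n₂ hK hn₁ hn₂ hlt
  rw [mem_Ioc] at hn₁ hn₂
  set x : ℝ := (X : ℝ) with hx
  have hx1 : 1 ≤ x := by rw [hx]; exact_mod_cast hX
  have hx0 : 0 < x := by linarith
  have hK1 : (1 : ℝ) ≤ K := by exact_mod_cast hK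
  have hK0 : (0 : ℝ) < K := by linarith
  have hd : (0 : ℝ) < (n₁ : ℝ) - n₂ := by
    have : (n₂ : ℝ) < n₁ := by exact_mod_cast hlt
    linarith
  set F := h * x ^ γ * (n₁ - n₂) / K with hF
  have hF0 : 0 < F := by positivity
  have hsF : 0 < √F := Real.sqrt_pos.mpr hF0
  set a := max (X / n₁) (X / n₂) with ha
  set b := min (Y / n₁) (Y / n₂) with hb
  have hn₁0 : (0 : ℝ) < n₁ := by exact_mod_cast (by omega : 0 < n₁)
  have hn₂0 : (0 : ℝ) < n₂ := by exact_mod_cast (by omega : 0 < n₂)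
  have hn₁K : (K : ℝ) ≤ n₁ := by exact_mod_cast hn₁.1.le
  have hn₂K : (K : ℝ) ≤ n₂ := by exact_mod_cast hn₂.1.le
  have hn₁K2 : (n₁ : ℝ) ≤ 2 * K := by exact_mod_cast hn₁.2
  have hbn : (b : ℝ) * n₁ ≤ 3 * x := by
    rw [hx]
    have := (Nat.le_div_iff_mul_le (by omega)).mp (min_le_left (Y / n₁) (Y / n₂))
    exact_mod_cast this.trans hY
  have hbK : (b : ℝ) * K ≤ 3 * x := by
    refine le_trans ?_ hbn
    gcongr
  rcases Nat.eq_zero_or_pos b with hb0 | hb0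
  · rw [hb0, Ioc_eq_empty_of_le (Nat.zero_le _)]
    simp only [sum_empty, norm_zero]
    positivity
  have hb1 : (1 : ℝ) ≤ b := by exact_mod_cast hb0
  have hn₁x : (n₁ : ℝ) ≤ 3 * x := by nlinarith
  set l := c₀ * F * (K / x) ^ 2 with hl
  have hl0 : 0 < l := by positivity
  have hsl : √l = s * √F * (K / x) := by
    rw [hl, Real.sqrt_mul (by positivity), Real.sqrt_sq (by positivity), Real.sqrt_mul hc₀0.le]
  have hrange : ∀ t ∈ Set.Icc ((a : ℝ) + 1) (b + 1), ∀ y : ℝ, n₂ ≤ y → y ≤ n₁ →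
      x ≤ y * t ∧ y * t ≤ 6 * x := by
    intro t ht y hy1 hy2
    have ht0 : 0 ≤ t := by
      have := ht.1
      have : (0 : ℝ) ≤ a := Nat.cast_nonneg a
      linarith
    constructor
    · have h1 : (X : ℝ) ≤ (n₂ * (X / n₂ + 1) : ℕ) := by
        exact_mod_cast (Nat.lt_mul_div_succ X (by omega)).le
      push_cast at h1
      have h2 : ((X / n₂ : ℕ) : ℝ) ≤ a := by exact_mod_cast le_max_right (X / n₁) (X / n₂)
      calc x ≤ n₂ * (((X / n₂ : ℕ) : ℝ) + 1) := h1
        _ ≤ n₂ * t := by gcongr; linarith [ht.1]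
        _ ≤ y * t := by gcongr
    · calc y * t ≤ n₁ * t := by gcongr
        _ ≤ n₁ * ((b : ℝ) + 1) := by gcongr; exact ht.2
        _ = b * n₁ + n₁ := by ring
        _ ≤ 6 * x := by linarith
  have hβ1 := neg_abs_le β
  have hβ2 := le_abs_self β
  have hγx : γ * x ≤ x := by nlinarith
  have hv : ∀ t ∈ Set.Icc ((a : ℝ) + 1) (b + 1), ∀ y : ℝ, n₂ ≤ y → y ≤ n₁ →
      x / 2 ≤ y * t - β ∧ y * t - β ≤ 7 * x := by
    intro t ht y hy1 hy2
    have := hrange t ht y hy1 hy2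
    have := abs_nonneg β
    constructor <;> linarith
  have hpos : ∀ t ∈ Set.Icc ((a : ℝ) + 1) (b + 1), ∀ y : ℝ, n₂ ≤ y → y ≤ n₁ →
      0 < y * t - β := by
    intro t ht y hy1 hy2
    have := hv t ht y hy1 hy2
    linarith
  have hle : (n₂ : ℝ) ≤ n₁ := by linarith
  have key := van_der_corput_deriv
    (fun t => phase (κ * h) β γ θ (n₁ * t) - phase (κ * h) β γ θ (n₂ * t)) _ _ (a := a) (b := b)
    hl0 hC1
    (fun t ht => (hasDerivAt_phase (κ * h) β γ θ (hpos t ht n₁ hle le_rfl)).sub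
      (hasDerivAt_phase (κ * h) β γ θ (hpos t ht n₂ le_rfl hle)))
    (fun t ht => (hasDerivAt_phase' (κ * h) β γ θ (hpos t ht n₁ hle le_rfl)).sub
      (hasDerivAt_phase' (κ * h) β γ θ (hpos t ht n₂ le_rfl hle))) (by
      intro t ht
      -- The second derivative of the phase difference is a multiple of the increment of y ↦ y²(yt -
      -- β)^(γ-2) from n₂ to n₁. By the mean value theorem that increment is n₁ - n₂ times the
      -- derivative given here, and 4|β| ≤ γX keeps γyt - 2β ≥ γx/2.
      have hder : ∀ y ∈ Set.Icc (n₂ : ℝ) n₁, HasDerivAt (fun y => y ^ 2 * (y * t - β) ^ (γ - 2))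
          (y * (y * t - β) ^ (γ - 3) * (γ * (y * t) - 2 * β)) y := by
        intro y hy
        have hp := hpos t ht y hy.1 hy.2
        have d1 : HasDerivAt (fun y => (t * y - β) ^ (γ - 2))
            ((γ - 2) * t * (t * y - β) ^ (γ - 2 - 1)) y :=
          hasDerivAt_rpow_comp (γ - 2) (by rwa [mul_comm])
        have d2 := (hasDerivAt_pow 2 y).mul d1
        convert! d2 using 1
        · ext z
          simp [mul_comm]
        · have e1 : γ - 2 - 1 = γ - 3 := by ring
          have e2 : (y * t - β) ^ (γ - 2) = (y * t - β) ^ (γ - 3) * (y * t - β) := by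
            rw [← Real.rpow_add_one hp.ne']
            congr 1
            ring
          rw [e1, mul_comm t y, e2]
          push_cast
          ring
      obtain ⟨y, hy, hy'⟩ := exists_hasDerivAt_eq_slope
        (fun y => y ^ 2 * (y * t - β) ^ (γ - 2))
        (fun y => y * (y * t - β) ^ (γ - 3) * (γ * (y * t) - 2 * β)) (by linarith : (n₂ : ℝ) < n₁)
        (fun y hy => (hder y hy).continuousAt.continuousWithinAt)
        (fun y hy => hder y (Set.Ioo_subset_Icc_self hy))
      rw [eq_div_iff hd.ne'] at hy'
      rw [← mul_sub, ← hy']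
      have hr := hrange t ht y hy.1.le hy.2.le
      obtain ⟨e1, e2⟩ := rpow_neg_bounds (γ - 3) 3 hx0 (hv t ht y hy.1.le hy.2.le).1
        (hv t ht y hy.1.le hy.2.le).2 (by linarith) (by push_cast; linarith)
      have e3 : x ^ (γ - 3) * x = x ^ γ / x ^ 2 := by
        rw [← Real.rpow_add_one hx0.ne', ← Real.rpow_two, ← Real.rpow_sub hx0]
        congr 1
        ring
      have e4 : l = κ * h * γ * (1 - γ) *
          (K * (x ^ (γ - 3) / 7 ^ 3) * (γ / 2 * x) * (n₁ - n₂)) := by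
        have : (K : ℝ) * (x ^ (γ - 3) / 7 ^ 3) * (γ / 2 * x) * (n₁ - n₂) =
            K * (γ / 686) * (n₁ - n₂) * (x ^ (γ - 3) * x) := by ring
        rw [this, e3, hl, hc₀, hF]
        field_simp
      have e5 : 0 ≤ κ * h * γ * (1 - γ) := by positivity
      have e6 : γ / 2 * x ≤ γ * (y * t) - 2 * β := by
        have : γ * x ≤ γ * (y * t) := by gcongr; exact hr.1
        linarith
      have e7 : γ * (y * t) - 2 * β ≤ 7 * x := by
        have : γ * (y * t) ≤ 1 * (6 * x) :=
          mul_le_mul hγ1.le hr.2 (by linarith [hr.1]) (by norm_num)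
        linarith
      have e8 : 0 ≤ γ / 2 * x := by positivity
      have hyK : (K : ℝ) ≤ y := hn₂K.trans hy.1.le
      have hyK2 : y ≤ 2 * K := hy.2.le.trans hn₁K2
      have hy0 : 0 < y := by linarith
      have hpw : 0 ≤ (y * t - β) ^ (γ - 3) :=
        Real.rpow_nonneg (hpos t ht y hy.1.le hy.2.le).le _
      constructor
      · rw [e4]
        gcongr
      · calc _ ≤ κ * h * γ * (1 - γ) *
              ((2 * K) * (2 ^ 3 * x ^ (γ - 3)) * (7 * x) * (n₁ - n₂)) := by
              gcongr
              linarith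
          _ = _ := by
            rw [e4, hC]
            field_simp
            ring)
  have hsum : ∑ m ∈ Ioc a b, ex (phase (κ * h) β γ θ ((n₁ * m : ℕ) : ℝ)) *
      (starRingEnd ℂ) (ex (phase (κ * h) β γ θ ((n₂ * m : ℕ) : ℝ))) =
      ∑ m ∈ Ioc a b, ex (phase (κ * h) β γ θ (n₁ * m) - phase (κ * h) β γ θ (n₂ * m)) := by
    refine sum_congr rfl fun m _ => ?_
    rw [← ex_neg, ← ex_add, sub_eq_add_neg]
    push_cast
    rfl
  rw [hsum]
  refine key.trans ?_
  rw [hsl]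
  have k1 : (b : ℝ) * (s * √F * (K / x)) ≤ 3 * s * √F := by
    calc (b : ℝ) * (s * √F * (K / x)) = s * √F * (b * K) / x := by ring
      _ ≤ s * √F * (3 * x) / x := by gcongr
      _ = _ := by field_simp
  have k2 : (s * √F * (K / x))⁻¹ = s⁻¹ * (x / K * (√F)⁻¹) := by
    field_simp
  rw [k2]
  have k4 : 0 ≤ x / K * (√F)⁻¹ := by positivity
  calc 8 * C * ((b : ℝ) * (s * √F * (K / x)) + s⁻¹ * (x / K * (√F)⁻¹)) ≤
        8 * C * (3 * s * √F + s⁻¹ * (x / K * (√F)⁻¹)) := by gcongr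
    _ ≤ 8 * C * (3 * s * √F + s⁻¹ * (x / K * (√F)⁻¹)) + (√F + x / K * (√F)⁻¹)
        + 8 * C * (s⁻¹ * √F + 3 * s * (x / K * (√F)⁻¹)) := by
        have : 0 ≤ 8 * C * (s⁻¹ * √F + 3 * s * (x / K * (√F)⁻¹)) := by positivity
        linarith
    _ = _ := by ring

end

/-! ### Exponential sums over primes. -/

section

open Finset ArithmeticFunction

/-- Passing from von Mangoldt weights to primes. -/
lemma norm_sum_primes_le (g : ℕ → ℂ) {X Y : ℕ} {B D : ℝ} (hX : 1 ≤ X) (hXY : X ≤ Y)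
    (hY : Y ≤ 3 * X) (hg : ∀ n, ‖g n‖ ≤ 1) (hD : Real.log Y ≤ D) (hB : 0 ≤ B)
    (h : ∀ k, X ≤ k → k ≤ Y → ‖∑ n ∈ Ioc X k, (Λ n : ℂ) * g n‖ ≤ B) :
    ‖∑ p ∈ Ioc X Y with p.Prime, g p‖ ≤ 2 * (B + 4 * √X * D) := by
  have hlogY : 0 ≤ Real.log Y := Real.log_natCast_nonneg Y
  have hD0 : 0 ≤ D := hlogY.trans hD
  rcases hXY.eq_or_lt with rfl | hlt
  · simp
    positivity
  -- Replacing Λ by log on primes costs at most ψ - θ = O(√X log Y). Abel summation then removes the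
  -- logarithm with weight 1/log n, and 1/log 2 < 2 gives the leading constant.
  set c : ℕ → ℂ := fun n => if n.Prime then (Real.log n : ℂ) * g n else 0 with hc
  have hpart : ∀ k, X ≤ k → k ≤ Y → ‖∑ n ∈ Ioc X k, c n‖ ≤ B + 4 * √X * D := by
    intro k hk1 hk2
    have e1 : ∑ n ∈ Ioc X k, c n = ∑ n ∈ Ioc X k, (Λ n : ℂ) * g n -
        ∑ n ∈ Ioc X k with ¬ n.Prime, (Λ n : ℂ) * g n := by
      rw [sum_filter, ← sum_sub_distrib]
      refine sum_congr rfl fun n _ => ?_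
      by_cases hn : n.Prime
      · simp only [hc, if_pos hn, not_true_eq_false, if_false, sub_zero, hn,
          vonMangoldt_apply_prime hn]
      · simp [hc, hn]
    have e2 : ‖∑ n ∈ Ioc X k with ¬ n.Prime, (Λ n : ℂ) * g n‖ ≤ 4 * √X * D := by
      have f1 : ‖∑ n ∈ Ioc X k with ¬ n.Prime, (Λ n : ℂ) * g n‖ ≤
          ∑ n ∈ Ioc 0 k with ¬ n.Prime, Λ n := by
        refine (norm_sum_le _ _).trans ?_
        calc _ ≤ ∑ n ∈ Ioc X k with ¬ n.Prime, Λ n := by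
              refine sum_le_sum fun n _ => ?_
              rw [norm_mul, Complex.norm_real, Real.norm_of_nonneg vonMangoldt_nonneg]
              exact mul_le_of_le_one_right vonMangoldt_nonneg (hg n)
          _ ≤ _ := sum_le_sum_of_subset_of_nonneg
              (filter_subset_filter _ (Ioc_subset_Ioc_left (Nat.zero_le _)))
              fun _ _ _ => vonMangoldt_nonneg
      have f2 := Chebyshev.psi_sub_theta_eq_sum_not_prime (k : ℝ)
      rw [Nat.floor_natCast] at f2
      have hk0 : (1 : ℝ) ≤ k := by exact_mod_cast hX.trans hk1
      have f3 := Chebyshev.psi_sub_theta_le hk0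
      have f4 : Real.log k ≤ D := (Real.log_le_log (by linarith) (by exact_mod_cast hk2)).trans hD
      have f5 : √(k : ℝ) ≤ 2 * √X := by
        have : (2 : ℝ) * √X = √(4 * X) := by
          rw [Real.sqrt_mul (by norm_num)]
          congr 1
          rw [show (4 : ℝ) = 2 ^ 2 by norm_num, Real.sqrt_sq (by norm_num)]
        rw [this]
        apply Real.sqrt_le_sqrt
        have : k ≤ 4 * X := by omega
        exact_mod_cast this
      have f6 : 0 ≤ Real.log k := Real.log_natCast_nonneg k
      calc _ ≤ _ := f1
        _ = _ := f2.symm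
        _ ≤ _ := f3
        _ ≤ 2 * (2 * √X) * D := by gcongr
        _ = _ := by ring
    rw [e1]
    exact (norm_sub_le _ _).trans (add_le_add (h k hk1 hk2) e2)
  have e3 : ∑ p ∈ Ioc X Y with p.Prime, g p =
      ∑ n ∈ Ioc X Y, (((Real.log n)⁻¹ : ℝ) : ℂ) * c n := by
    rw [sum_filter]
    refine sum_congr rfl fun n hn => ?_
    by_cases hp : n.Prime
    · have : Real.log n ≠ 0 := (Real.log_pos (by exact_mod_cast hp.one_lt)).ne'
      simp only [hc, if_pos hp]
      rw [← mul_assoc, ← Complex.ofReal_mul, inv_mul_cancel₀ this]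
      simp
    · simp [hc, hp]
  rw [e3]
  have hlogpos : ∀ n : ℕ, X < n → 0 < Real.log n := fun n hn =>
    Real.log_pos (by exact_mod_cast (by omega : 1 < n))
  refine (norm_sum_antitone_mul_le (fun n => (Real.log n)⁻¹) c (fun n h1 _ => ?_)
    (fun n h1 _ => (inv_pos.mpr (hlogpos n h1)).le) hpart hlt).trans ?_
  · apply inv_anti₀ (hlogpos n h1)
    have : (0 : ℝ) < n := by exact_mod_cast (by omega : 0 < n)
    exact Real.log_le_log this (by push_cast; linarith)
  · gcongr
    have h1 : Real.log 2 ≤ Real.log ((X + 1 : ℕ) : ℝ) :=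
      Real.log_le_log (by norm_num) (by exact_mod_cast (by omega : 2 ≤ X + 1))
    have h2 := Real.log_two_gt_d9
    rw [inv_le_comm₀ (by linarith) (by norm_num)]
    linarith

/-- A common bound for the logarithms and the divisor function up to `3X`. -/
lemma exists_log_divisor_bound {s : ℝ} (hs : 0 < s) :
    ∃ C : ℝ, 1 ≤ C ∧ ∀ X Y : ℕ, 1 ≤ X → Y ≤ 3 * X →
    1 ≤ C * (X : ℝ) ^ s ∧ Nat.log 2 Y + 1 ≤ C * (X : ℝ) ^ s ∧ Real.log Y ≤ C * (X : ℝ) ^ s ∧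
      ∀ n, n ≤ Y → (#n.divisors : ℝ) ≤ C * (X : ℝ) ^ s := by
  obtain ⟨C₁, hC₁, hd⟩ := card_divisors_le_rpow hs
  refine ⟨(C₁ + 2 / s + 1) * 3 ^ s, ?_, ?_⟩
  · have h1 : (1 : ℝ) ≤ 3 ^ s := Real.one_le_rpow (by norm_num) hs.le
    have h2 : 0 ≤ 2 / s := by positivity
    nlinarith
  intro X Y hX hY
  have hx1 : (1 : ℝ) ≤ X := by exact_mod_cast hX
  have hY3 : (Y : ℝ) ≤ 3 * X := by exact_mod_cast hY
  set T := (3 * (X : ℝ)) ^ s with hT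
  have hT1 : 1 ≤ T := Real.one_le_rpow (by linarith) hs.le
  have hTe : (C₁ + 2 / s + 1) * 3 ^ s * (X : ℝ) ^ s = (C₁ + 2 / s + 1) * T := by
    rw [hT, Real.mul_rpow (by norm_num) (by linarith)]
    ring
  rw [hTe]
  have hs2 : 0 ≤ 2 / s := by positivity
  have hlog : Real.log Y ≤ T / s := by
    refine (Real.log_le_rpow_div (Nat.cast_nonneg Y) hs).trans ?_
    rw [hT]
    gcongr
  have hexp : (C₁ + 2 / s + 1) * T = C₁ * T + 2 * (T / s) + T := by ring
  have hTs : 0 ≤ T / s := by positivity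
  have hC₁T : T ≤ C₁ * T := le_mul_of_one_le_left (by linarith) hC₁
  rw [hexp]
  refine ⟨by linarith, ?_, by linarith, ?_⟩
  · have h1 : (Nat.log 2 Y : ℝ) ≤ 2 * Real.log Y := by
      have h2 := Real.natLog_le_logb Y 2
      rw [Real.logb] at h2
      have h3 := Real.log_two_gt_d9
      refine h2.trans ?_
      push_cast
      rw [div_le_iff₀ (by linarith)]
      nlinarith [Real.log_natCast_nonneg Y]
    linarith
  · intro n hn
    rcases Nat.eq_zero_or_pos n with rfl | h0
    · simp
      positivity
    · have h1 : (n : ℝ) ≤ 3 * X := le_trans (by exact_mod_cast hn) hY3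
      have h2 : C₁ * (n : ℝ) ^ s ≤ C₁ * T := by
        rw [hT]
        gcongr
      have := hd n h0
      linarith

/-- The exponential sum over primes with phase `-κ h (p - β) ^ γ + θ p`, uniformly in `θ`. -/
theorem norm_sum_primes_phase_le {κ β γ η : ℝ} (hκ : 0 < κ) (hγ : 11 / 12 < γ) (hγ1 : γ < 1)
    (hη : 0 < η) : ∃ C : ℝ, 0 < C ∧ ∀ (X Y : ℕ) (h θ : ℝ), 1 ≤ X → 4 * |β| ≤ γ * X → X ≤ Y →
      Y ≤ 3 * X → 1 ≤ h →
      ‖∑ p ∈ Ioc X Y with p.Prime, ex (phase (κ * h) β γ θ p)‖ ≤ C * (X : ℝ) ^ η *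
        ((X : ℝ) ^ (11 / 12 : ℝ) + (X : ℝ) ^ (2 / 3 : ℝ) * (h * (X : ℝ) ^ γ) ^ (1 / 4 : ℝ) +
          (X : ℝ) ^ (1 / 3 : ℝ) * (h * (X : ℝ) ^ γ) ^ (1 / 2 : ℝ)) := by
  obtain ⟨A₁, hA₁, hI⟩ := typeI_phase (β := β) hκ (by linarith) hγ1
  obtain ⟨A₂, hA₂, hII⟩ := typeII_phase (β := β) hκ (by linarith) hγ1
  -- The exponent is η/3 because this bound enters cubed. In the constant below, 108 = 2(50 + 4).
  obtain ⟨C₀, hC₀, hD⟩ := exists_log_divisor_bound (s := η / 3) (by linarith)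
  set A := max A₁ A₂ with hA
  have hA1 : 1 ≤ A := hA₁.trans (le_max_left _ _)
  refine ⟨108 * A * C₀ ^ 3, by positivity, ?_⟩
  intro X Y h θ hX hβ hXY hY hh
  have hx1 : (1 : ℝ) ≤ X := by exact_mod_cast hX
  have hβ' : 2 * |β| ≤ X := by nlinarith [abs_nonneg β]
  set F := h * (X : ℝ) ^ γ with hF
  have hFx : (X : ℝ) ^ (11 / 12 : ℝ) ≤ F := by
    have h1 : (X : ℝ) ^ (11 / 12 : ℝ) ≤ (X : ℝ) ^ γ :=
      Real.rpow_le_rpow_of_exponent_le hx1 hγ.le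
    have h2 : (X : ℝ) ^ γ ≤ F := le_mul_of_one_le_left (by positivity) hh
    exact h1.trans h2
  have hF0 : 0 < F := by positivity
  set P := (X : ℝ) ^ (11 / 12 : ℝ) + (X : ℝ) ^ (2 / 3 : ℝ) * F ^ (1 / 4 : ℝ) +
    (X : ℝ) ^ (1 / 3 : ℝ) * F ^ (1 / 2 : ℝ) with hP
  set D := C₀ * (X : ℝ) ^ (η / 3) with hDdef
  obtain ⟨hD1, _, hDY, _⟩ := hD X Y hX hY
  have hg : ∀ n : ℕ, ‖ex (phase (κ * h) β γ θ (n : ℝ))‖ ≤ 1 := fun n => (norm_ex _).le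
  have main : ∀ k, X ≤ k → k ≤ Y →
      ‖∑ n ∈ Ioc X k, (Λ n : ℂ) * ex (phase (κ * h) β γ θ (n : ℝ))‖ ≤ 50 * A * D ^ 3 * P := by
    intro k hk1 hk2
    obtain ⟨_, hl2, hl, hd⟩ := hD X k hX (hk2.trans hY)
    refine norm_sum_vonMangoldt_mul_le (fun n => ex (phase (κ * h) β γ θ (n : ℝ))) hX
      (hk2.trans hY) hg hA1 hFx hD1 hl2 hl hd ?_ ?_
    · intro m b hm hmk _ hb
      refine (hI X k h θ hX hβ' (hk2.trans hY) (by linarith) m b hm hmk hb).trans ?_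
      gcongr
      exact le_max_left _ _
    · intro K n₁ n₂ hK h₁ h₂ hlt
      refine (hII X k h θ hX hβ (hk2.trans hY) (by linarith) K n₁ n₂ hK h₁ h₂ hlt).trans ?_
      gcongr
      exact le_max_right _ _
  refine (norm_sum_primes_le _ hX hXY hY hg hDY (by positivity) main).trans ?_
  have hD3 : D ^ 3 = C₀ ^ 3 * (X : ℝ) ^ η := by
    rw [hDdef, mul_pow, ← Real.rpow_natCast ((X : ℝ) ^ (η / 3)), ← Real.rpow_mul (by positivity)]
    congr 2
    push_cast
    ring
  have hDD : D ≤ D ^ 3 := le_self_pow₀ hD1 (by norm_num)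
  have hsq : √(X : ℝ) ≤ P := by
    have h1 : √(X : ℝ) ≤ (X : ℝ) ^ (11 / 12 : ℝ) := by
      rw [Real.sqrt_eq_rpow]
      exact Real.rpow_le_rpow_of_exponent_le hx1 (by norm_num)
    have h2 : 0 ≤ (X : ℝ) ^ (2 / 3 : ℝ) * F ^ (1 / 4 : ℝ) := by positivity
    have h3 : 0 ≤ (X : ℝ) ^ (1 / 3 : ℝ) * F ^ (1 / 2 : ℝ) := by positivity
    linarith
  calc 2 * (50 * A * D ^ 3 * P + 4 * √(X : ℝ) * D) ≤
        2 * (50 * A * D ^ 3 * P + 4 * P * D ^ 3) := by gcongr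
    _ ≤ 2 * (50 * A * D ^ 3 * P + 4 * A * P * D ^ 3) := by
        gcongr
        linarith
    _ = 108 * A * C₀ ^ 3 * (X : ℝ) ^ η * P := by
        rw [hD3]
        ring

end

/-! ### The sawtooth function, and detection of progressions by characters. -/

section

open Finset

/-- The sawtooth function. -/
noncomputable def saw (t : ℝ) : ℝ := Int.fract t - 1 / 2

/-- The periodized second Bernoulli polynomial. -/
noncomputable def bern (t : ℝ) : ℝ := Int.fract t ^ 2 - Int.fract t + 1 / 6

lemma abs_saw_le (t : ℝ) : |saw t| ≤ 1 := by
  have h1 := Int.fract_nonneg t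
  have h2 := Int.fract_lt_one t
  rw [saw, abs_le]
  constructor <;> linarith

/-- `bern` has derivative 2 `saw` away from the integers, and its Fourier coefficients decay like
n^(-2), so its series converges absolutely, unlike that of `saw`. -/
lemma hasSum_bern (t : ℝ) :
    HasSum (fun n : ℕ => 1 / (n : ℝ) ^ 2 * Real.cos (2 * Real.pi * n * t))
      (Real.pi ^ 2 * bern t) := by
  have h := hasSum_one_div_nat_pow_mul_cos (k := 1) one_ne_zero
    (x := Int.fract t) ⟨Int.fract_nonneg t, (Int.fract_lt_one t).le⟩
  convert! h using 1
  · ext n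
    rw [mul_one]
    congr 1
    have : 2 * Real.pi * n * Int.fract t =
        2 * Real.pi * n * t - ((n * ⌊t⌋ : ℤ) : ℝ) * (2 * Real.pi) := by
      rw [Int.fract]
      push_cast
      ring
    rw [this, Real.cos_sub_int_mul_two_pi]
  · have h2 := bernoulliFun_two (Int.fract t)
    rw [bernoulliFun] at h2
    rw [mul_one, h2, bern]
    have h3 : (((2 * 1).factorial : ℕ) : ℝ) = 2 := by norm_num [Nat.factorial]
    rw [h3]
    ring

/-- The quotient is the mean of `saw` over [t, t + δ]. Since `saw` rises with slope 1 and jumps only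
downwards, this mean exceeds `saw t` by at most δ. -/
lemma saw_lower {t δ : ℝ} (h0 : 0 < δ) (h1 : δ < 1) :
    (bern (t + δ) - bern t) / (2 * δ) - δ ≤ saw t := by
  have hu0 := Int.fract_nonneg t
  have hu1 := Int.fract_lt_one t
  have ht : t = ⌊t⌋ + Int.fract t := (Int.floor_add_fract t).symm
  rw [sub_le_iff_le_add, div_le_iff₀ (by positivity)]
  by_cases h : Int.fract t + δ < 1
  · have : Int.fract (t + δ) = Int.fract t + δ := by
      rw [Int.fract_eq_iff]
      exact ⟨by linarith, h, ⌊t⌋, by linarith⟩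
    rw [bern, bern, saw, this]
    nlinarith
  · have : Int.fract (t + δ) = Int.fract t + δ - 1 := by
      rw [Int.fract_eq_iff]
      exact ⟨by linarith, by linarith, ⌊t⌋ + 1, by push_cast; linarith⟩
    rw [bern, bern, saw, this]
    nlinarith

/-- The mirror image: the quotient is the mean of `saw` over [t - δ, t]. -/
lemma saw_upper {t δ : ℝ} (h0 : 0 < δ) (h1 : δ < 1) :
    saw t ≤ -(bern (t + -δ) - bern t) / (2 * δ) + δ := by
  have hu0 := Int.fract_nonneg t
  have hu1 := Int.fract_lt_one t
  have ht : t = ⌊t⌋ + Int.fract t := (Int.floor_add_fract t).symm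
  rw [← sub_le_iff_le_add, le_div_iff₀ (by positivity)]
  by_cases h : 0 ≤ Int.fract t - δ
  · have : Int.fract (t + -δ) = Int.fract t - δ := by
      rw [Int.fract_eq_iff]
      exact ⟨h, by linarith, ⌊t⌋, by linarith⟩
    rw [bern, bern, saw, this]
    nlinarith
  · have : Int.fract (t + -δ) = Int.fract t - δ + 1 := by
      rw [Int.fract_eq_iff]
      exact ⟨by linarith, by linarith, ⌊t⌋ - 1, by push_cast; linarith⟩
    rw [bern, bern, saw, this]
    nlinarith

/-- The bound |1 - e(z)| ≪ min(1, y) and the growth 1 + √y allowed to the exponential sums are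
merged into one power of y. With y = nδ and the Fourier weights n^(-2), this leaves the convergent
series Σ n^(-1-η). -/
lemma norm_one_sub_ex_mul_le {y η : ℝ} (hy : 0 < y) (hη0 : 0 < η) (hη : η ≤ 1 / 2) {z : ℝ}
    (hz : |z| = y) : ‖1 - ex z‖ * (1 + √y) ≤ 4 * Real.pi * y ^ (1 - η) := by
  rw [norm_one_sub_ex]
  have hpi := Real.pi_gt_three
  rcases le_total y 1 with h | h
  · have h1 : |Real.sin (Real.pi * z)| ≤ Real.pi * y := by
      refine (Real.abs_sin_le_abs).trans ?_
      rw [abs_mul, hz, abs_of_pos Real.pi_pos]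
    have h2 : √y ≤ 1 := Real.sqrt_le_one.mpr h
    have h3 : y ≤ y ^ (1 - η) := by
      conv_lhs => rw [← Real.rpow_one y]
      exact Real.rpow_le_rpow_of_exponent_ge hy h (by linarith)
    calc 2 * |Real.sin (Real.pi * z)| * (1 + √y) ≤ 2 * (Real.pi * y) * (1 + 1) := by gcongr
      _ = 4 * Real.pi * y := by ring
      _ ≤ _ := by gcongr
  · have h1 : |Real.sin (Real.pi * z)| ≤ 1 := Real.abs_sin_le_one _
    have h2 : √y ≤ y ^ (1 - η) := by
      rw [Real.sqrt_eq_rpow]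
      exact Real.rpow_le_rpow_of_exponent_le h (by linarith)
    have h3 : 1 ≤ y ^ (1 - η) := Real.one_le_rpow h (by linarith)
    calc 2 * |Real.sin (Real.pi * z)| * (1 + √y) ≤ 2 * 1 * (y ^ (1 - η) + y ^ (1 - η)) := by gcongr
      _ = 4 * 1 * y ^ (1 - η) := by ring
      _ ≤ 4 * Real.pi * y ^ (1 - η) := by
        gcongr
        linarith

/-- Differences of the periodized Bernoulli polynomial along a finite family, in terms of
exponential sums. -/
lemma abs_sum_bern_sub_le {ι : Type*} (s : Finset ι) (t : ι → ℝ) {δ z V η : ℝ} (hδ : 0 < δ)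
    (hz : |z| = δ) (hη0 : 0 < η) (hη : η ≤ 1 / 2)
    (hS : ∀ h : ℕ, 1 ≤ h → ‖∑ p ∈ s, ex (h * t p)‖ ≤ V * (1 + √(h * δ))) :
    |∑ p ∈ s, (bern (t p + z) - bern (t p))| ≤
      2 * δ * ((∑' n : ℕ, (n : ℝ) ^ (-(1 + η))) * V * δ ^ (-η)) := by
  have hV : 0 ≤ V := by
    have := (norm_nonneg _).trans (hS 1 le_rfl)
    have h2 : 0 < 1 + √(((1 : ℕ) : ℝ) * δ) := by positivity
    exact nonneg_of_mul_nonneg_left this h2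
  have hsum : HasSum (fun n : ℕ => ∑ p ∈ s,
      (1 / (n : ℝ) ^ 2 * Real.cos (2 * Real.pi * n * (t p + z))
      - 1 / (n : ℝ) ^ 2 * Real.cos (2 * Real.pi * n * t p)))
      (∑ p ∈ s, (Real.pi ^ 2 * bern (t p + z) - Real.pi ^ 2 * bern (t p))) :=
    hasSum_sum fun p _ => (hasSum_bern _).sub (hasSum_bern _)
  have hsm : Summable (fun n : ℕ => (n : ℝ) ^ (-(1 + η))) :=
    Real.summable_nat_rpow.mpr (by linarith)
  set c := 4 * Real.pi * V * δ ^ (1 - η) with hc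
  have hterm : ∀ n : ℕ, ‖∑ p ∈ s, (1 / (n : ℝ) ^ 2 * Real.cos (2 * Real.pi * n * (t p + z))
      - 1 / (n : ℝ) ^ 2 * Real.cos (2 * Real.pi * n * t p))‖ ≤ c * (n : ℝ) ^ (-(1 + η)) := by
    intro n
    rcases Nat.eq_zero_or_pos n with rfl | hn
    · simp
      positivity
    have hn0 : (0 : ℝ) < n := by exact_mod_cast hn
    have e1 : ∑ p ∈ s, (1 / (n : ℝ) ^ 2 * Real.cos (2 * Real.pi * n * (t p + z))
        - 1 / (n : ℝ) ^ 2 * Real.cos (2 * Real.pi * n * t p)) =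
        1 / (n : ℝ) ^ 2 * (-((1 - ex (n * z)) * ∑ p ∈ s, ex (n * t p))).re := by
      rw [mul_sum, ← sum_neg_distrib, Complex.re_sum, mul_sum]
      refine sum_congr rfl fun p _ => ?_
      have e2 : -((1 - ex (n * z)) * ex (n * t p)) = ex (n * (t p + z)) - ex (n * t p) := by
        rw [mul_add, ex_add]
        ring
      have e3 : ∀ u : ℝ, (ex (n * u)).re = Real.cos (2 * Real.pi * n * u) := by
        intro u
        rw [ex, Complex.exp_ofReal_mul_I_re]
        congr 1
        ring
      rw [e2, Complex.sub_re, e3, e3]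
      ring
    rw [e1, norm_mul, Real.norm_of_nonneg (by positivity)]
    have e4 : ‖(-((1 - ex (n * z)) * ∑ p ∈ s, ex (n * t p))).re‖ ≤
        4 * Real.pi * (n * δ) ^ (1 - η) * V := by
      refine (Complex.abs_re_le_norm _).trans ?_
      rw [norm_neg, norm_mul]
      have hnz : |(n : ℝ) * z| = n * δ := by rw [abs_mul, hz, abs_of_pos hn0]
      calc _ ≤ ‖1 - ex (n * z)‖ * (V * (1 + √(n * δ))) := by
            gcongr
            exact hS n hn
        _ = ‖1 - ex (n * z)‖ * (1 + √(n * δ)) * V := by ring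
        _ ≤ _ := by
            exact mul_le_mul_of_nonneg_right
              (norm_one_sub_ex_mul_le (by positivity) hη0 hη hnz) hV
    calc 1 / (n : ℝ) ^ 2 * ‖(-((1 - ex (n * z)) * ∑ p ∈ s, ex (n * t p))).re‖ ≤
          1 / (n : ℝ) ^ 2 * (4 * Real.pi * (n * δ) ^ (1 - η) * V) := by gcongr
      _ = c * (n : ℝ) ^ (-(1 + η)) := by
          have e5 : (n : ℝ) ^ (-(1 + η)) = (n : ℝ) ^ (1 - η) / (n : ℝ) ^ 2 := by
            rw [← Real.rpow_two, ← Real.rpow_sub hn0]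
            congr 1
            ring
          rw [e5, Real.mul_rpow hn0.le hδ.le, hc]
          ring
  have hb := tsum_of_norm_bounded (hsm.mul_left c).hasSum hterm
  rw [hsum.tsum_eq, tsum_mul_left, Real.norm_eq_abs] at hb
  have e6 : ∑ p ∈ s, (Real.pi ^ 2 * bern (t p + z) - Real.pi ^ 2 * bern (t p)) =
      Real.pi ^ 2 * ∑ p ∈ s, (bern (t p + z) - bern (t p)) := by
    rw [mul_sum]
    exact sum_congr rfl fun p _ => by ring
  rw [e6, abs_mul, abs_of_pos (by positivity)] at hb
  set Z := ∑' n : ℕ, (n : ℝ) ^ (-(1 + η)) with hZ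
  have hZ0 : 0 ≤ Z := tsum_nonneg fun n => by positivity
  have e7 : δ ^ (1 - η) = δ * δ ^ (-η) := by
    rw [sub_eq_add_neg, Real.rpow_add hδ, Real.rpow_one]
  have hpi := Real.pi_gt_three
  have e8 : Real.pi ^ 2 * |∑ p ∈ s, (bern (t p + z) - bern (t p))| ≤
      Real.pi ^ 2 * (2 * δ * (Z * V * δ ^ (-η))) := by
    refine hb.trans ?_
    rw [hc, e7]
    have e9 : 0 ≤ Z * V * δ * δ ^ (-η) := by positivity
    calc _ = 4 * Real.pi * (Z * V * δ * δ ^ (-η)) := by ring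
      _ ≤ 2 * Real.pi ^ 2 * (Z * V * δ * δ ^ (-η)) :=
          mul_le_mul_of_nonneg_right (by nlinarith) e9
      _ = _ := by ring
  exact le_of_mul_le_mul_left e8 (by positivity)

/-- A truncated Fourier expansion of the sawtooth function summed over a finite family. -/
theorem abs_sum_saw_le {ι : Type*} (s : Finset ι) (t : ι → ℝ) {δ V η : ℝ} (hδ : 0 < δ)
    (hδ1 : δ < 1) (hη0 : 0 < η) (hη : η ≤ 1 / 2)
    (hS : ∀ h : ℕ, 1 ≤ h → ‖∑ p ∈ s, ex (h * t p)‖ ≤ V * (1 + √(h * δ))) :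
    |∑ p ∈ s, saw (t p)| ≤ #s * δ + (∑' n : ℕ, (n : ℝ) ^ (-(1 + η))) * V * δ ^ (-η) := by
  set W := (∑' n : ℕ, (n : ℝ) ^ (-(1 + η))) * V * δ ^ (-η) with hW
  have h1 := abs_sum_bern_sub_le s t hδ (z := δ) (abs_of_pos hδ) hη0 hη hS
  have h2 := abs_sum_bern_sub_le s t hδ (z := -δ) (by rw [abs_neg, abs_of_pos hδ]) hη0 hη hS
  rw [← hW] at h1 h2
  have l1 : (∑ p ∈ s, (bern (t p + δ) - bern (t p))) / (2 * δ) - #s * δ ≤ ∑ p ∈ s, saw (t p) := by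
    rw [sum_div, ← nsmul_eq_mul, ← sum_const, ← sum_sub_distrib]
    exact sum_le_sum fun p _ => saw_lower hδ hδ1
  have l2 : ∑ p ∈ s, saw (t p) ≤
      -(∑ p ∈ s, (bern (t p + -δ) - bern (t p))) / (2 * δ) + #s * δ := by
    rw [← sum_neg_distrib, sum_div, ← nsmul_eq_mul (#s), ← sum_const, ← sum_add_distrib]
    exact sum_le_sum fun p _ => saw_upper hδ hδ1
  have h1' : -W ≤ (∑ p ∈ s, (bern (t p + δ) - bern (t p))) / (2 * δ) := by
    rw [le_div_iff₀ (by positivity)]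
    linarith [(abs_le.mp h1).1]
  have h2' : -(∑ p ∈ s, (bern (t p + -δ) - bern (t p))) / (2 * δ) ≤ W := by
    rw [div_le_iff₀ (by positivity)]
    linarith [(abs_le.mp h2).1]
  rw [abs_le]
  constructor <;> linarith

lemma sum_range_ex_div {q : ℕ} (hq : 1 ≤ q) (m : ℤ) :
    ∑ k ∈ range q, ex (k * (m / q : ℝ)) = if (q : ℤ) ∣ m then (q : ℂ) else 0 := by
  have hq0 : (q : ℝ) ≠ 0 := by exact_mod_cast (by omega : q ≠ 0)
  have hpow : ∀ k : ℕ, ex (k * (m / q : ℝ)) = ex (m / q : ℝ) ^ k := by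
    intro k
    rw [ex, ex, ← Complex.exp_nat_mul]
    congr 1
    push_cast
    ring
  simp only [hpow]
  split_ifs with h
  · obtain ⟨d, rfl⟩ := h
    have : ((((q : ℤ) * d : ℤ) : ℝ) / q) = (d : ℝ) := by
      push_cast
      field_simp
    rw [this, ex_intCast]
    simp
  · have hne : ex (m / q : ℝ) ≠ 1 := by
      intro he
      rw [ex, Complex.exp_eq_one_iff] at he
      obtain ⟨n, hn⟩ := he
      apply h
      have h2 : (2 * Real.pi * (m / q : ℝ)) = n * (2 * Real.pi) := by
        have h3 : ((2 * Real.pi * (m / q : ℝ) : ℝ) : ℂ) * Complex.I =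
            ((n * (2 * Real.pi) : ℝ) : ℂ) * Complex.I := by
          rw [hn]
          push_cast
          ring
        exact_mod_cast mul_right_cancel₀ Complex.I_ne_zero h3
      have h4 : (m / q : ℝ) = n := by
        have := Real.pi_pos
        have h5 : (2 * Real.pi) * (m / q : ℝ) = (2 * Real.pi) * n := by rw [h2]; ring
        exact mul_left_cancel₀ (by positivity) h5
      rw [div_eq_iff hq0] at h4
      refine ⟨n, ?_⟩
      have : (m : ℝ) = ((q * n : ℤ) : ℝ) := by
        rw [h4]
        push_cast
        ring
      exact_mod_cast this
    rw [geom_sum_eq hne, ← hpow]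
    have : (q : ℝ) * (m / q : ℝ) = m := by field_simp
    rw [this, ex_intCast]
    simp

/-- Detecting an arithmetic progression by additive characters. -/
lemma norm_sum_ap_le (s : Finset ℕ) (t : ℕ → ℝ) {q : ℕ} (hq : 1 ≤ q) (a : ℤ) {B : ℝ}
    (hB : ∀ θ : ℝ, ‖∑ p ∈ s, ex (t p + θ * p)‖ ≤ B) :
    ‖∑ p ∈ s with ((p : ℕ) : ℤ) ≡ a [ZMOD (q : ℤ)], ex (t p)‖ ≤ B := by
  have hq0 : (0 : ℝ) < q := by exact_mod_cast hq
  -- Each of the q frequencies k/q contributes at most B, and the factor q on the left cancels their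
  -- number, so nothing is lost in q.
  have e1 : (q : ℂ) * ∑ p ∈ s with ((p : ℕ) : ℤ) ≡ a [ZMOD (q : ℤ)], ex (t p) =
      ∑ k ∈ range q, ex (-(k * (a / q : ℝ))) * ∑ p ∈ s, ex (t p + (k / q : ℝ) * p) := by
    simp only [mul_sum]
    rw [sum_comm, sum_filter]
    refine sum_congr rfl fun p _ => ?_
    have e2 : ∀ k ∈ range q, ex (-(k * (a / q : ℝ))) * ex (t p + (k / q : ℝ) * p) =
        ex (t p) * ex (k * ((((p : ℤ) - a : ℤ) : ℝ) / q)) := by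
      intro k _
      rw [← ex_add, ← ex_add]
      congr 1
      push_cast
      ring
    rw [sum_congr rfl e2, ← mul_sum, sum_range_ex_div hq]
    have e3 : ((p : ℤ) ≡ a [ZMOD (q : ℤ)]) ↔ (q : ℤ) ∣ (p : ℤ) - a := by
      rw [Int.modEq_comm, Int.modEq_iff_dvd]
    by_cases hp : (q : ℤ) ∣ (p : ℤ) - a
    · rw [if_pos (e3.mpr hp), if_pos hp, mul_comm]
    · rw [if_neg (fun h => hp (e3.mp h)), if_neg hp, mul_zero]
  have e4 : (q : ℝ) * ‖∑ p ∈ s with ((p : ℕ) : ℤ) ≡ a [ZMOD (q : ℤ)], ex (t p)‖ ≤ q * B := by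
    have : ‖(q : ℂ)‖ = q := by simp
    rw [← this, ← norm_mul, e1, this]
    refine (norm_sum_le _ _).trans ?_
    calc _ ≤ ∑ k ∈ range q, B := sum_le_sum fun k _ => by
          rw [norm_mul, norm_ex, one_mul]
          exact hB _
      _ = q * B := by simp
  exact le_of_mul_le_mul_left e4 hq0

end

/-! ### Sawtooth sums over primes in arithmetic progressions. -/

section

open Finset

/-- Brings the F^(1/4) term of the exponential sum bound to the shape 1 + √(hδ) required by
`abs_sum_saw_le`. -/
lemma rpow_quarter_le {y : ℝ} (hy : 0 ≤ y) : y ^ (1 / 4 : ℝ) ≤ 1 + √y := by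
  rcases le_total y 1 with h | h
  · have : y ^ (1 / 4 : ℝ) ≤ 1 := Real.rpow_le_one hy h (by norm_num)
    linarith [Real.sqrt_nonneg y]
  · have : y ^ (1 / 4 : ℝ) ≤ √y := by
      rw [Real.sqrt_eq_rpow]
      exact Real.rpow_le_rpow_of_exponent_le h (by norm_num)
    linarith

/-- Writing `h = (h x ^ (E - 1)) x ^ (1 - E)` in a monomial bound. -/
lemma monomial_le {x h γ E e s : ℝ} (hx : 1 ≤ x) (hh : 0 < h) (hE : e + γ * s + (1 - E) * s ≤ E) :
    x ^ e * (h * x ^ γ) ^ s ≤ x ^ E * (h * x ^ (E - 1)) ^ s := by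
  have hx0 : 0 < x := by linarith
  rw [Real.mul_rpow hh.le (by positivity), Real.mul_rpow hh.le (by positivity),
    ← Real.rpow_mul hx0.le, ← Real.rpow_mul hx0.le]
  calc x ^ e * (h ^ s * x ^ (γ * s)) = h ^ s * x ^ (e + γ * s) := by
        rw [Real.rpow_add hx0]
        ring
    _ ≤ h ^ s * x ^ (E + (E - 1) * s) := by
        refine mul_le_mul_of_nonneg_left ?_ (by positivity)
        exact Real.rpow_le_rpow_of_exponent_le hx (by linarith)
    _ = _ := by
        rw [Real.rpow_add hx0]
        ring

/-- The sawtooth sum over primes in a dyadic block and in an arithmetic progression. -/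
theorem abs_sum_saw_block_le {κ β γ E ε : ℝ} (hκ : 0 < κ) (hγ : 11 / 12 < γ) (hγ1 : γ < 1)
    (hE0 : 11 / 12 ≤ E) (hE1 : E < 1) (hE2 : 2 / 3 + γ / 4 + (1 - E) / 4 ≤ E)
    (hε : 0 < ε) :
    ∃ C : ℝ, 0 < C ∧ ∀ (X Y q : ℕ) (a : ℤ), 2 ≤ X → 4 * |β| ≤ γ * X → X ≤ Y → Y ≤ 3 * X → 1 ≤ q →
      |∑ p ∈ Ioc X Y with p.Prime ∧ ((p : ℕ) : ℤ) ≡ a [ZMOD (q : ℤ)], saw (-(κ * (p - β) ^ γ))| ≤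
        C * (X : ℝ) ^ (E + ε) := by
  -- A factor x^η is lost twice: in the exponential sum, and in δ^(-η) ≤ x^η.
  set η := min (ε / 2) (1 / 2) with hη
  have hη0 : 0 < η := lt_min (by linarith) (by norm_num)
  have hη1 : η ≤ 1 / 2 := min_le_right _ _
  have hη2 : 2 * η ≤ ε := by
    have : η ≤ ε / 2 := min_le_left _ _
    linarith
  obtain ⟨C₀, hC₀, hexp⟩ := norm_sum_primes_phase_le (β := β) hκ hγ hγ1 hη0
  set Z := ∑' n : ℕ, (n : ℝ) ^ (-(1 + η)) with hZ
  have hZ0 : 0 ≤ Z := tsum_nonneg fun n => by positivity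
  refine ⟨2 + Z * (3 * C₀), by positivity, ?_⟩
  intro X Y q a hX hβ hXY hY hq
  set x : ℝ := (X : ℝ) with hx
  have hx2 : 2 ≤ x := by rw [hx]; exact_mod_cast hX
  have hx1 : 1 ≤ x := by linarith
  have hx0 : 0 < x := by linarith
  -- With at most 2x terms, the smoothing error is at most 2xδ = 2x^E.
  set δ := x ^ (E - 1) with hδ
  have hδ0 : 0 < δ := by positivity
  have hδ1 : δ < 1 := Real.rpow_lt_one_of_one_lt_of_neg (by linarith) (by linarith)
  have hS : ∀ h : ℕ, 1 ≤ h →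
      ‖∑ p ∈ Ioc X Y with p.Prime ∧ ((p : ℕ) : ℤ) ≡ a [ZMOD (q : ℤ)],
        ex (h * (-(κ * (p - β) ^ γ)))‖ ≤ 3 * C₀ * x ^ (E + η) * (1 + √(h * δ)) := by
    intro h hh
    have hh1 : (1 : ℝ) ≤ h := by exact_mod_cast hh
    have hh0 : (0 : ℝ) < h := by linarith
    rw [← filter_filter]
    refine norm_sum_ap_le _ (fun p => h * (-(κ * ((p : ℝ) - β) ^ γ))) hq a fun θ => ?_
    have e1 : ∀ p : ℕ, (h : ℝ) * (-(κ * ((p : ℝ) - β) ^ γ)) + θ * p = phase (κ * h) β γ θ p := by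
      intro p
      rw [phase]
      ring
    simp only [e1]
    refine (hexp X Y h θ (by omega) hβ hXY hY hh1).trans ?_
    set y := (h : ℝ) * δ with hy
    have hy0 : 0 ≤ y := by positivity
    have hsy : 0 ≤ √y := Real.sqrt_nonneg y
    have t1 : x ^ (11 / 12 : ℝ) ≤ x ^ E * (1 + √y) := by
      have : x ^ (11 / 12 : ℝ) ≤ x ^ E := Real.rpow_le_rpow_of_exponent_le hx1 hE0
      have : 0 ≤ x ^ E * √y := by positivity
      linarith
    have t2 : x ^ (2 / 3 : ℝ) * (h * x ^ γ) ^ (1 / 4 : ℝ) ≤ x ^ E * (1 + √y) := by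
      refine (monomial_le hx1 hh0 (E := E) (by linarith)).trans ?_
      gcongr
      exact rpow_quarter_le hy0
    have t3 : x ^ (1 / 3 : ℝ) * (h * x ^ γ) ^ (1 / 2 : ℝ) ≤ x ^ E * (1 + √y) := by
      refine (monomial_le hx1 hh0 (E := E) (by linarith)).trans ?_
      rw [← Real.sqrt_eq_rpow]
      gcongr
      linarith
    calc C₀ * x ^ η * (x ^ (11 / 12 : ℝ) + x ^ (2 / 3 : ℝ) * (h * x ^ γ) ^ (1 / 4 : ℝ) +
          x ^ (1 / 3 : ℝ) * (h * x ^ γ) ^ (1 / 2 : ℝ)) ≤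
          C₀ * x ^ η * (x ^ E * (1 + √y) + x ^ E * (1 + √y) + x ^ E * (1 + √y)) := by gcongr
      _ = _ := by
          rw [Real.rpow_add hx0]
          ring
  have key := abs_sum_saw_le _ _ hδ0 hδ1 hη0 hη1 hS
  rw [← hZ] at key
  refine key.trans ?_
  have hcard : (#{p ∈ Ioc X Y | p.Prime ∧ ((p : ℕ) : ℤ) ≡ a [ZMOD (q : ℤ)]} : ℝ) ≤ 2 * x := by
    have h1 := card_filter_le (Ioc X Y) (fun p => p.Prime ∧ ((p : ℕ) : ℤ) ≡ a [ZMOD (q : ℤ)])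
    rw [Nat.card_Ioc] at h1
    rw [hx]
    exact_mod_cast h1.trans (by omega)
  have k1 : x * δ ≤ x ^ (E + ε) := by
    calc x * δ = x ^ E := by
          rw [hδ, Real.rpow_sub_one hx0.ne']
          field_simp
      _ ≤ _ := Real.rpow_le_rpow_of_exponent_le hx1 (by linarith)
  have k2 : x ^ (E + η) * δ ^ (-η) ≤ x ^ (E + ε) := by
    rw [hδ, ← Real.rpow_mul hx0.le, ← Real.rpow_add hx0]
    exact Real.rpow_le_rpow_of_exponent_le hx1 (by nlinarith)
  calc _ ≤ 2 * x * δ + Z * (3 * C₀ * x ^ (E + η)) * δ ^ (-η) := by gcongr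
    _ = 2 * (x * δ) + Z * (3 * C₀) * (x ^ (E + η) * δ ^ (-η)) := by ring
    _ ≤ 2 * x ^ (E + ε) + Z * (3 * C₀) * x ^ (E + ε) := by gcongr
    _ = _ := by ring

/-- The sawtooth sum over primes in an arithmetic progression. -/
theorem abs_sum_saw_primes_le {κ β γ E ε : ℝ} (hκ : 0 < κ) (hγ : 11 / 12 < γ) (hγ1 : γ < 1)
    (hE0 : 11 / 12 ≤ E) (hE1 : E < 1) (hE2 : 2 / 3 + γ / 4 + (1 - E) / 4 ≤ E)
    (hε : 0 < ε) :
    ∃ N₁ : ℕ, ∀ N₀ : ℕ, N₁ ≤ N₀ → ∃ C : ℝ, 0 < C ∧ ∀ (q : ℕ) (a : ℤ), 1 ≤ q → ∀ N : ℕ,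
      |∑ p ∈ Ioc N₀ N with p.Prime ∧ ((p : ℕ) : ℤ) ≡ a [ZMOD (q : ℤ)], saw (-(κ * (p - β) ^ γ))| ≤
        C * (N : ℝ) ^ (E + ε) := by
  obtain ⟨C₀, hC₀, hblock⟩ := abs_sum_saw_block_le (β := β) hκ hγ hγ1 hE0 hE1 hE2 hε
  -- Beyond this threshold every block has X ≥ 2 and 4|β| ≤ γX. Any larger N₀ is allowed, so that
  -- the sums for β and β - 1 can share one starting point.
  refine ⟨max 2 ⌈4 * |β| / γ⌉₊, fun N₀ hN₀ => ?_⟩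
  -- The part 4C₀ closes the halving induction through 3C/4 + C₀ ≤ C; the part 2N₀ covers N < 2N₀
  -- trivially.
  refine ⟨4 * C₀ + 2 * N₀ + 1, by positivity, ?_⟩
  intro q a hq N
  set P : ℕ → Prop := fun p => p.Prime ∧ ((p : ℕ) : ℤ) ≡ a [ZMOD (q : ℤ)] with hP
  set C := 4 * C₀ + 2 * N₀ + 1 with hC
  have hs0 : 0 < E + ε := by linarith
  induction N using Nat.strong_induction_on with
  | _ N ih =>
    rcases Nat.lt_or_ge N (2 * N₀) with hlt | hge
    · rcases Nat.eq_zero_or_pos N with rfl | hN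
      · simp
        positivity
      · have h1 : (1 : ℝ) ≤ (N : ℝ) ^ (E + ε) :=
          Real.one_le_rpow (by exact_mod_cast hN) hs0.le
        refine (abs_sum_le_sum_abs _ _).trans ?_
        calc _ ≤ ∑ p ∈ Ioc N₀ N with P p, (1 : ℝ) := sum_le_sum fun p _ => abs_saw_le _
          _ = (#((Ioc N₀ N).filter P) : ℝ) := by simp
          _ ≤ 2 * N₀ := by
              have := card_filter_le (Ioc N₀ N) P
              rw [Nat.card_Ioc] at this
              exact_mod_cast this.trans (by omega)
          _ ≤ C := by rw [hC]; linarith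
          _ ≤ _ := le_mul_of_one_le_right (by positivity) h1
    · have hN₀2 : 2 ≤ N₀ := (le_max_left _ _).trans hN₀
      set X := N / 2 with hX
      have hX0 : N₀ ≤ X := by omega
      have hβX : 4 * |β| ≤ γ * X := by
        have h1 : 4 * |β| / γ ≤ X := (Nat.le_ceil _).trans (by
          exact_mod_cast ((le_max_right _ _).trans hN₀).trans hX0)
        rw [div_le_iff₀ (by linarith)] at h1
        linarith
      have h1 := ih X (by omega)
      have h2 := hblock X N q a (by omega) hβX (by omega) (by omega) hq
      have hsplit : ∑ p ∈ Ioc N₀ N with P p, saw (-(κ * ((p : ℝ) - β) ^ γ)) =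
          ∑ p ∈ Ioc N₀ X with P p, saw (-(κ * ((p : ℝ) - β) ^ γ)) +
          ∑ p ∈ Ioc X N with P p, saw (-(κ * ((p : ℝ) - β) ^ γ)) := by
        simp only [sum_filter]
        rw [sum_Ioc_consecutive _ hX0 (by omega)]
      rw [hsplit]
      refine (abs_add_le _ _).trans ((add_le_add h1 h2).trans ?_)
      have hN0 : (0 : ℝ) ≤ N := Nat.cast_nonneg N
      have hXN : (X : ℝ) ≤ N / 2 := by
        have : X * 2 ≤ N := by omega
        have : (X : ℝ) * 2 ≤ N := by exact_mod_cast this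
        linarith
      set T := (N : ℝ) ^ (E + ε) with hT
      have hT0 : 0 ≤ T := by positivity
      -- Since E + ε ≥ 1/2, halving N gains at least a factor 1/√2 ≤ 3/4.
      have h3 : (X : ℝ) ^ (E + ε) ≤ 3 / 4 * T := by
        calc (X : ℝ) ^ (E + ε) ≤ (N / 2 : ℝ) ^ (E + ε) := by gcongr
          _ = ((2 : ℝ) ^ (E + ε))⁻¹ * T := by
              rw [Real.div_rpow hN0 (by norm_num)]
              ring
          _ ≤ 3 / 4 * T := by
              gcongr
              have h4 : √2 ≤ (2 : ℝ) ^ (E + ε) := by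
                rw [Real.sqrt_eq_rpow]
                exact Real.rpow_le_rpow_of_exponent_le (by norm_num) (by linarith)
              have h5 : 4 / 3 ≤ √2 := Real.le_sqrt_of_sq_le (by norm_num)
              rw [inv_le_comm₀ (by positivity) (by norm_num)]
              linarith
      have h6 : (X : ℝ) ^ (E + ε) ≤ T := by linarith
      have hC4 : 4 * C₀ ≤ C := by
        rw [hC]
        have : (0 : ℝ) ≤ N₀ := Nat.cast_nonneg _
        linarith
      have hC0 : 0 ≤ C := by positivity
      calc C * (X : ℝ) ^ (E + ε) + C₀ * (X : ℝ) ^ (E + ε) ≤ C * (3 / 4 * T) + C₀ * T := by gcongr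
        _ ≤ C * (3 / 4 * T) + C / 4 * T := by
            gcongr
            linarith
        _ = C * T := by ring

end

/-! ### From the indicator function to the main terms. -/

section

open Finset

/-- Membership in the sequence `⌊α n ^ c + β⌋` in terms of the inverse function. -/
lemma mem_genPiatetskiShapiro_iff {α β c : ℝ} (hα : 0 < α) (hc : 0 < c) {p : ℕ}
    (hp : 0 < (p : ℝ) - β) :
    (p : ℤ) ∈ genPiatetskiShapiro α β c ↔
      ∃ n : ℤ, α ^ (-c⁻¹) * ((p : ℝ) - β) ^ c⁻¹ ≤ n ∧
        (n : ℝ) < α ^ (-c⁻¹) * ((p : ℝ) + 1 - β) ^ c⁻¹ := by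
  have hf : ∀ u : ℝ, 0 < u → α ^ (-c⁻¹) * u ^ c⁻¹ = (u / α) ^ c⁻¹ := by
    intro u hu
    rw [Real.div_rpow hu.le hα.le, Real.rpow_neg hα.le]
    ring
  have hp1 : 0 < (p : ℝ) + 1 - β := by linarith
  rw [hf _ hp, hf _ hp1]
  have key : ∀ n : ℕ, ((p : ℤ) = ⌊α * (n : ℝ) ^ c + β⌋) ↔
      (((p : ℝ) - β) / α) ^ c⁻¹ ≤ n ∧ (n : ℝ) < (((p : ℝ) + 1 - β) / α) ^ c⁻¹ := by
    intro n
    rw [Real.rpow_inv_le_iff_of_pos (by positivity) (Nat.cast_nonneg n) hc,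
      Real.lt_rpow_inv_iff_of_pos (Nat.cast_nonneg n) (by positivity) hc, div_le_iff₀ hα,
      lt_div_iff₀ hα, eq_comm, Int.floor_eq_iff]
    push_cast
    constructor
    · rintro ⟨h1, h2⟩
      constructor <;> linarith
    · rintro ⟨h1, h2⟩
      constructor <;> linarith
  constructor
  · rintro ⟨n, _, hn⟩
    exact ⟨n, by exact_mod_cast (key n).mp hn⟩
  · rintro ⟨n, h1, h2⟩
    have hpos : (0 : ℝ) < n := lt_of_lt_of_le (by positivity) h1
    have hn0 : 0 < n := by exact_mod_cast hpos
    obtain ⟨k, rfl⟩ := Int.eq_ofNat_of_zero_le hn0.le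
    refine ⟨k, by omega, (key k).mpr ?_⟩
    exact_mod_cast And.intro h1 h2

/-- Exact at integers too, since `saw` equals -1/2 there; half-open intervals therefore need no
endpoint correction. -/
lemma ceil_eq_saw (A : ℝ) : (⌈A⌉ : ℝ) = A + saw (-A) + 1 / 2 := by
  rw [saw, Int.fract, Int.floor_neg]
  push_cast
  ring

/-- The indicator of an integer point in a half-open interval of length at most one. -/
lemma ite_exists_int_eq {A B : ℝ} (hAB : A ≤ B) (h1 : B - A ≤ 1)
    [Decidable (∃ n : ℤ, A ≤ n ∧ (n : ℝ) < B)] :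
    (if ∃ n : ℤ, A ≤ n ∧ (n : ℝ) < B then (1 : ℝ) else 0) = B - A + saw (-B) - saw (-A) := by
  -- The integers in [A, B) number ⌈B⌉ - ⌈A⌉, which is 0 or 1 because B - A ≤ 1.
  have e : B - A + saw (-B) - saw (-A) = ((⌈B⌉ - ⌈A⌉ : ℤ) : ℝ) := by
    push_cast
    rw [ceil_eq_saw, ceil_eq_saw]
    ring
  rw [e]
  have hle : ⌈A⌉ ≤ ⌈B⌉ := Int.ceil_le_ceil hAB
  have hle1 : ⌈B⌉ ≤ ⌈A⌉ + 1 := by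
    rw [Int.ceil_le]
    push_cast
    linarith [Int.le_ceil A]
  split_ifs with h
  · obtain ⟨n, hn1, hn2⟩ := h
    have h2 : ⌈A⌉ ≤ n := Int.ceil_le.mpr hn1
    have h3 : n < ⌈B⌉ := Int.lt_ceil.mpr hn2
    have : ⌈B⌉ - ⌈A⌉ = 1 := by omega
    rw [this]
    simp
  · have h4 : ¬ ⌈A⌉ < ⌈B⌉ := fun hlt => h ⟨⌈A⌉, Int.le_ceil A, Int.lt_ceil.mp hlt⟩
    have : ⌈B⌉ - ⌈A⌉ = 0 := by omega
    rw [this]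
    simp

/-- The increment of `κ (u - β) ^ γ` over a unit step. -/
lemma increment_bounds {κ β γ p : ℝ} (hκ : 0 < κ) (hκ1 : κ ≤ 1) (hγ0 : 0 < γ) (hγ1 : γ < 1)
    (hp : 2 * |β| + 2 ≤ p) :
    0 ≤ κ * (p + 1 - β) ^ γ - κ * (p - β) ^ γ ∧ κ * (p + 1 - β) ^ γ - κ * (p - β) ^ γ ≤ 1 ∧
      |κ * (p + 1 - β) ^ γ - κ * (p - β) ^ γ - κ * γ * p ^ (γ - 1)| ≤
        κ * γ * (4 * (1 + |β|)) * p ^ (γ - 2) := by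
  have hβ1 := neg_abs_le β
  have hβ2 := le_abs_self β
  have hβ0 := abs_nonneg β
  have hder : ∀ u ∈ Set.Icc (p - β) (p + 1 - β),
      HasDerivAt (fun u => κ * u ^ γ) (κ * (γ * u ^ (γ - 1))) u := by
    intro u hu
    exact (Real.hasDerivAt_rpow_const (Or.inl (by linarith [hu.1] : (0 : ℝ) < u).ne')).const_mul κ
  -- The increment is κγv^(γ-1) with v within 1 + |β| of p; a mean value inequality on [p/2, ∞) then
  -- replaces v by p.
  obtain ⟨v, hv, hv'⟩ := exists_hasDerivAt_eq_slope (fun u => κ * u ^ γ)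
    (fun u => κ * (γ * u ^ (γ - 1))) (by linarith : p - β < p + 1 - β)
    (fun u hu => (hder u hu).continuousAt.continuousWithinAt)
    (fun u hu => hder u (Set.Ioo_subset_Icc_self hu))
  have e1 : p + 1 - β - (p - β) = 1 := by ring
  rw [e1, div_one] at hv'
  rw [← hv']
  have hv1 : 1 ≤ v := by linarith [hv.1]
  have hvp : p / 2 ≤ v := by linarith [hv.1]
  have hp0 : 0 < p := by linarith
  refine ⟨by positivity, ?_, ?_⟩
  · have h1 : v ^ (γ - 1) ≤ 1 := Real.rpow_le_one_of_one_le_of_nonpos hv1 (by linarith)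
    have h2 : γ * v ^ (γ - 1) ≤ 1 := mul_le_one₀ hγ1.le (by positivity) h1
    exact mul_le_one₀ hκ1 (by positivity) h2
  · have hM : ∀ w ∈ Set.Ici (p / 2), ‖(γ - 1) * w ^ (γ - 1 - 1)‖ ≤ 4 * p ^ (γ - 2) := by
      intro w hw
      have hw : p / 2 ≤ w := hw
      have hw0 : 0 < w := by linarith
      rw [norm_mul, Real.norm_eq_abs, Real.norm_of_nonneg (by positivity)]
      have h1 : |γ - 1| ≤ 1 := by
        rw [abs_le]
        constructor <;> linarith
      have h2 : w ^ (γ - 1 - 1) ≤ 4 * p ^ (γ - 2) := by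
        have e2 : γ - 1 - 1 = γ - 2 := by ring
        rw [e2]
        calc w ^ (γ - 2) ≤ (p / 2) ^ (γ - 2) :=
              Real.rpow_le_rpow_of_nonpos (by positivity) hw (by linarith)
          _ = (2 : ℝ) ^ (2 - γ) * p ^ (γ - 2) := by
              rw [Real.div_rpow hp0.le (by norm_num), show 2 - γ = -(γ - 2) by ring,
                Real.rpow_neg (by norm_num)]
              ring
          _ ≤ (2 : ℝ) ^ (2 : ℝ) * p ^ (γ - 2) := by
              gcongr
              · norm_num
              · linarith
          _ = _ := by norm_num
      calc |γ - 1| * w ^ (γ - 1 - 1) ≤ 1 * (4 * p ^ (γ - 2)) := by gcongr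
        _ = _ := one_mul _
    have hmv := Convex.norm_image_sub_le_of_norm_hasDerivWithin_le
      (f := fun w : ℝ => w ^ (γ - 1)) (f' := fun w => (γ - 1) * w ^ (γ - 1 - 1))
      (s := Set.Ici (p / 2)) (x := p) (y := v) (C := 4 * p ^ (γ - 2))
      (fun w hw => (Real.hasDerivAt_rpow_const
        (Or.inl (lt_of_lt_of_le (by positivity) hw : (0 : ℝ) < w).ne')).hasDerivWithinAt)
      hM (convex_Ici _) (by simp; linarith) hvp
    rw [Real.norm_eq_abs, Real.norm_eq_abs] at hmv
    have hvp' : |v - p| ≤ 1 + |β| := by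
      rw [abs_le]
      constructor <;> linarith [hv.1, hv.2]
    have e3 : κ * (γ * v ^ (γ - 1)) - κ * γ * p ^ (γ - 1) =
        κ * γ * (v ^ (γ - 1) - p ^ (γ - 1)) := by ring
    rw [e3, abs_mul, abs_of_pos (by positivity)]
    calc κ * γ * |v ^ (γ - 1) - p ^ (γ - 1)| ≤ κ * γ * (4 * p ^ (γ - 2) * (1 + |β|)) := by
          gcongr
          exact hmv.trans (by gcongr)
      _ = _ := by ring

lemma primeCountAP_eq_card (x : ℝ) (hx : 0 ≤ x) (q : ℕ) (a : ℤ) :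
    primeCountAP x q a =
      #{p ∈ Ioc 0 ⌊x⌋₊ | p.Prime ∧ ((p : ℕ) : ℤ) ≡ a [ZMOD (q : ℤ)]} := by
  rw [primeCountAP, ← Set.ncard_coe_finset]
  congr 1
  ext p
  simp only [Set.mem_ofPred_eq, coe_filter, mem_Ioc, Nat.le_floor_iff hx]
  constructor
  · rintro ⟨h1, h2, h3⟩
    exact ⟨⟨h1.pos, h2⟩, h1, h3⟩
  · rintro ⟨⟨_, h2⟩, h1, h3⟩
    exact ⟨h1, h2, h3⟩

open Classical in
lemma primeCountGPS_eq_sum (α β c x : ℝ) (hx : 0 ≤ x) (q : ℕ) (a : ℤ) :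
    (primeCountGPS α β c x q a : ℝ) =
      ∑ p ∈ Ioc 0 ⌊x⌋₊ with p.Prime ∧ ((p : ℕ) : ℤ) ≡ a [ZMOD (q : ℤ)],
        if (p : ℤ) ∈ genPiatetskiShapiro α β c then (1 : ℝ) else 0 := by
  rw [sum_boole, filter_filter, primeCountGPS, ← Set.ncard_coe_finset]
  congr 2
  ext p
  simp only [Set.mem_ofPred_eq, coe_filter, mem_Ioc, Nat.le_floor_iff hx]
  constructor
  · rintro ⟨h1, h2, h3, h4⟩
    exact ⟨⟨h1.pos, h2⟩, ⟨h1, h4⟩, h3⟩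
  · rintro ⟨⟨_, h2⟩, ⟨h1, h4⟩, h3⟩
    exact ⟨h1, h2, h3, h4⟩

/-- Abel summation for `∑ p ^ (γ - 1)` over primes in an arithmetic progression. -/
lemma sum_primes_rpow_eq {γ x : ℝ} (hx : 2 ≤ x) (q : ℕ) (a : ℤ) :
    ∑ p ∈ Ioc 0 ⌊x⌋₊ with p.Prime ∧ ((p : ℕ) : ℤ) ≡ a [ZMOD (q : ℤ)], (p : ℝ) ^ (γ - 1) =
      x ^ (γ - 1) * (primeCountAP x q a : ℝ)
        + (1 - γ) * ∫ u in (2 : ℝ)..x, u ^ (γ - 2) * (primeCountAP u q a : ℝ) := by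
  set c : ℕ → ℝ := fun n => if n.Prime ∧ ((n : ℕ) : ℤ) ≡ a [ZMOD (q : ℤ)] then 1 else 0 with hc
  have hc0 : c 0 = 0 := by simp [hc, Nat.not_prime_zero]
  have hc1 : c 1 = 0 := by simp [hc, Nat.not_prime_one]
  have hcount : ∀ u : ℝ, 0 ≤ u → ∑ k ∈ Icc 0 ⌊u⌋₊, c k = (primeCountAP u q a : ℝ) := by
    intro u hu
    rw [primeCountAP_eq_card u hu, ← add_sum_Ioc_eq_sum_Icc (Nat.zero_le _), hc0, zero_add, hc,
      sum_boole]
  have hd : ∀ t : ℝ, 0 < t → HasDerivAt (fun t : ℝ => t ^ (γ - 1)) ((γ - 1) * t ^ (γ - 2)) t := by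
    intro t ht
    have := Real.hasDerivAt_rpow_const (x := t) (p := γ - 1) (Or.inl ht.ne')
    rwa [show γ - 1 - 1 = γ - 2 by ring] at this
  have hint : MeasureTheory.IntegrableOn (deriv fun t : ℝ => t ^ (γ - 1)) (Set.Icc 2 x) := by
    have h1 : ContinuousOn (fun t : ℝ => (γ - 1) * t ^ (γ - 2)) (Set.Icc 2 x) := by
      intro t ht
      have : (0 : ℝ) < t := by linarith [ht.1]
      exact ((Real.continuousAt_rpow_const t (γ - 2) (Or.inl this.ne')).const_mul
        (γ - 1)).continuousWithinAt
    refine (h1.integrableOn_Icc).congr_fun (fun t ht => ?_) measurableSet_Icc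
    exact ((hd t (by linarith [ht.1])).deriv).symm
  -- Because c vanishes at 0 and 1, the integral may start at 2.
  have key := sum_mul_eq_sub_integral_mul₁ c (f := fun t : ℝ => t ^ (γ - 1)) hc0 hc1 x
    (fun t ht => (hd t (by linarith [ht.1])).differentiableAt) hint
  rw [hcount x (by linarith)] at key
  have e1 : ∑ k ∈ Icc 0 ⌊x⌋₊, (k : ℝ) ^ (γ - 1) * c k =
      ∑ p ∈ Ioc 0 ⌊x⌋₊ with p.Prime ∧ ((p : ℕ) : ℤ) ≡ a [ZMOD (q : ℤ)], (p : ℝ) ^ (γ - 1) := by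
    rw [← add_sum_Ioc_eq_sum_Icc (f := fun k : ℕ => (k : ℝ) ^ (γ - 1) * c k) (Nat.zero_le _), hc0,
      mul_zero, zero_add, sum_filter]
    refine sum_congr rfl fun k _ => ?_
    simp only [hc, mul_ite, mul_one, mul_zero]
  have e2 : ∫ t in Set.Ioc 2 x, deriv (fun t : ℝ => t ^ (γ - 1)) t * ∑ k ∈ Icc 0 ⌊t⌋₊, c k =
      (γ - 1) * ∫ u in (2 : ℝ)..x, u ^ (γ - 2) * (primeCountAP u q a : ℝ) := by
    rw [intervalIntegral.integral_of_le hx, ← MeasureTheory.integral_const_mul]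
    refine MeasureTheory.setIntegral_congr_fun measurableSet_Ioc fun t ht => ?_
    have ht0 : 0 < t := by linarith [ht.1]
    rw [(hd t ht0).deriv, hcount t ht0.le]
    ring
  rw [← e1, key, e2]
  ring

/-- The Piatetski-Shapiro indicator minus its expected value, summed over large primes in an
arithmetic progression. -/
theorem abs_sum_indicator_sub_le {α β c γ E ε : ℝ} (hα : 1 ≤ α) (hc : 0 < c) (hγc : γ = c⁻¹)
    (hγ : 11 / 12 < γ) (hγ1 : γ < 1) (hE0 : 11 / 12 ≤ E) (hE1 : E < 1)
    (hE2 : 2 / 3 + γ / 4 + (1 - E) / 4 ≤ E) (hε : 0 < ε)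
    [DecidablePred fun p : ℕ => (p : ℤ) ∈ genPiatetskiShapiro α β c] :
    ∃ (N₀ : ℕ) (C : ℝ), 0 < C ∧ ∀ (q : ℕ) (a : ℤ), 1 ≤ q → ∀ N : ℕ, 1 ≤ N →
      |∑ p ∈ Ioc N₀ N with p.Prime ∧ ((p : ℕ) : ℤ) ≡ a [ZMOD (q : ℤ)],
        ((if (p : ℤ) ∈ genPiatetskiShapiro α β c then (1 : ℝ) else 0)
          - α ^ (-γ) * γ * (p : ℝ) ^ (γ - 1))| ≤ C * (N : ℝ) ^ (E + ε) := by
  set κ := α ^ (-γ) with hκdef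
  have hκ : 0 < κ := by positivity
  have hκ1 : κ ≤ 1 := Real.rpow_le_one_of_one_le_of_nonpos hα (by linarith)
  obtain ⟨N₁, h₁⟩ := abs_sum_saw_primes_le (β := β) hκ hγ hγ1 hE0 hE1 hE2 hε
  -- Since p + 1 - β = p - (β - 1), the right endpoints give the same kind of sum with β replaced by
  -- β - 1.
  obtain ⟨N₂, h₂⟩ := abs_sum_saw_primes_le (β := β - 1) hκ hγ hγ1 hE0 hE1 hE2 hε
  set N₀ := max (max N₁ N₂) ⌈2 * |β| + 2⌉₊ with hN₀
  obtain ⟨C₁, hC₁, h₁'⟩ := h₁ N₀ ((le_max_left _ _).trans (le_max_left _ _))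
  obtain ⟨C₂, hC₂, h₂'⟩ := h₂ N₀ ((le_max_right _ _).trans (le_max_left _ _))
  -- As γ - 2 < -1, the errors in the interval lengths add up to a constant, uniformly in q and a.
  have hsm : Summable (fun n : ℕ => (n : ℝ) ^ (γ - 2)) :=
    Real.summable_nat_rpow.mpr (by linarith)
  set Z := ∑' n : ℕ, (n : ℝ) ^ (γ - 2) with hZ
  have hZ0 : 0 ≤ Z := tsum_nonneg fun n => by positivity
  set B := κ * γ * (4 * (1 + |β|)) with hB
  have hγ0 : 0 < γ := by linarith
  have hB0 : 0 ≤ B := by positivity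
  refine ⟨N₀, C₁ + C₂ + B * Z, by positivity, ?_⟩
  intro q a hq N hN
  set s := (Ioc N₀ N).filter (fun p => p.Prime ∧ ((p : ℕ) : ℤ) ≡ a [ZMOD (q : ℤ)]) with hs
  have hlarge : ∀ p ∈ s, 2 * |β| + 2 ≤ (p : ℝ) := by
    intro p hp
    have h1 : N₀ < p := (mem_Ioc.mp (mem_filter.mp hp).1).1
    have h2 : 2 * |β| + 2 ≤ (N₀ : ℝ) :=
      (Nat.le_ceil _).trans (by exact_mod_cast le_max_right _ _)
    have h3 : (N₀ : ℝ) ≤ p := by exact_mod_cast h1.le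
    linarith
  have hpt : ∀ p ∈ s, (if (p : ℤ) ∈ genPiatetskiShapiro α β c then (1 : ℝ) else 0)
      - κ * γ * (p : ℝ) ^ (γ - 1) =
      (κ * ((p : ℝ) + 1 - β) ^ γ - κ * ((p : ℝ) - β) ^ γ - κ * γ * (p : ℝ) ^ (γ - 1))
      + saw (-(κ * ((p : ℝ) - (β - 1)) ^ γ)) - saw (-(κ * ((p : ℝ) - β) ^ γ)) := by
    intro p hp
    have hpl := hlarge p hp
    obtain ⟨i1, i2, _⟩ := increment_bounds hκ hκ1 hγ0 hγ1 hpl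
    have hpos : 0 < (p : ℝ) - β := by linarith [le_abs_self β, abs_nonneg β]
    have hiff := mem_genPiatetskiShapiro_iff (lt_of_lt_of_le one_pos hα) hc hpos
    rw [← hγc, ← hκdef] at hiff
    classical
    have e := ite_exists_int_eq (sub_nonneg.mp i1) i2
    have e2 : (if (p : ℤ) ∈ genPiatetskiShapiro α β c then (1 : ℝ) else 0) =
        if ∃ n : ℤ, κ * ((p : ℝ) - β) ^ γ ≤ n ∧ (n : ℝ) < κ * ((p : ℝ) + 1 - β) ^ γ then (1 : ℝ)
          else 0 := if_congr hiff rfl rfl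
    have e3 : (p : ℝ) - (β - 1) = p + 1 - β := by ring
    rw [e2, e, e3]
    ring
  rw [sum_congr rfl hpt, sum_sub_distrib, sum_add_distrib]
  have b1 : |∑ p ∈ s, (κ * ((p : ℝ) + 1 - β) ^ γ - κ * ((p : ℝ) - β) ^ γ -
      κ * γ * (p : ℝ) ^ (γ - 1))| ≤ B * Z := by
    refine (abs_sum_le_sum_abs _ _).trans ?_
    calc _ ≤ ∑ p ∈ s, B * (p : ℝ) ^ (γ - 2) :=
          sum_le_sum fun p hp => (increment_bounds hκ hκ1 hγ0 hγ1 (hlarge p hp)).2.2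
      _ = B * ∑ p ∈ s, (p : ℝ) ^ (γ - 2) := by rw [mul_sum]
      _ ≤ B * Z := by
          gcongr
          exact hsm.sum_le_tsum s (fun n _ => by positivity)
  have b2 := h₁' q a hq N
  have b3 := h₂' q a hq N
  have hT : 1 ≤ (N : ℝ) ^ (E + ε) := Real.one_le_rpow (by exact_mod_cast hN) (by linarith)
  have b4 : B * Z ≤ B * Z * (N : ℝ) ^ (E + ε) := le_mul_of_one_le_right (by positivity) hT
  refine (abs_sub _ _).trans ?_
  refine (add_le_add ((abs_add_le _ _).trans (add_le_add b1 b3)) b2).trans ?_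
  linarith

end

end PiatetskiShapiro

/-! ### Assembly: choice of E and removal of the small primes. -/

theorem theorem1 (α β c γ ε : ℝ) (hα : 1 ≤ α) (hc₁ : 1 < c) (hc₂ : c < 12 / 11)
    (hγ : γ = c⁻¹) (hε : 0 < ε) :
    ∃ C : ℝ, 0 < C ∧ ∀ (q : ℕ) (a : ℤ), 1 ≤ q → IsCoprime a (q : ℤ) → ∀ x : ℝ, 2 ≤ x →
      |(primeCountGPS α β c x q a : ℝ)
          - (α ^ (-γ) * γ * x ^ (γ - 1) * (primeCountAP x q a : ℝ)
            + α ^ (-γ) * γ * (1 - γ)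
              * ∫ u in (2 : ℝ)..x, u ^ (γ - 2) * (primeCountAP u q a : ℝ))|
        ≤ C * x ^ (7 * γ / 13 + 11 / 26 + ε) := by
  classical
  have hγ1 : γ < 1 := by
    rw [hγ]
    exact inv_lt_one_of_one_lt₀ hc₁
  have hγ0 : 11 / 12 < γ := by
    rw [hγ, lt_inv_comm₀ (by norm_num) (by linarith)]
    norm_num
    exact hc₂
  set E := 7 * γ / 13 + 11 / 26 with hE
  -- For this E, both 11/12 ≤ E and 2/3 + γ/4 + (1-E)/4 ≤ E are equivalent to γ ≥ 11/12, with
  -- equality at γ = 11/12; E < 1 follows from γ < 1.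
  obtain ⟨N₀, C, hC, hmain⟩ := PiatetskiShapiro.abs_sum_indicator_sub_le (α := α) (β := β) (c := c)
    (E := E) hα (by linarith) hγ hγ0 hγ1 (by linarith) (by linarith) (by linarith) hε
  have hκ : 0 < α ^ (-γ) := by positivity
  have hκ1 : α ^ (-γ) ≤ 1 := Real.rpow_le_one_of_one_le_of_nonpos hα (by linarith)
  refine ⟨C + N₀, by positivity, ?_⟩
  intro q a hq _ x hx
  have hx0 : 0 ≤ x := by linarith
  set N := ⌊x⌋₊ with hN
  have hN2 : 2 ≤ N := Nat.le_floor (by exact_mod_cast hx)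
  have hNx : (N : ℝ) ≤ x := Nat.floor_le hx0
  set P : ℕ → Prop := fun p => p.Prime ∧ ((p : ℕ) : ℤ) ≡ a [ZMOD (q : ℤ)] with hP
  set F : ℕ → ℝ := fun p => (if (p : ℤ) ∈ genPiatetskiShapiro α β c then (1 : ℝ) else 0)
    - α ^ (-γ) * γ * (p : ℝ) ^ (γ - 1) with hF
  have e1 : (primeCountGPS α β c x q a : ℝ)
      - (α ^ (-γ) * γ * x ^ (γ - 1) * (primeCountAP x q a : ℝ)
        + α ^ (-γ) * γ * (1 - γ) * ∫ u in (2 : ℝ)..x, u ^ (γ - 2) * (primeCountAP u q a : ℝ)) =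
      ∑ p ∈ Finset.Ioc 0 N with P p, F p := by
    have h1 := PiatetskiShapiro.sum_primes_rpow_eq (γ := γ) hx q a
    have h2 := PiatetskiShapiro.primeCountGPS_eq_sum α β c x hx0 q a
    simp only [hF]
    rw [Finset.sum_sub_distrib, ← Finset.mul_sum, h1, h2]
    ring
  have e2 : ∑ p ∈ Finset.Ioc 0 N with P p, F p =
      ∑ p ∈ Finset.Ioc 0 (min N₀ N) with P p, F p + ∑ p ∈ Finset.Ioc N₀ N with P p, F p := by
    simp only [Finset.sum_filter]
    rcases le_total N₀ N with h | h
    · rw [min_eq_left h, Finset.sum_Ioc_consecutive _ (Nat.zero_le _) h]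
    · rw [min_eq_right h, Finset.Ioc_eq_empty_of_le h, Finset.sum_empty, add_zero]
  -- The indicator and its expected value both lie in [0, 1], so each small prime contributes at
  -- most 1.
  have b1 : |∑ p ∈ Finset.Ioc 0 (min N₀ N) with P p, F p| ≤ N₀ := by
    refine (Finset.abs_sum_le_sum_abs _ _).trans ?_
    calc _ ≤ ∑ p ∈ Finset.Ioc 0 (min N₀ N) with P p, (1 : ℝ) := by
          refine Finset.sum_le_sum fun p hp => ?_
          have hp1 : (1 : ℝ) ≤ p := by
            exact_mod_cast (Finset.mem_Ioc.mp (Finset.mem_filter.mp hp).1).1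
          have h1 : (p : ℝ) ^ (γ - 1) ≤ 1 :=
            Real.rpow_le_one_of_one_le_of_nonpos hp1 (by linarith)
          have h2 : α ^ (-γ) * γ * (p : ℝ) ^ (γ - 1) ≤ 1 :=
            mul_le_one₀ (mul_le_one₀ hκ1 (by linarith) hγ1.le) (by positivity) h1
          have h3 : 0 ≤ α ^ (-γ) * γ * (p : ℝ) ^ (γ - 1) := by
            have : 0 < γ := by linarith
            positivity
          simp only [hF]
          rw [abs_le]
          split_ifs <;> constructor <;> linarith
      _ = (Finset.card ((Finset.Ioc 0 (min N₀ N)).filter P) : ℝ) := by simp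
      _ ≤ N₀ := by
          have := Finset.card_filter_le (Finset.Ioc 0 (min N₀ N)) P
          rw [Nat.card_Ioc] at this
          exact_mod_cast this.trans (by omega)
  have b2 := hmain q a hq N (by omega)
  have hEε : 0 ≤ E + ε := by linarith
  have b3 : (N : ℝ) ^ (E + ε) ≤ x ^ (E + ε) := by gcongr
  have b4 : 1 ≤ x ^ (E + ε) := Real.one_le_rpow (by linarith) hEε
  rw [e1, e2]
  refine (abs_add_le _ _).trans ((add_le_add b1 b2).trans ?_)
  have b5 : C * (N : ℝ) ^ (E + ε) ≤ C * x ^ (E + ε) := by gcongr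
  have b6 : (N₀ : ℝ) ≤ N₀ * x ^ (E + ε) := le_mul_of_one_le_right (Nat.cast_nonneg _) b4
  linarith
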